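/- Let $k$ be a field and let $A$ be a complete normal Noetherian local $k$-algebra with residue field $k$ and $\dim A\ge 2$. Put $X=\operatorname{Spec}A$, let $x\in X(k)$ be the point given by the maximal ideal, and $U=X\setminus\{x\}$. For a $k$-group-scheme $G$, a $G$-principal bundle over a $k$-scheme $S$ is an affine, flat, surjective $k$-morphism $h\colon V\to S$ with an action of $G$ on $V$ over $S$ such that $V\times_kG\to V\times_SV$, $(v,g)\mapsto(v,vg)$, is an isomorphism; a morphism of principal bundles is an $S$-morphism $f\colon V_1\to V_2$ together with a homomorphism $\varphi\colon G_1\to G_2$ such that $f(vg)=f(v)\varphi(g)$. For a principal bundle $h\colon V\to U$, its integral closure is $\tilde h\colon Y=\operatorname{Spec}B\to X$, where $B$ is the integral closure of $A$ in $\Gamma(V,\mathcal O_V)$; a morphism $f\colon V_1\to V_2$ over $U$ induces $\tilde f\colon Y_1\to Y_2$. Let $\mathcal C(X,x)$ be the category of triples $(h\colon Y\to X,G,y)$ with $G$ a finite $k$-group-scheme, $h$ a $G$-principal bundle and $y\in Y(k)$ with $h(y)=x$, with the morphisms of principal bundles which respect the points. Let $\mathcal C_{\rm loc}(U,x)$ be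 the category of triples $(h\colon V\to U,G,y)$ with $G$ a finite $k$-group-scheme, $h$ a $G$-principal bundle and $y\in Y(k)$ with $\tilde h(y)=x$, where $\tilde h\colon Y\to X$ is the integral closure of $h$, with the morphisms of principal bundles for which $\tilde f(y_1)=y_2$. Let $\mathcal C^{\rm ind}(X,x)$ and $\mathcal C^{\rm ind}_{\rm loc}(U,x)$ be the corresponding categories of limits of small cofiltered systems of such triples. By definition, $\pi^N(X,x)$, resp. $\pi^N_{\rm loc}(U,x)$, is the structure group of a universal (that is, initial) object of $\mathcal C^{\rm ind}(X,x)$, resp. $\mathcal C^{\rm ind}_{\rm loc}(U,x)$, when one exists. Sending $(Y\to X,G,y)$ to $(Y\times_XU\to U,G,y)$ defines restriction functors $\rho\colon\mathcal C(X,x)\to\mathcal C_{\rm loc}(U,x)$ and $\rho\colon\mathcal C^{\rm ind}(X,x)\to\mathcal C^{\rm ind}_{\rm loc}(U,x)$. If $L$ and $T$ are universal objects of $\mathcal C^{\rm ind}_{\rm loc}(U,x)$ and $\mathcal C^{\rm ind}(X,x)$, let $\rho_*\colon\pi^N_{\rm loc}(U,x)\to\pi^N(X,x)$ be the homomorphism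 of structure groups underlying the unique morphism $L\to\rho(T)$. Then: 1. For all universal objects $L$ and $T$, the homomorphism $\rho_*\colon\pi^N_{\rm loc}(U,x)\to\pi^N(X,x)$ is faithfully flat. 2. More generally, for every object $L$ of $\mathcal C^{\rm ind}_{\rm loc}(U,x)$ (universal or not), every universal object $T$ of $\mathcal C^{\rm ind}(X,x)$ and every morphism $L\to\rho(T)$, the underlying homomorphism from the structure group of $L$ to $\pi^N(X,x)$ is faithfully flat. 3. If $(Y\to X,G,y)\in\mathcal C(X,x)$, and $\rho(Y\to X,G,y)\to(V\to U,H,v)$ is a morphism in $\mathcal C_{\rm loc}(U,x)$, then there is a $(Z\to X,H',z)\in\mathcal C(X,x)$ with $\rho(Z\to X,H',z)\cong(V\to U,H,v)$ in $\mathcal C_{\rm loc}(U,x)$ (so $H'\cong H$). -/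

import Mathlib

open CategoryTheory MonoidalCategory CartesianMonoidalCategory Limits AlgebraicGeometry
open scoped MonObj

universe u

namespace LocalNori

/-! ### Functions on the punctured spectrum -/

/-- An element `s` of the fraction field with `𝔪 ^ n s ⊆ A` lies in `A`. -/
theorem mem_range_of_forall_maximalIdeal_pow {A : Type u} [CommRing A] [IsDomain A] [IsLocalRing A]
    [IsNoetherianRing A] [IsIntegrallyClosed A] (hdim : 2 ≤ ringKrullDim A)
    (s : FractionRing A) (n : ℕ)
    (hs : ∀ a ∈ IsLocalRing.maximalIdeal A ^ n,
      algebraMap A (FractionRing A) a * s ∈ (algebraMap A (FractionRing A)).range) :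
    s ∈ (algebraMap A (FractionRing A)).range := by
  induction n generalizing s with
  | zero => simpa using hs 1 (by simp)
  | succ n ih =>
    refine ih s fun a ha ↦ ?_
    set t := algebraMap A (FractionRing A) a * s with ht
    have hmt : ∀ b ∈ IsLocalRing.maximalIdeal A,
        algebraMap A (FractionRing A) b * t ∈ (algebraMap A (FractionRing A)).range := by
      intro b hb
      rw [ht, ← mul_assoc, ← map_mul]
      exact hs _ (by rw [pow_succ']; exact Ideal.mul_mem_mul hb ha)
    have hinj := IsFractionRing.injective A (FractionRing A)
    have hne : IsLocalRing.maximalIdeal A ≠ ⊥ := by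
      intro h
      have hF := (IsLocalRing.isField_iff_maximalIdeal_eq (R := A)).2 h
      rw [ringKrullDim_eq_zero_of_isField hF] at hdim
      exact absurd hdim (by decide)
    by_cases hcase : ∀ b ∈ IsLocalRing.maximalIdeal A, ∀ c : A,
        algebraMap A (FractionRing A) c = algebraMap A (FractionRing A) b * t →
          c ∈ IsLocalRing.maximalIdeal A
    · have hint : IsIntegral A t := by
        obtain ⟨b₀, hb₀, hb₀'⟩ := Submodule.exists_mem_ne_zero_of_ne_bot hne
        let N : Submodule A (FractionRing A) :=
          Submodule.map (Algebra.linearMap A (FractionRing A)) (IsLocalRing.maximalIdeal A)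
        refine isIntegral_of_smul_mem_submodule (M := FractionRing A) N ?_ ?_ t ?_
        · intro h
          have : algebraMap A (FractionRing A) b₀ ∈ N := ⟨b₀, hb₀, rfl⟩
          rw [h, Submodule.mem_bot] at this
          exact hb₀' (hinj (by simpa using this))
        · exact (IsNoetherian.noetherian (IsLocalRing.maximalIdeal A)).map _
        · rintro _ ⟨b, hb, rfl⟩
          obtain ⟨c, hc⟩ := hmt b hb
          refine ⟨c, hcase b hb c hc, ?_⟩
          simp [hc, mul_comm]
      obtain ⟨c, hc⟩ := IsIntegrallyClosed.algebraMap_eq_of_integral hint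
      exact ⟨c, hc⟩
    · push Not at hcase
      obtain ⟨b, hb, c, hc, hcm⟩ := hcase
      have hcu : IsUnit c := by simpa using hcm
      exfalso
      have hbeq : IsLocalRing.maximalIdeal A = Ideal.span {b} := by
        apply le_antisymm
        · intro d hd
          obtain ⟨e, he⟩ := hmt d hd
          rw [Ideal.mem_span_singleton]
          obtain ⟨c', hc'⟩ := hcu.exists_left_inv
          refine ⟨c' * e, hinj ?_⟩
          have h1 : d * c = b * e := hinj (by
            simp only [map_mul]; rw [hc, he]; ring)
          have : d = b * (c' * e) := by
            calc d = d * (c' * c) := by rw [hc', mul_one]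
              _ = c' * (d * c) := by ring
              _ = _ := by rw [h1]; ring
          rw [← this]
        · rw [Ideal.span_singleton_le_iff_mem]; exact hb
      have hht : (IsLocalRing.maximalIdeal A).height ≤ 1 :=
        Ideal.height_le_one_of_isPrincipal_of_mem_minimalPrimes (Ideal.span {b}) _ (by
          rw [← hbeq, Ideal.minimalPrimes_eq_subsingleton_self]; rfl)
      rw [← IsLocalRing.maximalIdeal_height_eq_ringKrullDim] at hdim
      have h2 : (2 : ℕ∞) ≤ (IsLocalRing.maximalIdeal A).height := by
        rw [← WithBot.coe_le_coe]; exact hdim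
      exact absurd (h2.trans hht) (by decide)

theorem mem_range_of_forall_pow_mul {A R : Type u} [CommRing A] [IsDomain A] [IsLocalRing A]
    [IsNoetherianRing A] [IsIntegrallyClosed A] (hdim : 2 ≤ ringKrullDim A)
    [CommRing R] [IsDomain R] (i : A →+* R) (hi : Function.Injective i) (s : R)
    (hs : ∀ f ∈ IsLocalRing.maximalIdeal A, f ≠ 0 → ∃ (n : ℕ) (a : A), i (f ^ n) * s = i a) :
    s ∈ i.range := by
  have hinj := IsFractionRing.injective A (FractionRing A)
  have hne : IsLocalRing.maximalIdeal A ≠ ⊥ := by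
    intro h
    have hF := (IsLocalRing.isField_iff_maximalIdeal_eq (R := A)).2 h
    rw [ringKrullDim_eq_zero_of_isField hF] at hdim
    exact absurd hdim (by decide)
  obtain ⟨f, hf, hf0⟩ := Submodule.exists_mem_ne_zero_of_ne_bot hne
  obtain ⟨n, a, ha⟩ := hs f hf hf0
  have hfn : algebraMap A (FractionRing A) (f ^ n) ≠ 0 := by
    rw [Ne, map_eq_zero_iff _ hinj]; exact pow_ne_zero _ hf0
  set s' : FractionRing A := algebraMap A _ a / algebraMap A _ (f ^ n) with hs'
  have key : ∀ b c : A, i b * s = i c ↔ algebraMap A (FractionRing A) b * s' = algebraMap A _ c := by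
    intro b c
    have h1 : algebraMap A (FractionRing A) b * s' = algebraMap A _ c ↔ b * a = c * f ^ n := by
      rw [hs', ← mul_div_assoc, div_eq_iff hfn, ← map_mul, ← map_mul, hinj.eq_iff]
    have hfi : i (f ^ n) ≠ 0 := by
      rw [Ne, map_eq_zero_iff _ hi]; exact pow_ne_zero _ hf0
    rw [h1, ← hi.eq_iff, map_mul, map_mul, ← ha, ← mul_left_inj' hfi]
    constructor
    · intro h; rw [← h]; ring
    · intro h; rw [← h]; ring
  let J : Ideal A :=
    { carrier := {b | algebraMap A (FractionRing A) b * s' ∈ (algebraMap A (FractionRing A)).range}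
      add_mem' := fun {b c} hb hc ↦ by
        simp only [Set.mem_ofPred_eq, map_add, add_mul] at *
        exact add_mem hb hc
      zero_mem' := by simp
      smul_mem' := fun b c hc ↦ by
        simp only [Set.mem_ofPred_eq, smul_eq_mul, map_mul, mul_assoc] at *
        exact mul_mem ⟨b, rfl⟩ hc }
  have hJ : IsLocalRing.maximalIdeal A ≤ J.radical := by
    intro g hg
    by_cases hg0 : g = 0
    · rw [hg0]; exact zero_mem _
    obtain ⟨m, b, hb⟩ := hs g hg hg0
    exact ⟨m, b, ((key _ _).1 hb).symm⟩
  obtain ⟨N, hN⟩ := Ideal.exists_pow_le_of_le_radical_of_fg hJ (IsNoetherian.noetherian _)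
  obtain ⟨c, hc⟩ := mem_range_of_forall_maximalIdeal_pow hdim s' N (fun b hb ↦ hN hb)
  exact ⟨c, by simpa using ((key 1 c).2 (by simpa using hc.symm)).symm⟩

/-- The punctured spectrum. -/
def puncturedSpec (A : Type u) [CommRing A] [IsLocalRing A] : (Spec (.of A)).Opens :=
  ⟨{IsLocalRing.closedPoint A}ᶜ,
    ((PrimeSpectrum.isClosed_singleton_iff_isMaximal _).2
      (IsLocalRing.maximalIdeal.isMaximal A)).isOpen_compl⟩

theorem isIso_punctured_appTop {A : Type u} [CommRing A] [IsDomain A] [IsLocalRing A]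
    [IsNoetherianRing A] [IsIntegrallyClosed A] (hdim : 2 ≤ ringKrullDim A) :
    IsIso (puncturedSpec A).ι.appTop := by
  have hbot : (⊥ : PrimeSpectrum A) ∈ puncturedSpec A := by
    intro h
    have h2 := congrArg PrimeSpectrum.asIdeal (Set.mem_singleton_iff.1 h)
    have hF := (IsLocalRing.isField_iff_maximalIdeal_eq (R := A)).2 h2.symm
    rw [ringKrullDim_eq_zero_of_isField hF] at hdim
    exact absurd hdim (by decide)
  have : Nonempty (puncturedSpec A) := ⟨⟨_, hbot⟩⟩
  have : Nonempty ((puncturedSpec A : (Spec (.of A)).Opens) : Scheme) := ⟨⟨_, hbot⟩⟩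
  have : IsIntegral (Spec (.of A)) := inferInstance
  have : IsIntegral (puncturedSpec A : Scheme) := inferInstance
  let X : Scheme.{u} := Spec (.of A)
  let W : X.Opens := (puncturedSpec A).ι ''ᵁ ⊤
  have hW : ∀ p : X, p ∈ W ↔ p ∈ puncturedSpec A := by
    intro p; simp [W, X]
  have : Nonempty W := ⟨⟨_, (hW _).2 hbot⟩⟩
  let e : A ≃+* Γ(X, ⊤) := (Scheme.ΓSpecIso (.of A)).symm.commRingCatIsoToRingEquiv
  let r : Γ(X, ⊤) →+* Γ(X, W) := (X.presheaf.map (homOfLE (x := W) le_top).op).hom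
  have hr : Function.Injective r := map_injective_of_isIntegral X _
  let i : A →+* Γ(X, W) := r.comp e.toRingHom
  have hi : Function.Injective i := hr.comp e.injective
  have hsur : Function.Surjective i := by
    intro s
    refine mem_range_of_forall_pow_mul hdim i hi s fun f hf hf0 ↦ ?_
    let D : X.Opens := X.basicOpen (e f)
    have hDmem : ∀ p : PrimeSpectrum A, (p : X) ∈ D ↔ f ∉ p.asIdeal := by
      intro p
      have : D = PrimeSpectrum.basicOpen f := basicOpen_eq_of_affine (R := .of A) f
      rw [this]; rfl
    have hDW : D ≤ W := by
      intro p hp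
      rw [hW]
      intro hpc
      have hpc' : p = IsLocalRing.closedPoint A := hpc
      exact (hDmem p).1 hp (hpc' ▸ hf)
    have : Nonempty D := ⟨⟨_, (hDmem ⊥).2 hf0⟩⟩
    let q : Γ(X, W) →+* Γ(X, D) := (X.presheaf.map (homOfLE hDW).op).hom
    have hq : Function.Injective q := map_injective_of_isIntegral X _
    have hloc := (isAffineOpen_top X).isLocalization_basicOpen (e f)
    obtain ⟨n, a, ha⟩ := IsLocalization.Away.surj (e f) (q s)
    have hqr : ∀ z, q (r z) = algebraMap Γ(X, ⊤) Γ(X, D) z := by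
      intro z
      change (X.presheaf.map _ ≫ X.presheaf.map _).hom z = _
      rw [← X.presheaf.map_comp]
      rfl
    refine ⟨n, e.symm a, hq ?_⟩
    rw [map_mul]
    change q (r (e _)) * _ = q (r (e _))
    rw [hqr, hqr, e.apply_symm_apply, ← ha, mul_comm, map_pow, map_pow]
  have : IsIso ((Scheme.ΓSpecIso (.of A)).inv ≫ (puncturedSpec A).ι.appTop) := by
    rw [ConcreteCategory.isIso_iff_bijective]
    rw [Scheme.Opens.ι_appTop]
    exact ⟨hi, hsur⟩
  exact IsIso.of_isIso_comp_left (Scheme.ΓSpecIso (.of A)).inv _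

theorem isIso_appTop_of_isPullback {A : Type u} [CommRing A] [IsDomain A] [IsLocalRing A]
    [IsNoetherianRing A] [IsIso (puncturedSpec A).ι.appTop] {V V' : Scheme.{u}}
    {h : V ⟶ Spec (.of A)} {p : V' ⟶ V} {h' : V' ⟶ puncturedSpec A}
    (hp : IsPullback p h' h (puncturedSpec A).ι) [IsAffineHom h] [Flat h] : IsIso p.appTop := by
  have : IsAffine V := isAffine_of_isAffineHom h
  have : IsNoetherian (Spec (CommRingCat.of A)) := inferInstance
  have : TopologicalSpace.NoetherianSpace (puncturedSpec A) :=
    (puncturedSpec A).ι.isOpenEmbedding.isInducing.noetherianSpace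
  have : QuasiSeparatedSpace (puncturedSpec A) := inferInstance
  have key := (isIso_pushoutSection_iff hp.flip (US := ⊤) (UT := ⊤) (UX := ⊤) (UY := ⊤) le_top
    le_top (by simp)).1 (isIso_pushoutSection_of_isQuasiSeparated_of_flat_right _ _ _ _
      (isAffineOpen_top _) (isAffineOpen_top _) isCompact_univ
      (isQuasiSeparated_univ_iff.2 inferInstance))
  have h1 : (puncturedSpec A).ι.appLE ⊤ ⊤ le_top = (puncturedSpec A).ι.appTop :=
    Scheme.Hom.appLE_eq_app _
  rw [h1] at key
  have := key.isIso_inr_of_isIso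
  have h2 : p.appLE ⊤ ⊤ le_top = p.appTop := Scheme.Hom.appLE_eq_app _
  exact h2 ▸ this

lemma specMap_ΓSpecIso_conj {R S : CommRingCat.{u}} (g : Spec R ⟶ Spec S) :
    Spec.map ((Scheme.ΓSpecIso S).inv ≫ g.appTop ≫ (Scheme.ΓSpecIso R).hom) = g := by
  obtain ⟨φ, rfl⟩ := Spec.map_surjective g
  rw [← Scheme.ΓSpecIso_inv_naturality_assoc, Iso.inv_hom_id, Category.comp_id]

/-- A cofiltered limit over `S` stays a limit after base change along `j : S' ⟶ S`. -/
theorem nonempty_isLimit_of_isPullback {C : Type*} [Category C] {J : Type*} [Category J]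
    [IsCofiltered J] {S S' : C} (j : S' ⟶ S) {D D' : J ⥤ C} {c : Cone D} (hc : IsLimit c)
    (c' : Cone D') (h : ∀ i, D.obj i ⟶ S) (h' : ∀ i, D'.obj i ⟶ S')
    (p : ∀ i, D'.obj i ⟶ D.obj i)
    (hp : ∀ {i i' : J} (f : i ⟶ i'), D'.map f ≫ p i' = p i ≫ D.map f)
    (hh' : ∀ {i i' : J} (f : i ⟶ i'), D'.map f ≫ h' i' = h' i)
    (hpb : ∀ i, IsPullback (p i) (h' i) (h i) j) (h₀ : c.pt ⟶ S) (h₀' : c'.pt ⟶ S')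
    (p₀ : c'.pt ⟶ c.pt) (hpb₀ : IsPullback p₀ h₀' h₀ j)
    (hcp : ∀ i, c'.π.app i ≫ p i = p₀ ≫ c.π.app i) (hch : ∀ i, c.π.app i ≫ h i = h₀)
    (hch' : ∀ i, c'.π.app i ≫ h' i = h₀') : Nonempty (IsLimit c') := by
  have hconst : ∀ (s : Cone D') (i i' : J), s.π.app i ≫ h' i = s.π.app i' ≫ h' i' := by
    intro s i i'
    rw [← s.w (IsCofiltered.minToLeft i i'), ← s.w (IsCofiltered.minToRight i i'),
      Category.assoc, Category.assoc, hh', hh']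
  let t : Cone D' → Cone D := fun s ↦
    { pt := s.pt
      π := { app := fun i ↦ s.π.app i ≫ p i
             naturality := fun i i' f ↦ by
              simp only [Functor.const_obj_obj, Functor.const_obj_map, Category.id_comp,
                Category.assoc]
              rw [← hp, ← Category.assoc, s.w] } }
  let i₀ : J := (IsCofiltered.nonempty (C := J)).some
  have hw : ∀ s : Cone D', hc.lift (t s) ≫ h₀ = (s.π.app i₀ ≫ h' i₀) ≫ j := by
    intro s
    rw [← hch i₀, ← Category.assoc, hc.fac, Category.assoc, (hpb i₀).w, Category.assoc]
  refine ⟨{ lift := fun s ↦ hpb₀.lift (hc.lift (t s)) (s.π.app i₀ ≫ h' i₀) (hw s), fac := ?_,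
            uniq := ?_ }⟩
  · intro s i
    apply (hpb i).hom_ext
    · rw [Category.assoc, hcp, hpb₀.lift_fst_assoc, hc.fac]
    · rw [Category.assoc, hch', hpb₀.lift_snd, hconst s i₀ i]
  · intro s m hm
    apply hpb₀.hom_ext
    · rw [hpb₀.lift_fst]
      apply hc.hom_ext
      intro i
      rw [hc.fac, Category.assoc, ← hcp, ← Category.assoc, hm]
    · rw [hpb₀.lift_snd, ← hch' i₀, ← Category.assoc, hm]

/-! ### Principal bundles -/

noncomputable section Bundles

variable {k : Type u} [Field k]

/-- A principal bundle (torsor) `h : V ⟶ S` over the `k`-scheme `S`: a `k`-group-scheme `G` acting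
(on the right) on `V`, with `h` affine, flat and surjective and invariant under the action, such
that `V × G ⟶ V ×_S V`, `(v, g) ↦ (v, v g)`, is an isomorphism, i.e. the square formed by
`(v, g) ↦ v`, `(v, g) ↦ v g` and `h`, `h` is cartesian. No finiteness is imposed on `G` here. -/
structure PrincipalBundle (S : Over (Spec (.of k))) where
  /-- the structure group -/
  G : Grp (Over (Spec (.of k)))
  /-- the total space -/
  V : Over (Spec (.of k))
  /-- the projection -/
  h : V ⟶ S
  /-- the action `(v, g) ↦ v g` -/
  act : V ⊗ G.X ⟶ V
  act_one : ∀ {T : Over (Spec (.of k))} (v : T ⟶ V), lift v (1 : T ⟶ G.X) ≫ act = v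
  act_mul : ∀ {T : Over (Spec (.of k))} (v : T ⟶ V) (g g' : T ⟶ G.X),
    lift v (g * g') ≫ act = lift (lift v g ≫ act) g' ≫ act
  isAffineHom : IsAffineHom h.left
  flat : Flat h.left
  surjective : Surjective h.left
  isPullback : IsPullback (fst V G.X) act h h

namespace PrincipalBundle

attribute [instance] isAffineHom flat surjective

variable {S : Over (Spec (.of k))}

/-- A morphism of principal bundles over `S`: an `S`-morphism `f` of the total spaces and a
homomorphism `φ` of the groups, with `f (v g) = f v (φ g)`. -/
@[ext]
structure Hom (P Q : PrincipalBundle S) where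
  f : P.V ⟶ Q.V
  φ : P.G ⟶ Q.G
  comp_h : f ≫ Q.h = P.h
  equivariant : P.act ≫ f = (f ⊗ₘ φ.hom.hom) ≫ Q.act

instance : Category (PrincipalBundle S) where
  Hom := Hom
  id P := ⟨𝟙 _, 𝟙 _, by simp, by simp⟩
  comp a b := ⟨a.f ≫ b.f, a.φ ≫ b.φ, by simp [a.comp_h, b.comp_h], by
    rw [← Category.assoc, a.equivariant, Category.assoc, b.equivariant]
    simp⟩

@[simp] lemma id_f (P : PrincipalBundle S) : Hom.f (𝟙 P) = 𝟙 P.V := rfl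
@[simp] lemma id_φ (P : PrincipalBundle S) : Hom.φ (𝟙 P) = 𝟙 P.G := rfl
@[simp] lemma comp_f {P Q R : PrincipalBundle S} (a : P ⟶ Q) (b : Q ⟶ R) :
    Hom.f (a ≫ b) = Hom.f a ≫ Hom.f b := rfl
@[simp] lemma comp_φ {P Q R : PrincipalBundle S} (a : P ⟶ Q) (b : Q ⟶ R) :
    Hom.φ (a ≫ b) = Hom.φ a ≫ Hom.φ b := rfl
@[ext] lemma hom_ext {P Q : PrincipalBundle S} {a b : P ⟶ Q} (hf : Hom.f a = Hom.f b)
    (hφ : Hom.φ a = Hom.φ b) : a = b := Hom.ext hf hφ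

/-- The action on the base change `V'` of `V` along `j : S' ⟶ S`. -/
def baseChangeAct {S' : Over (Spec (.of k))} {j : S' ⟶ S} (P : PrincipalBundle S)
    {V' : Over (Spec (.of k))} {p : V' ⟶ P.V} {h' : V' ⟶ S'} (hp : IsPullback p h' P.h j) :
    V' ⊗ P.G.X ⟶ V' :=
  hp.lift (lift (fst _ _ ≫ p) (snd _ _) ≫ P.act) (fst _ _ ≫ h') (by
    rw [Category.assoc, ← P.isPullback.w, lift_fst_assoc, Category.assoc, Category.assoc, hp.w])

@[simp]
lemma baseChangeAct_fst {S' : Over (Spec (.of k))} {j : S' ⟶ S} (P : PrincipalBundle S)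
    {V' : Over (Spec (.of k))} {p : V' ⟶ P.V} {h' : V' ⟶ S'} (hp : IsPullback p h' P.h j) :
    P.baseChangeAct hp ≫ p = lift (fst _ _ ≫ p) (snd _ _) ≫ P.act := hp.lift_fst _ _ _

@[simp]
lemma baseChangeAct_snd {S' : Over (Spec (.of k))} {j : S' ⟶ S} (P : PrincipalBundle S)
    {V' : Over (Spec (.of k))} {p : V' ⟶ P.V} {h' : V' ⟶ S'} (hp : IsPullback p h' P.h j) :
    P.baseChangeAct hp ≫ h' = fst _ _ ≫ h' := hp.lift_snd _ _ _

lemma lift_baseChangeAct_fst {S' : Over (Spec (.of k))} {j : S' ⟶ S} (P : PrincipalBundle S)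
    {V' : Over (Spec (.of k))} {p : V' ⟶ P.V} {h' : V' ⟶ S'} (hp : IsPullback p h' P.h j)
    {T : Over (Spec (.of k))} (v : T ⟶ V') (g : T ⟶ P.G.X) :
    lift v g ≫ P.baseChangeAct hp ≫ p = lift (v ≫ p) g ≫ P.act := by
  simp [comp_lift_assoc]

/-- The base change of a principal bundle along `j : S' ⟶ S`, with the same group. -/
def baseChange {S' : Over (Spec (.of k))} {j : S' ⟶ S} (P : PrincipalBundle S)
    {V' : Over (Spec (.of k))} {p : V' ⟶ P.V} {h' : V' ⟶ S'} (hp : IsPullback p h' P.h j) :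
    PrincipalBundle S' where
  G := P.G
  V := V'
  h := h'
  act := P.baseChangeAct hp
  act_one v := by
    apply hp.hom_ext
    · rw [Category.assoc, lift_baseChangeAct_fst, P.act_one]
    · simp
  act_mul v g g' := by
    apply hp.hom_ext
    · simp only [Category.assoc, lift_baseChangeAct_fst, P.act_mul]
    · simp
  isAffineHom := MorphismProperty.of_isPullback (P := @IsAffineHom)
    (hp.map (Over.forget _)) P.isAffineHom
  flat := MorphismProperty.of_isPullback (P := @Flat) (hp.map (Over.forget _)) P.flat
  surjective := MorphismProperty.of_isPullback (P := @Surjective)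
    (hp.map (Over.forget _)) P.surjective
  isPullback := by
    have h1 : IsPullback (lift (fst V' P.G.X ≫ p) (snd V' P.G.X)) (fst V' P.G.X)
        (fst P.V P.G.X) p :=
      IsPullback.of_isLimit' ⟨by simp⟩ (PullbackCone.IsLimit.mk _
        (fun s ↦ lift s.snd (s.fst ≫ snd _ _))
        (fun s ↦ by
          apply CartesianMonoidalCategory.hom_ext
          · simp [s.condition]
          · simp)
        (fun s ↦ by simp)
        (fun s m hm hm' ↦ by
          apply CartesianMonoidalCategory.hom_ext
          · simp [hm']
          · simp [← hm]))
    have h2 := h1.paste_horiz P.isPullback.flip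
    refine (IsPullback.of_right (h₁₂ := p) (h₂₂ := j) ?_
      (P.baseChangeAct_snd hp) hp).flip
    rw [baseChangeAct_fst, ← hp.w]
    exact h2

lemma baseChange_equivariant {S' : Over (Spec (.of k))} {j : S' ⟶ S} {P Q : PrincipalBundle S}
    (a : P ⟶ Q) {V' W' : Over (Spec (.of k))} {p : V' ⟶ P.V} {h' : V' ⟶ S'}
    (hp : IsPullback p h' P.h j) {q : W' ⟶ Q.V} {g' : W' ⟶ S'} (hq : IsPullback q g' Q.h j)
    (f : V' ⟶ W') (hf : f ≫ q = p ≫ Hom.f a) (hf' : f ≫ g' = h') :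
    P.baseChangeAct hp ≫ f = (f ⊗ₘ (Hom.φ a).hom.hom) ≫ Q.baseChangeAct hq := by
  apply hq.hom_ext
  · rw [Category.assoc, Category.assoc, hf, baseChangeAct_fst, ← Category.assoc,
      baseChangeAct_fst, Category.assoc, Hom.equivariant, ← Category.assoc, ← Category.assoc]
    congr 1
    apply CartesianMonoidalCategory.hom_ext <;> simp [hf]
  · simp [hf']

/-- The base change of a morphism of principal bundles. -/
def baseChangeMap {S' : Over (Spec (.of k))} {j : S' ⟶ S} {P Q : PrincipalBundle S} (a : P ⟶ Q)
    {V' W' : Over (Spec (.of k))} {p : V' ⟶ P.V} {h' : V' ⟶ S'} (hp : IsPullback p h' P.h j)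
    {q : W' ⟶ Q.V} {g' : W' ⟶ S'} (hq : IsPullback q g' Q.h j) :
    Hom (P.baseChange hp) (Q.baseChange hq) where
  f := hq.lift (p ≫ Hom.f a) h' ((Category.assoc _ _ _).trans
    ((congrArg (p ≫ ·) (Hom.comp_h a)).trans hp.w))
  φ := Hom.φ (P := P) (Q := Q) a
  comp_h := hq.lift_snd _ _ _
  equivariant := baseChange_equivariant a hp hq _ (hq.lift_fst _ _ _) (hq.lift_snd _ _ _)

lemma baseChangeMap_f_fst {S' : Over (Spec (.of k))} {j : S' ⟶ S} {P Q : PrincipalBundle S}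
    (a : P ⟶ Q) {V' W' : Over (Spec (.of k))} {p : V' ⟶ P.V} {h' : V' ⟶ S'}
    (hp : IsPullback p h' P.h j) {q : W' ⟶ Q.V} {g' : W' ⟶ S'} (hq : IsPullback q g' Q.h j) :
    (baseChangeMap a hp hq).f ≫ q = p ≫ Hom.f a := hq.lift_fst _ _ _

lemma baseChangeMap_f_snd {S' : Over (Spec (.of k))} {j : S' ⟶ S} {P Q : PrincipalBundle S}
    (a : P ⟶ Q) {V' W' : Over (Spec (.of k))} {p : V' ⟶ P.V} {h' : V' ⟶ S'}
    (hp : IsPullback p h' P.h j) {q : W' ⟶ Q.V} {g' : W' ⟶ S'} (hq : IsPullback q g' Q.h j) :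
    (baseChangeMap a hp hq).f ≫ g' = h' := hq.lift_snd _ _ _

/-- The pull-back functor on principal bundles along `j : S' ⟶ S`. -/
def restrict {S' : Over (Spec (.of k))} (j : S' ⟶ S) :
    PrincipalBundle S ⥤ PrincipalBundle S' where
  obj P := P.baseChange (IsPullback.of_hasPullback P.h j)
  map {P Q} a := baseChangeMap a (IsPullback.of_hasPullback P.h j) (IsPullback.of_hasPullback Q.h j)
  map_id P := by
    apply hom_ext
    · apply (IsPullback.of_hasPullback P.h j).hom_ext
      · exact (baseChangeMap_f_fst _ _ _).trans
          ((Category.comp_id _).trans (Category.id_comp _).symm)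
      · exact (baseChangeMap_f_snd _ _ _).trans (Category.id_comp _).symm
    · rfl
  map_comp {P Q R} a b := by
    apply hom_ext
    · apply (IsPullback.of_hasPullback R.h j).hom_ext
      · refine (baseChangeMap_f_fst _ _ _).trans (Eq.symm ((Category.assoc _ _ _).trans ?_))
        refine (congrArg (_ ≫ ·) (baseChangeMap_f_fst b _ _)).trans ?_
        refine (Category.assoc _ _ _).symm.trans ?_
        exact (congrArg (· ≫ Hom.f b) (baseChangeMap_f_fst a _ _)).trans (Category.assoc _ _ _)
      · refine (baseChangeMap_f_snd _ _ _).trans (Eq.symm ((Category.assoc _ _ _).trans ?_))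
        refine (congrArg (_ ≫ ·) (baseChangeMap_f_snd b _ _)).trans ?_
        exact baseChangeMap_f_snd a _ _
    · rfl

end PrincipalBundle

end Bundles

/-! ### The categories of pointed bundles -/

noncomputable section Pointed

variable {k : Type u} [Field k]

namespace PrincipalBundle

variable (S : Over (Spec (.of k)))

/-- The structure group of a principal bundle, as a functor to `k`-schemes. -/
def groupFunctor : PrincipalBundle S ⥤ Over (Spec (.of k)) where
  obj P := P.G.X
  map a := (Hom.φ a).hom.hom

/-- The total space of a principal bundle, as a functor to `k`-schemes. -/
def totalFunctor : PrincipalBundle S ⥤ Over (Spec (.of k)) where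
  obj P := P.V
  map a := Hom.f a

end PrincipalBundle

/-- The objects of `E` (a category of principal bundles over `S` with extra structure, `F` being the
forgetful functor) whose structure group is a finite `k`-group-scheme. -/
def HasFiniteGroup {S : Over (Spec (.of k))} {E : Type*} [Category E] (F : E ⥤ PrincipalBundle S) :
    ObjectProperty E :=
  fun T ↦ IsFinite (F.obj T).G.X.hom

/-- The objects `T` of `E` (a category of principal bundles over `S` with extra structure, `F` being
the forgetful functor) which are limits of a small cofiltered system `T_α` of objects with finite
structure group: there are compatible morphisms `T ⟶ T_α` in `E` for which
`G = lim G_α` and `V = lim V_α`. -/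
def IsProObject {S : Over (Spec (.of k))} {E : Type*} [Category E] (F : E ⥤ PrincipalBundle S) :
    ObjectProperty E :=
  fun T ↦ ∃ (J : Type u) (_ : SmallCategory J) (_ : IsCofiltered J) (D : J ⥤ E)
    (c : (Functor.const J).obj T ⟶ D),
    (∀ i, HasFiniteGroup F (D.obj i)) ∧
    Nonempty (IsLimit ((F ⋙ PrincipalBundle.groupFunctor S).mapCone (Cone.mk T c))) ∧
    Nonempty (IsLimit ((F ⋙ PrincipalBundle.totalFunctor S).mapCone (Cone.mk T c)))

/-- A triple `(h : V ⟶ S, G, y)`: a principal bundle with a `k`-point `y` of `V` over the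
`k`-point `x` of `S`. -/
structure PointedBundle (S : Over (Spec (.of k))) (x : 𝟙_ (Over (Spec (.of k))) ⟶ S) where
  bundle : PrincipalBundle S
  y : 𝟙_ (Over (Spec (.of k))) ⟶ bundle.V
  y_h : y ≫ bundle.h = x

namespace PointedBundle

variable {S : Over (Spec (.of k))} {x : 𝟙_ (Over (Spec (.of k))) ⟶ S}

/-- A morphism of pointed bundles: a morphism of principal bundles which respects the points. -/
@[ext]
structure Hom (P Q : PointedBundle S x) where
  hom : P.bundle ⟶ Q.bundle
  y_f : P.y ≫ PrincipalBundle.Hom.f hom = Q.y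

instance : Category (PointedBundle S x) where
  Hom := Hom
  id P := ⟨𝟙 _, by simp⟩
  comp a b := ⟨a.hom ≫ b.hom, by
    rw [PrincipalBundle.comp_f, ← Category.assoc, a.y_f, b.y_f]⟩

/-- Forget the point. -/
def forget (S : Over (Spec (.of k))) (x : 𝟙_ (Over (Spec (.of k))) ⟶ S) :
    PointedBundle S x ⥤ PrincipalBundle S where
  obj P := P.bundle
  map a := Hom.hom a

end PointedBundle

/-- Nori's category `𝒞(S, x)` of pointed principal bundles under finite `k`-group-schemes. -/
abbrev NoriCat (S : Over (Spec (.of k))) (x : 𝟙_ (Over (Spec (.of k))) ⟶ S) :=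
  (HasFiniteGroup (PointedBundle.forget S x)).FullSubcategory

/-- Nori's category `𝒞^ind(S, x)` of pro-objects of `𝒞(S, x)`. A fundamental group-scheme of
`(S, x)` is the structure group of an initial object. -/
abbrev NoriIndCat (S : Over (Spec (.of k))) (x : 𝟙_ (Over (Spec (.of k))) ⟶ S) :=
  (IsProObject (PointedBundle.forget S x)).FullSubcategory

end Pointed

/-! ### Integral closures -/

noncomputable section IntegralClosure

variable (k A : Type u) [Field k] [CommRing A] [Algebra k A]

/-- `X = Spec A` as a `k`-scheme. -/
abbrev baseX : Over (Spec (.of k)) := Over.mk (Spec.map (CommRingCat.ofHom (algebraMap k A)))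

variable {k A}

/-- The ring homomorphism `A ⟶ Γ(V, 𝒪_V)` given by a morphism `V ⟶ Spec A`. -/
def coordMap {V : Over (Spec (.of k))} (g : V ⟶ baseX k A) : A →+* Γ(V.left, ⊤) :=
  ((Scheme.ΓSpecIso (.of A)).inv ≫ g.left.appTop).hom

/-- The integral closure of `A` in `Γ(V, 𝒪_V)`. -/
def intClosureRing {V : Over (Spec (.of k))} (g : V ⟶ baseX k A) : Subring Γ(V.left, ⊤) :=
  letI := (coordMap g).toAlgebra
  (integralClosure A Γ(V.left, ⊤)).toSubring

lemma mem_intClosureRing {V : Over (Spec (.of k))} (g : V ⟶ baseX k A) (s : Γ(V.left, ⊤)) :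
    s ∈ intClosureRing g ↔ (coordMap g).IsIntegralElem s := Iff.rfl

/-- The structure map of the integral closure. -/
def toIntClosureRing {V : Over (Spec (.of k))} (g : V ⟶ baseX k A) : A →+* intClosureRing g :=
  (coordMap g).codRestrict _ fun _ ↦ RingHom.isIntegralElem_map _

/-- The integral closure `h̃ : Y = Spec B ⟶ X` of `g : V ⟶ X`, where `X = Spec A` and `B` is the
integral closure of `A` in `Γ(X, g_* 𝒪_V)`: the `k`-scheme `Y`. -/
def intClosure {V : Over (Spec (.of k))} (g : V ⟶ baseX k A) : Over (Spec (.of k)) :=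
  Over.mk (Spec.map (CommRingCat.ofHom (toIntClosureRing g)) ≫ (baseX k A).hom)

/-- The integral closure `h̃ : Y = Spec B ⟶ X` of `g : V ⟶ X`: the morphism `h̃`. -/
def intClosureHom {V : Over (Spec (.of k))} (g : V ⟶ baseX k A) : intClosure g ⟶ baseX k A :=
  Over.homMk (Spec.map (CommRingCat.ofHom (toIntClosureRing g)))

lemma coordMap_comp {V W : Over (Spec (.of k))} (g : V ⟶ baseX k A) (g' : W ⟶ baseX k A)
    (f : V ⟶ W) (w : f ≫ g' = g) : f.left.appTop.hom.comp (coordMap g') = coordMap g := by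
  subst w
  ext a
  simp only [coordMap, Over.comp_left, Scheme.Hom.comp_appTop]
  rfl

/-- The pull-back of functions along an `X`-morphism `f : V ⟶ W`, on integral closures. -/
def intClosureRingMap {V W : Over (Spec (.of k))} (g : V ⟶ baseX k A) (g' : W ⟶ baseX k A)
    (f : V ⟶ W) (w : f ≫ g' = g) : intClosureRing g' →+* intClosureRing g :=
  f.left.appTop.hom.restrict _ _ fun s hs ↦ by
    rw [mem_intClosureRing] at hs ⊢
    rw [← coordMap_comp g g' f w]
    exact hs.map _

lemma intClosureRingMap_comp_to {V W : Over (Spec (.of k))} (g : V ⟶ baseX k A)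
    (g' : W ⟶ baseX k A) (f : V ⟶ W) (w : f ≫ g' = g) :
    (intClosureRingMap g g' f w).comp (toIntClosureRing g') = toIntClosureRing g := by
  ext a
  exact congrArg (fun r : A →+* _ ↦ r a) (coordMap_comp g g' f w)

/-- The extension `f̃` of an `X`-morphism `f : V ⟶ W` to the integral closures. -/
def intClosureMap {V W : Over (Spec (.of k))} (g : V ⟶ baseX k A) (g' : W ⟶ baseX k A)
    (f : V ⟶ W) (w : f ≫ g' = g) : intClosure g ⟶ intClosure g' :=
  Over.homMk (Spec.map (CommRingCat.ofHom (intClosureRingMap g g' f w))) (by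
    refine (Category.assoc _ _ _).symm.trans (congrArg (· ≫ (baseX k A).hom) ?_)
    exact (Spec.map_comp _ _).symm.trans (congrArg (fun r ↦ Spec.map (CommRingCat.ofHom r))
      (intClosureRingMap_comp_to g g' f w)))

lemma intClosureMap_id {V : Over (Spec (.of k))} (g : V ⟶ baseX k A) :
    intClosureMap g g (𝟙 V) (Category.id_comp g) = 𝟙 _ := by
  ext1
  have : intClosureRingMap g g (𝟙 V) (Category.id_comp g) = RingHom.id _ := by
    ext s
    simp [intClosureRingMap]
  change Spec.map (CommRingCat.ofHom _) = 𝟙 _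
  rw [this]
  exact Spec.map_id _

lemma intClosureMap_comp {V W Z : Over (Spec (.of k))} (g : V ⟶ baseX k A) (g' : W ⟶ baseX k A)
    (g'' : Z ⟶ baseX k A) (f : V ⟶ W) (w : f ≫ g' = g) (f' : W ⟶ Z) (w' : f' ≫ g'' = g') :
    intClosureMap g g'' (f ≫ f') (by rw [Category.assoc, w', w]) =
      intClosureMap g g' f w ≫ intClosureMap g' g'' f' w' := by
  ext1
  change Spec.map _ = Spec.map _ ≫ Spec.map _
  rw [← Spec.map_comp, ← CommRingCat.ofHom_comp]
  congr 2

end IntegralClosure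

/-! ### The local situation -/

/-- `A` is a complete normal (Noetherian) local `k`-algebra with residue field `k`,
of dimension at least `2`. -/
class IsCompleteNormalGerm (k A : Type u) [Field k] [CommRing A] [IsLocalRing A] [Algebra k A] :
    Prop where
  isNoetherianRing : IsNoetherianRing A
  isDomain : IsDomain A
  isIntegrallyClosed : IsIntegrallyClosed A
  isAdicComplete : IsAdicComplete (IsLocalRing.maximalIdeal A) A
  bijective_algebraMap : Function.Bijective (algebraMap k (IsLocalRing.ResidueField A))
  two_le_dim : 2 ≤ ringKrullDim A

noncomputable section Local

variable (k A : Type u) [Field k] [CommRing A] [IsLocalRing A] [Algebra k A]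

/-- The open subscheme `U = X ∖ {x}` of `X = Spec A`, as a `k`-scheme. -/
abbrev baseU : Over (Spec (.of k)) :=
  Over.mk ((puncturedSpec A).ι ≫ Spec.map (CommRingCat.ofHom (algebraMap k A)))

/-- The open immersion `j : U ⟶ X`. -/
def inclU : baseU k A ⟶ baseX k A := Over.homMk (puncturedSpec A).ι


namespace LocalBundle

variable {k A}

/-- The extension `f̃` of a morphism of principal bundles over `U` to the integral closures. -/
def extend {P Q : PrincipalBundle (baseU k A)} (a : P ⟶ Q) :
    intClosure (P.h ≫ inclU k A) ⟶ intClosure (Q.h ≫ inclU k A) :=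
  intClosureMap _ _ (PrincipalBundle.Hom.f a) (by
    rw [← Category.assoc, PrincipalBundle.Hom.comp_h])

lemma extend_id (P : PrincipalBundle (baseU k A)) : extend (𝟙 P) = 𝟙 _ := intClosureMap_id _

lemma extend_comp {P Q R : PrincipalBundle (baseU k A)} (a : P ⟶ Q) (b : Q ⟶ R) :
    extend (a ≫ b) = extend a ≫ extend b := intClosureMap_comp _ _ _ _ _ _ _

end LocalBundle

variable [IsCompleteNormalGerm k A]

/-- The residue map `A ⟶ A / 𝔪 = k`. -/
def augmentation : A →ₐ[k] k :=
  ((AlgEquiv.ofBijective (Algebra.ofId k (IsLocalRing.ResidueField A))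
    IsCompleteNormalGerm.bijective_algebraMap).symm : IsLocalRing.ResidueField A →ₐ[k] k).comp
    (IsScalarTower.toAlgHom k A (IsLocalRing.ResidueField A))

/-- The rational point `x ∈ X(k)` given by the maximal ideal of `A`. -/
def pointX : 𝟙_ (Over (Spec (.of k))) ⟶ baseX k A :=
  Over.homMk (Spec.map (CommRingCat.ofHom (augmentation k A).toRingHom)) (by
    refine (Spec.map_comp _ _).symm.trans ?_
    rw [← CommRingCat.ofHom_comp]
    have : (augmentation k A).toRingHom.comp (algebraMap k A) = RingHom.id k :=
      (augmentation k A).comp_algebraMap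
    rw [this]
    exact Spec.map_id _)

/-- A triple `(h : V ⟶ U, G, y)`: a principal bundle over `U` with a `k`-point `y` over `x` of the
integral closure `h̃ : Y ⟶ X` of `h`. -/
structure LocalBundle where
  bundle : PrincipalBundle (baseU k A)
  y : 𝟙_ (Over (Spec (.of k))) ⟶ intClosure (bundle.h ≫ inclU k A)
  y_h : y ≫ intClosureHom (bundle.h ≫ inclU k A) = pointX k A

namespace LocalBundle

variable {k A}

/-- A morphism of local bundles: a morphism of principal bundles over `U` whose extension to the
integral closures respects the points. -/
@[ext]
structure Hom (P Q : LocalBundle k A) where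
  hom : P.bundle ⟶ Q.bundle
  y_f : P.y ≫ extend hom = Q.y

instance : Category (LocalBundle k A) where
  Hom := Hom
  id P := ⟨𝟙 _, by rw [extend_id, Category.comp_id]⟩
  comp a b := ⟨a.hom ≫ b.hom, by rw [extend_comp, ← Category.assoc, a.y_f, b.y_f]⟩

variable (k A) in
/-- Forget the point. -/
def forget : LocalBundle k A ⥤ PrincipalBundle (baseU k A) where
  obj P := P.bundle
  map a := Hom.hom a

end LocalBundle

/-- The category `𝒞_loc(U, x)`: the triples `(h : V ⟶ U, G, y)` with `G` finite. -/
abbrev LocCat := (HasFiniteGroup (LocalBundle.forget k A)).FullSubcategory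

/-- The category `𝒞_loc^ind(U, x)` of pro-objects of `𝒞_loc(U, x)`. A local fundamental
group-scheme of `(U, x)` is the structure group of an initial object. -/
abbrev LocIndCat := (IsProObject (LocalBundle.forget k A)).FullSubcategory

/-- The category `𝒞(X, x)`. -/
abbrev XCat := NoriCat (baseX k A) (pointX k A)

/-- The category `𝒞^ind(X, x)`. -/
abbrev XIndCat := NoriIndCat (baseX k A) (pointX k A)

variable {k A}

/-- The functions on a flat affine `X`-scheme are the functions on its restriction to `U`. -/
lemma isIso_appTop_of_flat {V V' : Over (Spec (.of k))} {h : V ⟶ baseX k A} {p : V' ⟶ V}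
    {h' : V' ⟶ baseU k A} (hp : IsPullback p h' h (inclU k A)) [IsAffineHom h.left]
    [Flat h.left] : IsIso p.left.appTop :=
  have := IsCompleteNormalGerm.isNoetherianRing (k := k) (A := A)
  have := IsCompleteNormalGerm.isDomain (k := k) (A := A)
  have := IsCompleteNormalGerm.isIntegrallyClosed (k := k) (A := A)
  have := isIso_punctured_appTop (IsCompleteNormalGerm.two_le_dim (k := k) (A := A))
  @isIso_appTop_of_isPullback A _ _ _ _ _ _ _ h.left _ _ (hp.map (Over.forget _)) ‹_› ‹_›

/-- The restriction of a `k`-point `y` of `V` to the integral closure of `A` in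
`Γ(V', 𝒪) = Γ(V, 𝒪)`, where `V' = V ×_X U`. -/
def restrictPointRingHom {V V' : Over (Spec (.of k))} {h : V ⟶ baseX k A} {p : V' ⟶ V}
    {h' : V' ⟶ baseU k A} (hp : IsPullback p h' h (inclU k A)) [IsAffineHom h.left]
    [Flat h.left] (y : 𝟙_ (Over (Spec (.of k))) ⟶ V) :
    CommRingCat.of (intClosureRing (h' ≫ inclU k A)) ⟶ CommRingCat.of k :=
  have := isIso_appTop_of_flat hp
  CommRingCat.ofHom (intClosureRing (h' ≫ inclU k A)).subtype ≫
    inv p.left.appTop ≫ y.left.appTop ≫ (Scheme.ΓSpecIso (.of k)).hom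

lemma specMap_restrictPointRingHom_comp {V V' : Over (Spec (.of k))} {h : V ⟶ baseX k A}
    {p : V' ⟶ V} {h' : V' ⟶ baseU k A} (hp : IsPullback p h' h (inclU k A)) [IsAffineHom h.left]
    [Flat h.left] (y : 𝟙_ (Over (Spec (.of k))) ⟶ V) :
    Spec.map (restrictPointRingHom hp y) ≫
      Spec.map (CommRingCat.ofHom (toIntClosureRing (h' ≫ inclU k A))) = (y ≫ h).left := by
  have := isIso_appTop_of_flat hp
  have h1 : CommRingCat.ofHom (toIntClosureRing (h' ≫ inclU k A)) ≫
      CommRingCat.ofHom (intClosureRing (h' ≫ inclU k A)).subtype =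
      (Scheme.ΓSpecIso (.of A)).inv ≫ h.left.appTop ≫ p.left.appTop := by
    have h2 : (p ≫ h).left.appTop = h.left.appTop ≫ p.left.appTop := by
      rw [Over.comp_left, Scheme.Hom.comp_appTop]
    rw [← h2, hp.w]
    rfl
  have h3 : CommRingCat.ofHom (toIntClosureRing (h' ≫ inclU k A)) ≫ restrictPointRingHom hp y =
      (Scheme.ΓSpecIso (.of A)).inv ≫ (y ≫ h).left.appTop ≫ (Scheme.ΓSpecIso (.of k)).hom := by
    rw [restrictPointRingHom, reassoc_of% h1, IsIso.hom_inv_id_assoc, Over.comp_left,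
      Scheme.Hom.comp_appTop, Category.assoc]
  rw [← Spec.map_comp, h3]
  exact specMap_ΓSpecIso_conj _

/-- The point of the integral closure of `V' = V ×_X U ⟶ X` given by a `k`-point `y` of `V`. -/
def restrictPoint {V V' : Over (Spec (.of k))} {h : V ⟶ baseX k A} {p : V' ⟶ V}
    {h' : V' ⟶ baseU k A} (hp : IsPullback p h' h (inclU k A)) [IsAffineHom h.left]
    [Flat h.left] (y : 𝟙_ (Over (Spec (.of k))) ⟶ V) :
    𝟙_ (Over (Spec (.of k))) ⟶ intClosure (h' ≫ inclU k A) :=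
  Over.homMk (Spec.map (restrictPointRingHom hp y)) (by
    refine (Category.assoc _ _ _).symm.trans ?_
    refine (congrArg (· ≫ (baseX k A).hom) (specMap_restrictPointRingHom_comp hp y)).trans ?_
    exact Over.w (y ≫ h))

lemma restrictPoint_hom {V V' : Over (Spec (.of k))} {h : V ⟶ baseX k A} {p : V' ⟶ V}
    {h' : V' ⟶ baseU k A} (hp : IsPullback p h' h (inclU k A)) [IsAffineHom h.left]
    [Flat h.left] (y : 𝟙_ (Over (Spec (.of k))) ⟶ V) :
    restrictPoint hp y ≫ intClosureHom (h' ≫ inclU k A) = y ≫ h :=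
  Over.OverMorphism.ext (specMap_restrictPointRingHom_comp hp y)

lemma restrictPoint_map {V V' W W' : Over (Spec (.of k))} {h : V ⟶ baseX k A} {p : V' ⟶ V}
    {h' : V' ⟶ baseU k A} (hp : IsPullback p h' h (inclU k A)) [IsAffineHom h.left]
    [Flat h.left] {g : W ⟶ baseX k A} {q : W' ⟶ W} {g' : W' ⟶ baseU k A}
    (hq : IsPullback q g' g (inclU k A)) [IsAffineHom g.left] [Flat g.left]
    (y : 𝟙_ (Over (Spec (.of k))) ⟶ V) (f : V ⟶ W) (f' : V' ⟶ W') (w : f' ≫ q = p ≫ f)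
    (w'' : f' ≫ g' ≫ inclU k A = h' ≫ inclU k A) :
    restrictPoint hp y ≫ intClosureMap (h' ≫ inclU k A) (g' ≫ inclU k A) f' w'' =
      restrictPoint hq (y ≫ f) := by
  have := isIso_appTop_of_flat hp
  have := isIso_appTop_of_flat hq
  apply Over.OverMorphism.ext
  refine (Spec.map_comp _ _).symm.trans (congrArg Spec.map ?_)
  have h1 : q.left.appTop ≫ f'.left.appTop = f.left.appTop ≫ p.left.appTop := by
    rw [← Scheme.Hom.comp_appTop, ← Scheme.Hom.comp_appTop, ← Over.comp_left, ← Over.comp_left, w]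
  have h2 : f'.left.appTop ≫ inv p.left.appTop = inv q.left.appTop ≫ f.left.appTop := by
    rw [IsIso.comp_inv_eq, Category.assoc, ← h1, IsIso.inv_hom_id_assoc]
  rw [restrictPointRingHom, restrictPointRingHom, Over.comp_left, Scheme.Hom.comp_appTop,
    Category.assoc, ← reassoc_of% h2]
  rfl

/-- The restriction functor `ρ` on pointed bundles: `(h : Y ⟶ X, G, y)` is sent to
`(Y ×_X U ⟶ U, G, y)`. -/
def rhoPointed : PointedBundle (baseX k A) (pointX k A) ⥤ LocalBundle k A where
  obj P :=
    { bundle := (PrincipalBundle.restrict (inclU k A)).obj P.bundle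
      y := restrictPoint (IsPullback.of_hasPullback P.bundle.h (inclU k A)) P.y
      y_h := (restrictPoint_hom _ _).trans P.y_h }
  map {P Q} a :=
    { hom := (PrincipalBundle.restrict (inclU k A)).map (PointedBundle.Hom.hom a)
      y_f := (restrictPoint_map (IsPullback.of_hasPullback P.bundle.h (inclU k A))
          (IsPullback.of_hasPullback Q.bundle.h (inclU k A)) P.y
          (PrincipalBundle.Hom.f (PointedBundle.Hom.hom a)) _
          (PrincipalBundle.baseChangeMap_f_fst _ _ _) _).trans
        (congrArg (restrictPoint (IsPullback.of_hasPullback Q.bundle.h (inclU k A)))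
          (PointedBundle.Hom.y_f a)) }
  map_id P := LocalBundle.Hom.ext ((PrincipalBundle.restrict (inclU k A)).map_id P.bundle)
  map_comp a b := LocalBundle.Hom.ext ((PrincipalBundle.restrict (inclU k A)).map_comp
    (PointedBundle.Hom.hom a) (PointedBundle.Hom.hom b))

variable (k A)

/-- The restriction functor `ρ : 𝒞(X, x) ⥤ 𝒞_loc(U, x)`. -/
def rho : XCat k A ⥤ LocCat k A :=
  ObjectProperty.lift _ ((HasFiniteGroup _).ι ⋙ rhoPointed) fun P ↦ P.property

lemma isProObject_rhoPointed (P : PointedBundle (baseX k A) (pointX k A))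
    (hP : IsProObject (PointedBundle.forget _ _) P) :
    IsProObject (LocalBundle.forget k A) (rhoPointed.obj P) := by
  obtain ⟨J, _, _, D, c, hfin, ⟨hG⟩, ⟨hV⟩⟩ := hP
  refine ⟨J, _, ‹_›, D ⋙ rhoPointed, ⟨fun i ↦ rhoPointed.map (c.app i), ?_⟩, hfin, ⟨hG⟩, ⟨?_⟩⟩
  · intro i i' f
    refine ((Category.id_comp _).trans ?_).trans (rhoPointed.map_comp (c.app i) (D.map f))
    exact congrArg rhoPointed.map ((Category.id_comp _).symm.trans (c.naturality f))
  · exact (nonempty_isLimit_of_isPullback (inclU k A) hV _ (fun i ↦ (D.obj i).bundle.h)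
      (fun i ↦ pullback.snd _ _) (fun i ↦ pullback.fst _ _)
      (fun f ↦ PrincipalBundle.baseChangeMap_f_fst _ _ _)
      (fun f ↦ PrincipalBundle.baseChangeMap_f_snd _ _ _)
      (fun i ↦ IsPullback.of_hasPullback _ _) P.bundle.h (pullback.snd _ _) (pullback.fst _ _)
      (IsPullback.of_hasPullback _ _)
      (fun i ↦ PrincipalBundle.baseChangeMap_f_fst _ _ _)
      (fun i ↦ PrincipalBundle.Hom.comp_h (PointedBundle.Hom.hom (c.app i)))
      (fun i ↦ PrincipalBundle.baseChangeMap_f_snd _ _ _)).some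

/-- The restriction functor `ρ : 𝒞^ind(X, x) ⥤ 𝒞_loc^ind(U, x)`. -/
def rhoInd : XIndCat k A ⥤ LocIndCat k A :=
  ObjectProperty.lift _ ((IsProObject _).ι ⋙ rhoPointed)
    fun P ↦ isProObject_rhoPointed k A P.obj P.property

variable {k A}

/-- The homomorphism of structure groups underlying a morphism of `𝒞_loc^ind(U, x)` to the
restriction of an object of `𝒞^ind(X, x)`. -/
def groupHom {L : LocIndCat k A} {T : XIndCat k A} (u : L ⟶ (rhoInd k A).obj T) :
    L.obj.bundle.G ⟶ T.obj.bundle.G :=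
  PrincipalBundle.Hom.φ (LocalBundle.Hom.hom u.hom)

/-- The homomorphism `ρ_* : π^N_loc(U, x) ⟶ π^N(X, x)`, where `L` is a universal object of
`𝒞_loc^ind(U, x)`, with group `π^N_loc(U, x)`, and `T` is a universal object of `𝒞^ind(X, x)`,
with group `π^N(X, x)`: the group component of the unique morphism `L ⟶ ρ(T)`. -/
def rhoStar {L : LocIndCat k A} (hL : IsInitial L) {T : XIndCat k A} (_hT : IsInitial T) :
    L.obj.bundle.G ⟶ T.obj.bundle.G :=
  groupHom (hL.to ((rhoInd k A).obj T))

/-- A homomorphism of `k`-group-schemes is faithfully flat if the morphism of schemes is flat and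
surjective. -/
def IsFaithfullyFlat {G G' : Grp (Over (Spec (.of k)))} (φ : G ⟶ G') : Prop :=
  Flat φ.hom.hom.left ∧ Surjective φ.hom.hom.left

end Local

end LocalNori

open LocalNori

/-! Normality and dimension at least 2 enter through the equality `A = Γ(U, 𝒪)` and its flat version
`isIso_appTop_of_flat`: a flat affine `X`-scheme has the same functions as its restriction to `U`.
Hence morphisms into affine schemes extend from `U` to `X`, and identities between them can be
checked over `U`.

Faithful flatness. Let `T` be universal, `L ⟶ ρ(T)` a morphism and `T ⟶ D` a finite level of `T`.
Take the scheme-theoretic images `Q'` and `G'` of the total space and of the group of `L` in those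
of `D`. The map `Q' × G' ⟶ Q' ×_X Q'` is a closed immersion, because the corresponding map for `D`
is an isomorphism. A `G'`-invariant function on `Q'` pulls back to an invariant function on the
total space of `L`, so it comes from `U`, hence from `A`. A finite group-scheme acting freely in
this sense, with ring of invariants `A`, makes `Q'` a principal bundle over `X`: this is
`projective_and_injective_of_surjective`, where integrals of the Hopf algebra provide a trace and a
dual basis. Since `Q'` is integral over `X`, the point of `L` has an image in `Q'`. So `Q'` is an
object of `𝒞(X, x)` (`exists_image_pointedBundle`), and as `T` is initial, `T ⟶ D` factors through
`Q'`.

The functions on the group of `T` are therefore a union of images of Artinian rings `Γ(G', 𝒪)`, each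
of which maps injectively and flatly to the functions on the group of `L`. Flatness here is
descended along the injection itself, because the kernel pair of a homomorphism is a product with
its kernel. Flatness passes to the union; surjectivity on spectra follows because all primes of the
union are minimal.

Extension of quotients. Suppose that the restriction of a bundle `Q` over `X` maps to `V`, a bundle
under `H`. Put `Z = Spec Γ(V, 𝒪)`; as `U` is quasi-affine, `V` is the part of `Z` over `U`. The map
`Q|_U ⟶ V` trivializes `V` over `Q|_U`, and comparing functions gives `Z ×_X Q ≅ Q × H`. So `Z` is
flat and surjective over `X` by descent along `Q ⟶ X`. The action and the torsor condition extend by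
comparing functions again, and `Z`, being integral over `X`, is the integral closure of `V`, so it
carries the given point. -/

namespace LocalNori

/-! ### Integrals in finite-dimensional commutative Hopf algebras -/

section Integrals

open Coalgebra TensorProduct

/-- The contraction `u ⊗ v ↦ f v • u`. -/
noncomputable def contract {k M N : Type*} [CommRing k] [AddCommGroup M] [Module k M]
    [AddCommGroup N] [Module k N] (f : N →ₗ[k] k) : M ⊗[k] N →ₗ[k] M :=
  (TensorProduct.rid k M).toLinearMap ∘ₗ f.lTensor M

@[simp]
lemma contract_tmul {k M N : Type*} [CommRing k] [AddCommGroup M] [Module k M]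
    [AddCommGroup N] [Module k N] (f : N →ₗ[k] k) (m : M) (n : N) :
    contract f (m ⊗ₜ[k] n) = f n • m := by simp [contract]

variable {k O : Type*} [Field k] [CommRing O] [HopfAlgebra k O]

/-- By coassociativity the left side is `a₁ ⊗ a₂ S(a₃)`, and the antipode axiom collapses the last
two factors to `ε(a₂)`. -/
lemma sum_comul_mul_antipode (a : O) :
    (LinearMap.mul' k (O ⊗[k] O) ∘ₗ TensorProduct.map comul
      ((TensorProduct.mk k O O 1) ∘ₗ HopfAlgebra.antipode k)) (comul a) = a ⊗ₜ[k] (1 : O) := by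
  have h1 : LinearMap.mul' k (O ⊗[k] O) ∘ₗ TensorProduct.map comul
      ((TensorProduct.mk k O O 1) ∘ₗ HopfAlgebra.antipode k) =
      (LinearMap.mul' k O).lTensor O ∘ₗ ((HopfAlgebra.antipode k).lTensor O).lTensor O ∘ₗ
        (TensorProduct.assoc k O O O).toLinearMap ∘ₗ comul.rTensor O := by
    apply TensorProduct.ext'
    intro x y
    simp only [LinearMap.comp_apply, TensorProduct.map_tmul, LinearMap.rTensor_tmul,
      LinearEquiv.coe_coe, TensorProduct.mk_apply, LinearMap.mul'_apply]
    induction comul (R := k) x with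
    | zero => simp
    | add u v hu hv => simp only [add_mul, TensorProduct.add_tmul, map_add, hu, hv]
    | tmul u v => simp
  rw [h1]
  have h2 := Coalgebra.coassoc (R := k) (A := O)
  have h3 := HopfAlgebra.mul_antipode_lTensor_comul (R := k) (A := O)
  have h4 : (LinearMap.mul' k O).lTensor O ∘ₗ ((HopfAlgebra.antipode k).lTensor O).lTensor O ∘ₗ
      (comul (R := k) (A := O)).lTensor O = (Algebra.linearMap k O ∘ₗ counit).lTensor O := by
    rw [← h3, LinearMap.lTensor_comp, LinearMap.lTensor_comp]
  have h5 := LinearMap.congr_fun h2 a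
  simp only [LinearMap.comp_apply, LinearEquiv.coe_coe] at h5 ⊢
  rw [h5]
  have h6 := LinearMap.congr_fun h4 (comul a)
  simp only [LinearMap.comp_apply] at h6
  rw [h6, LinearMap.lTensor_comp, LinearMap.comp_apply, Coalgebra.lTensor_counit_comul]
  simp

/-- For an integral `Λ` of the algebra `O`, `a Λ₁ ⊗ Λ₂ = Λ₁ ⊗ S(a) Λ₂`. -/
lemma tmul_one_mul_comul {Λ : O} (hΛ : ∀ a : O, a * Λ = counit (R := k) a • Λ) (a : O) :
    (a ⊗ₜ[k] (1 : O)) * comul Λ = ((1 : O) ⊗ₜ[k] HopfAlgebra.antipode k a) * comul Λ := by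
  -- Written as `Δ(a₁)(1 ⊗ S(a₂))`, the factor `a ⊗ 1` meets `Δ(Λ)` through `Δ(a₁Λ) = ε(a₁) Δ(Λ)`,
  -- and only `S(a)` survives.
  rw [← sum_comul_mul_antipode a, ← LinearMap.mulRight_apply (R := k), ← LinearMap.comp_apply]
  have h1 : LinearMap.mulRight k (comul (R := k) Λ) ∘ₗ LinearMap.mul' k (O ⊗[k] O) ∘ₗ
      TensorProduct.map comul ((TensorProduct.mk k O O 1) ∘ₗ HopfAlgebra.antipode k) =
      LinearMap.mulRight k (comul (R := k) Λ) ∘ₗ (TensorProduct.mk k O O 1) ∘ₗ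
        HopfAlgebra.antipode k ∘ₗ (TensorProduct.lid k O).toLinearMap ∘ₗ counit.rTensor O := by
    apply TensorProduct.ext'
    intro x y
    simp only [LinearMap.comp_apply, TensorProduct.map_tmul, LinearMap.rTensor_tmul,
      LinearEquiv.coe_coe, TensorProduct.mk_apply, LinearMap.mul'_apply, TensorProduct.lid_tmul,
      LinearMap.mulRight_apply]
    rw [mul_right_comm, ← Bialgebra.comul_mul, hΛ]
    simp [mul_comm]
  rw [h1]
  simp [Coalgebra.rTensor_counit_comul]

lemma contract_tmul_one_mul {R P : Type*} [CommRing R] [Algebra k R] [CommRing P] [Algebra k P]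
    (f : P →ₗ[k] k) (a : R) (z : R ⊗[k] P) :
    contract f ((a ⊗ₜ[k] (1 : P)) * z) = a * contract f z := by
  induction z with
  | zero => simp
  | add u v hu hv => simp only [mul_add, map_add, hu, hv]
  | tmul u v => simp

lemma contract_one_tmul_mul {R P : Type*} [CommRing R] [Algebra k R] [CommRing P] [Algebra k P]
    (f : P →ₗ[k] k) (a : P) (z : R ⊗[k] P) :
    contract f (((1 : R) ⊗ₜ[k] a) * z) = contract (f ∘ₗ LinearMap.mulLeft k a) z := by
  induction z with
  | zero => simp
  | add u v hu hv => simp only [mul_add, map_add, hu, hv]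
  | tmul u v => simp

/-- `a₁ g(a₂) f(a₃)`, computed in two ways. -/
lemma contract_comul_contract_comul (f g : O →ₗ[k] k) (a : O) :
    contract g (comul (R := k) (contract f (comul (R := k) a))) =
      contract (f ∘ₗ (TensorProduct.lid k O).toLinearMap ∘ₗ g.rTensor O ∘ₗ comul)
        (comul (R := k) a) := by
  have h1 : contract g ∘ₗ comul (R := k) ∘ₗ contract f =
      contract (f ∘ₗ (TensorProduct.lid k O).toLinearMap ∘ₗ g.rTensor O) ∘ₗ
      (TensorProduct.assoc k O O O).toLinearMap ∘ₗ comul.rTensor O := by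
    apply TensorProduct.ext'
    intro x y
    simp only [LinearMap.comp_apply, contract_tmul, LinearMap.rTensor_tmul, map_smul,
      LinearEquiv.coe_coe]
    induction comul (R := k) x with
    | zero => simp
    | add u v hu hv => simp only [TensorProduct.add_tmul, map_add, hu, hv, smul_add]
    | tmul u v => simp [smul_smul, mul_comm]
  have h2 := LinearMap.congr_fun h1 (comul a)
  have h3 := LinearMap.congr_fun (Coalgebra.coassoc (R := k) (A := O)) a
  simp only [LinearMap.comp_apply, LinearEquiv.coe_coe] at h2 h3
  rw [h2, h3]
  generalize comul (R := k) a = z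
  induction z with
  | zero => simp
  | add u v hu hv => simp only [map_add, hu, hv]
  | tmul u v => simp

/-- The augmentation ideal is maximal, hence a minimal prime of the Artinian ring `O`, hence an
associated prime: it is the annihilator of some `Λ`, and `a - ε(a)` lies in it. -/
lemma exists_ne_zero_mul_eq_counit_smul (k O : Type*) [Field k] [CommRing O] [HopfAlgebra k O]
    [Module.Finite k O] : ∃ Λ : O, Λ ≠ 0 ∧ ∀ a : O, a * Λ = counit (R := k) a • Λ := by
  have : IsArtinianRing O := IsArtinianRing.of_finite k O
  have hs : Function.Surjective (Bialgebra.counitAlgHom k O) := fun c ↦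
    ⟨algebraMap k O c, by simp⟩
  let I : Ideal O := RingHom.ker (Bialgebra.counitAlgHom k O)
  have hI : I.IsMaximal := RingHom.ker_isMaximal_of_surjective _ hs
  have hmin : I ∈ (Module.annihilator O O).minimalPrimes := by
    rw [Module.annihilator_eq_bot.2 inferInstance]
    refine ⟨⟨hI.isPrime, bot_le⟩, fun J hJ hJI ↦ ?_⟩
    have := hJ.1
    exact ((IsArtinianRing.isMaximal_of_isPrime J).eq_of_le hI.ne_top hJI).ge
  obtain ⟨h1, Λ, hΛ⟩ := isAssociatedPrime_iff.1
    (Module.associatedPrimes.minimalPrimes_annihilator_subset_associatedPrimes O O hmin)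
  have hann (b : O) : b ∈ I ↔ b * Λ = 0 := by
    rw [hΛ, Submodule.mem_colon_singleton]; simp
  refine ⟨Λ, ?_, fun a ↦ ?_⟩
  · rintro rfl
    exact hI.ne_top ((Ideal.eq_top_iff_one _).2 ((hann 1).2 (by simp)))
  · have h2 : a - algebraMap k O (counit (R := k) a) ∈ I := by simp [I, RingHom.mem_ker]
    rw [hann, sub_mul, sub_eq_zero] at h2
    rw [h2, Algebra.smul_def]

/-- Integrals of a finite-dimensional commutative Hopf algebra: a left invariant functional `l` and
an element `Λ` with `l (h Λ) = ε(h)`. -/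
theorem exists_integrals (k O : Type*) [Field k] [CommRing O] [HopfAlgebra k O]
    [Module.Finite k O] : ∃ (l : O →ₗ[k] k) (Λ : O),
      (∀ a, contract l (comul (R := k) a) = l a • (1 : O)) ∧
      ∀ h, l (h * Λ) = counit (R := k) h := by
  obtain ⟨Λ, hΛ0, hΛ⟩ := exists_ne_zero_mul_eq_counit_smul k O
  -- The map `f ↦ Λ₁ f(Λ₂)` turns out to be bijective, and the invariant functional is the preimage
  -- of `1`.
  let Φ : (O →ₗ[k] k) →ₗ[k] O :=
    { toFun f := contract f (comul Λ)
      map_add' f g := by simp [contract, LinearMap.lTensor_add]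
      map_smul' c f := by simp [contract, LinearMap.lTensor_smul] }
  have hΦ (f) : Φ f = contract f (comul Λ) := rfl
  have hmul (a : O) (f) : a * Φ f = Φ (f ∘ₗ LinearMap.mulLeft k (HopfAlgebra.antipode k a)) := by
    rw [hΦ, hΦ, ← contract_tmul_one_mul, tmul_one_mul_comul hΛ, contract_one_tmul_mul]
  have hcounit (f) : counit (R := k) (Φ f) = f Λ := by
    rw [hΦ]
    have h1 : counit (R := k) ∘ₗ contract f =
        f ∘ₗ (TensorProduct.lid k O).toLinearMap ∘ₗ (counit (R := k) (A := O)).rTensor O :=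
      TensorProduct.ext' fun x y ↦ by simp [mul_comm]
    have h2 := LinearMap.congr_fun h1 (comul Λ)
    simpa [Coalgebra.rTensor_counit_comul] using h2
  obtain ⟨f₀, hf₀⟩ := Module.Projective.exists_dual_eq_one k hΛ0
  -- The range of `Φ` is an ideal by `hmul` and is stable under `a ↦ a₁ g(a₂)`. Since `ε(Φ f₀) = 1`,
  -- the identity `a₁ S(a₂) = ε(a)` for `a = Φ f₀` exhibits `1` as an element of the range.
  have hone : ∃ l, Φ l = 1 := by
    let e := Module.finBasis k O
    have h1 : (LinearMap.mul' k O) ((HopfAlgebra.antipode k).lTensor O (comul (Φ f₀))) = 1 := by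
      simp [hcounit, hf₀]
    have h2 (z : O ⊗[k] O) : (LinearMap.mul' k O) ((HopfAlgebra.antipode k).lTensor O z) =
        ∑ i, contract (e.coord i) z * HopfAlgebra.antipode k (e i) := by
      induction z with
      | zero => simp
      | add u v hu hv => simp only [map_add, hu, hv, add_mul, Finset.sum_add_distrib]
      | tmul u v =>
        have h3 := congrArg (fun x ↦ u * HopfAlgebra.antipode k x) (e.sum_repr v).symm
        simpa [-Module.Basis.sum_repr, map_sum, Finset.mul_sum] using h3
    rw [h2] at h1
    have hW (w : O) (hw : w ∈ LinearMap.range Φ) (a : O) : w * a ∈ LinearMap.range Φ := by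
      obtain ⟨f, rfl⟩ := hw
      exact ⟨_, by rw [mul_comm, hmul]⟩
    obtain ⟨l, hl⟩ : (1 : O) ∈ LinearMap.range Φ := by
      rw [← h1]
      refine Submodule.sum_mem _ fun i _ ↦ hW _ ?_ _
      rw [hΦ, contract_comul_contract_comul]
      exact ⟨_, rfl⟩
    exact ⟨l, hl⟩
  obtain ⟨l, hl⟩ := hone
  have hsurj : Function.Surjective Φ := fun a ↦ ⟨_, by rw [← hmul, hl, mul_one]⟩
  have hinj : Function.Injective Φ :=
    (LinearMap.injective_iff_surjective_of_finrank_eq_finrank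
      (Subspace.dual_finrank_eq (K := k) (V := O))).2 hsurj
  refine ⟨l, Λ, fun a ↦ ?_, fun h ↦ ?_⟩
  · rw [← sub_eq_zero, ← Module.forall_dual_apply_eq_zero_iff k]
    intro g
    -- Invariance of `l` is tested against every functional `g`; both sides have image `g(1) • 1`
    -- under the injective map `Φ`.
    have h1 : l ∘ₗ (TensorProduct.lid k O).toLinearMap ∘ₗ g.rTensor O ∘ₗ comul = g 1 • l := by
      apply hinj
      rw [hΦ, ← contract_comul_contract_comul, ← hΦ, hl, map_smul, hl, Bialgebra.comul_one,
        Algebra.TensorProduct.one_def, contract_tmul]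
    have h2 := LinearMap.congr_fun h1 a
    have h3 (z : O ⊗[k] O) : l (TensorProduct.lid k O (g.rTensor O z)) = g (contract l z) := by
      induction z with
      | zero => simp
      | add u v hu hv => simp only [map_add, hu, hv]
      | tmul u v => simp [mul_comm]
    simp only [LinearMap.comp_apply, LinearEquiv.coe_coe, h3] at h2
    simp [h2, mul_comm]
  · rw [hΛ, map_smul, ← hcounit, hl]
    simp

/-- A comodule algebra `B` over a finite-dimensional commutative Hopf algebra `O`, with invariants
`A`, for which `B ⊗ B ⟶ B ⊗ O`, `x ⊗ y ↦ x ρ(y)`, is surjective, is a projective `A`-module,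
and the map is injective. -/
theorem projective_and_injective_of_surjective {A B : Type*} [Module.Finite k O] [CommRing A]
    [CommRing B] [Algebra k A] [Algebra k B] [Algebra A B] [IsScalarTower k A B]
    (hAB : Function.Injective (algebraMap A B)) (ρ : B →ₐ[A] B ⊗[k] O)
    (hassoc : ∀ b, TensorProduct.assoc k B O O
      (((ρ.restrictScalars k).toLinearMap.rTensor O) (ρ b)) = comul.lTensor B (ρ b))
    (hcounit : ∀ b, contract counit (ρ b) = b)
    (hinv : ∀ b, ρ b = b ⊗ₜ 1 → b ∈ (algebraMap A B).range)
    (hsurj : Function.Surjective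
      (Algebra.TensorProduct.lift (Algebra.TensorProduct.includeLeft : B →ₐ[A] B ⊗[k] O) ρ
        fun _ _ ↦ .all _ _)) :
    (Module.Finite A B ∧ Module.Projective A B) ∧ Function.Injective
      (Algebra.TensorProduct.lift (Algebra.TensorProduct.includeLeft : B →ₐ[A] B ⊗[k] O) ρ
        fun _ _ ↦ .all _ _) := by
  obtain ⟨l, Λ, hl, hΛ⟩ := exists_integrals k O
  set β : B ⊗[A] B →ₐ[A] B ⊗[k] O :=
    Algebra.TensorProduct.lift (Algebra.TensorProduct.includeLeft : B →ₐ[A] B ⊗[k] O) ρ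
        fun _ _ ↦ .all _ _ with hβ
  have hβt (x y : B) : β (x ⊗ₜ y) = (x ⊗ₜ 1) * ρ y := by simp [hβ]
  -- The trace `b₀ l(b₁)` is coinvariant because `l` is an invariant functional.
  have hmem (b : B) : contract l (ρ b) ∈ LinearMap.range (Algebra.linearMap A B) := by
    obtain ⟨a, ha⟩ := hinv (contract l (ρ b)) (by
      have h1 (z : B ⊗[k] O) : (contract l).lTensor B (TensorProduct.assoc k B O O
          ((ρ.restrictScalars k).toLinearMap.rTensor O z)) = ρ (contract l z) := by
        induction z with
        | zero => simp
        | add u v hu hv => simp only [map_add, hu, hv]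
        | tmul x o =>
          rw [contract_tmul, ← AlgHom.restrictScalars_apply k, map_smul]
          simp only [LinearMap.rTensor_tmul, AlgHom.toLinearMap_apply]
          induction (ρ.restrictScalars k) x with
          | zero => simp
          | add u v hu hv => simp only [add_tmul, map_add, hu, hv, smul_add]
          | tmul u v => simp
      have h2 (z : B ⊗[k] O) : (contract l).lTensor B (comul.lTensor B z) =
          contract l z ⊗ₜ[k] (1 : O) := by
        induction z with
        | zero => simp
        | add u v hu hv => simp only [map_add, hu, hv, add_tmul]
        | tmul x o => simp [hl, TensorProduct.smul_tmul]
      rw [← h1, hassoc, h2])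
    exact ⟨a, ha⟩
  let trB : B →ₗ[A] B :=
    { toFun b := contract l (ρ b)
      map_add' := by simp
      map_smul' a b := by
        rw [Algebra.smul_def, map_mul, AlgHom.commutes, Algebra.TensorProduct.algebraMap_apply,
          contract_tmul_one_mul, RingHom.id_apply, Algebra.smul_def] }
  let e := LinearEquiv.ofInjective (Algebra.linearMap A B) hAB
  let tr : B →ₗ[A] A := e.symm.toLinearMap ∘ₗ trB.codRestrict _ hmem
  have htr (b : B) : algebraMap A B (tr b) = contract l (ρ b) :=
    congrArg Subtype.val (e.apply_symm_apply ⟨_, hmem b⟩)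
  -- A preimage `∑ xᵢ ⊗ yᵢ` of `1 ⊗ Λ` is a dual basis: `∑ tr(b yᵢ) xᵢ = b₀ l(Λ b₁) = b₀ ε(b₁) = b`.
  obtain ⟨z, hz⟩ := hsurj ((1 : B) ⊗ₜ Λ)
  obtain ⟨s, hs⟩ := TensorProduct.exists_finset z
  have hsum : ∑ i ∈ s, (i.1 ⊗ₜ[k] (1 : O)) * ρ i.2 = 1 ⊗ₜ Λ := by
    rw [← hz, hs, map_sum]
    exact Finset.sum_congr rfl fun i _ ↦ (hβt _ _).symm
  have hbasis (b : B) : ∑ i ∈ s, tr (b * i.2) • i.1 = b := by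
    have h1 (i : B × B) : tr (b * i.2) • i.1 =
        contract l ((i.1 ⊗ₜ[k] (1 : O)) * ρ i.2 * ρ b) := by
      rw [Algebra.smul_def, htr, mul_assoc, contract_tmul_one_mul, mul_comm, map_mul,
        mul_comm (ρ b)]
    simp only [h1]
    rw [← map_sum, ← Finset.sum_mul, hsum, contract_one_tmul_mul]
    have h2 : l ∘ₗ LinearMap.mulLeft k Λ = counit := LinearMap.ext fun h ↦ by
      simp [← hΛ, mul_comm]
    rw [h2, hcounit]
  let p : (s → A) →ₗ[A] B := Fintype.linearCombination A fun i : s ↦ i.1.1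
  let q : B →ₗ[A] (s → A) := LinearMap.pi fun i ↦ tr ∘ₗ LinearMap.mulRight A i.1.2
  have hpq : p ∘ₗ q = LinearMap.id := LinearMap.ext fun b ↦ by
    have h1 := hbasis b
    rw [← Finset.sum_coe_sort] at h1
    simpa [p, q, Fintype.linearCombination_apply] using h1
  refine ⟨⟨Module.Finite.of_surjective p fun b ↦ ⟨q b, LinearMap.congr_fun hpq b⟩,
    Module.Projective.of_split q p hpq⟩, ?_⟩
  -- The same elements give an explicit left inverse of `β`.
  have hinvβ (z : B ⊗[A] B) : ∑ i ∈ s, contract l (β z * ρ i.2) ⊗ₜ[A] i.1 = z := by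
    induction z with
    | zero => simp
    | add u v hu hv =>
      simp only [map_add, add_mul, add_tmul, Finset.sum_add_distrib, hu, hv]
    | tmul x y =>
      have h1 (i : B × B) : contract l (β (x ⊗ₜ y) * ρ i.2) ⊗ₜ[A] i.1 =
          x ⊗ₜ[A] (tr (y * i.2) • i.1) := by
        rw [hβt, mul_assoc, contract_tmul_one_mul, ← map_mul, ← htr, mul_comm, ← Algebra.smul_def,
          smul_tmul]
      simp only [h1, ← tmul_sum, hbasis]
  intro z z' h
  rw [← hinvβ z, ← hinvβ z', h]

end Integrals

end LocalNori

namespace LocalNori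

/-! ### Descent of flatness along injections of Artinian rings -/

section FlatDescent

open TensorProduct

/-- Nakayama's lemma for a nilpotent ideal, which needs no finiteness of `E`: iterating the
hypothesis replaces `I` by `I ^ n`. -/
lemma eq_top_of_sup_smul_top_of_isNilpotent {R E : Type*} [CommRing R] [AddCommGroup E]
    [Module R E] {I : Ideal R} (hI : IsNilpotent I) (N : Submodule R E)
    (hN : N ⊔ I • ⊤ = ⊤) : N = ⊤ := by
  have h (n : ℕ) : N ⊔ I ^ n • ⊤ = ⊤ := by
    induction n with
    | zero => simp
    | succ n ih =>
      rw [eq_top_iff]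
      nth_rewrite 1 [← hN]
      refine sup_le le_sup_left ?_
      nth_rewrite 1 [← ih]
      rw [Submodule.smul_sup, ← Submodule.smul_assoc, smul_eq_mul, ← pow_succ']
      exact sup_le_sup_right Submodule.smul_le_right _
  obtain ⟨n, hn⟩ := hI
  simpa [hn] using h n

/-- Flatness descends along an injective homomorphism from a local ring with nilpotent maximal
ideal. -/
theorem free_of_flat_baseChange_of_isLocalRing {R S E : Type*} [CommRing R] [IsLocalRing R]
    (hm : IsNilpotent (IsLocalRing.maximalIdeal R)) [CommRing S] [Algebra R S]
    (hRS : Function.Injective (algebraMap R S)) [AddCommGroup E] [Module R E]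
    [Module.Flat S (S ⊗[R] E)] : Module.Free R E := by
  let κ := IsLocalRing.ResidueField R
  let b := Module.Free.chooseBasis κ (κ ⊗[R] E)
  obtain ⟨v, hv⟩ := (TensorProduct.mk_surjective R E κ Ideal.Quotient.mk_surjective).comp_left b
  -- Lifts `v` of a basis of `κ ⊗ E` generate `E` by nilpotent Nakayama, so only their independence
  -- requires the flatness over `S`.
  have hspan : Submodule.span R (Set.range v) = ⊤ := by
    apply eq_top_of_sup_smul_top_of_isNilpotent hm
    rw [eq_top_iff]
    intro x _
    obtain ⟨y, hy, hyx⟩ : ∃ y ∈ Submodule.span R (Set.range v),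
        (1 : κ) ⊗ₜ[R] y = (1 : κ) ⊗ₜ[R] x := by
      have h1 : (1 : κ) ⊗ₜ[R] x ∈ Submodule.span κ (Set.range b) := by simp [b.span_eq]
      change _ ∈ (Submodule.span κ (Set.range b)).restrictScalars R at h1
      rw [Submodule.restrictScalars_span R κ Ideal.Quotient.mk_surjective, ← hv, Set.range_comp,
        ← Submodule.map_span] at h1
      exact h1
    have h2 : x - y ∈ IsLocalRing.maximalIdeal R • (⊤ : Submodule R E) := by
      have h3 := congrArg (TensorProduct.quotTensorEquivQuotSMul E (IsLocalRing.maximalIdeal R)) hyx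
      have h4 (z : E) : TensorProduct.quotTensorEquivQuotSMul E (IsLocalRing.maximalIdeal R)
          ((1 : R ⧸ IsLocalRing.maximalIdeal R) ⊗ₜ[R] z) = Submodule.Quotient.mk z := by
        have := TensorProduct.quotTensorEquivQuotSMul_mk_tmul (IsLocalRing.maximalIdeal R) 1 z
        rw [one_smul] at this
        exact this
      exact (Submodule.Quotient.eq _).1 ((h4 y).symm.trans (h3.trans (h4 x))).symm
    rw [← add_sub_cancel y x]
    exact Submodule.add_mem_sup hy h2
  have hind : LinearIndependent R v := by
    -- Over each local ring `Sn` of `S` the module is flat, and the images of `v` are independent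
    -- over the residue field, so they are independent over `Sn`.
    have key (n : Ideal S) (hn : n.IsMaximal) :
        LinearIndependent (Localization.AtPrime n)
          fun i ↦ (1 : Localization.AtPrime n) ⊗ₜ[R] v i := by
      let Sn := Localization.AtPrime n
      have h1 : Module.Flat Sn (Sn ⊗[R] E) :=
        Module.Flat.of_linearEquiv
          (AlgebraTensorModule.cancelBaseChange R S Sn Sn E).symm
      -- A non-unit of `R` is nilpotent, so its image in `Sn` cannot be a unit. This makes `κn` an
      -- extension of `κ`.
      have hloc : IsLocalHom (algebraMap R Sn) := by
        refine ⟨fun a ha ↦ ?_⟩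
        by_contra h
        obtain ⟨N, hN⟩ := hm
        have h2 : algebraMap R Sn a ^ N = 0 := by
          rw [← map_pow, Ideal.mem_bot.1 (hN.le (Ideal.pow_mem_pow
            ((IsLocalRing.mem_maximalIdeal _).2 h) N)), map_zero]
        exact not_isUnit_zero (h2 ▸ ha.pow N)
      let κn := IsLocalRing.ResidueField Sn
      apply Module.IsLocalRing.linearIndependent_of_flat
      have h2 := (b.baseChange κn).linearIndependent
      let e1 : κn ⊗[κ] (κ ⊗[R] E) ≃ₗ[κn] κn ⊗[R] E := AlgebraTensorModule.cancelBaseChange R κ κn κn E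
      let e2 : κn ⊗[Sn] (Sn ⊗[R] E) ≃ₗ[κn] κn ⊗[R] E := AlgebraTensorModule.cancelBaseChange R Sn κn κn E
      have h3 := h2.map' (e1.trans e2.symm).toLinearMap (LinearEquiv.ker _)
      have h4 : ⇑(e1.trans e2.symm).toLinearMap ∘ ⇑(b.baseChange κn) =
          fun i ↦ (1 : κn) ⊗ₜ[Sn] ((1 : Sn) ⊗ₜ[R] v i) := by
        funext i
        simp [← hv, e1, e2]
      rw [h4] at h3
      exact h3
    rw [linearIndependent_iff']
    intro s g hg i hi
    apply hRS
    rw [map_zero]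
    -- A coefficient of a relation vanishes in every `Sn`, hence in `S`, hence in `R` by
    -- injectivity.
    refine eq_zero_of_localization _ fun n hn ↦ ?_
    have h1 := (linearIndependent_iff'.1 (key n hn)) s
      (fun i ↦ algebraMap R (Localization.AtPrime n) (g i)) ?_ i hi
    · rw [← h1, IsScalarTower.algebraMap_apply R S (Localization.AtPrime n)]
    · simp only [algebraMap_smul, ← tmul_smul, ← tmul_sum, hg, tmul_zero]
  exact Module.Free.of_basis (Module.Basis.mk hind hspan.ge)

/-- Flatness descends along an injective homomorphism from an Artinian ring. -/
theorem flat_of_flat_baseChange_of_isArtinianRing {R S E : Type*} [CommRing R] [IsArtinianRing R]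
    [CommRing S] [Algebra R S] (hRS : Function.Injective (algebraMap R S)) [AddCommGroup E]
    [Module R E] [Module.Flat S (S ⊗[R] E)] : Module.Flat R E := by
  refine Module.flat_of_isLocalized_maximal (S := R) (R := R) (M := E)
    (fun P _ ↦ Localization.AtPrime P ⊗[R] E)
    (fun P _ ↦ TensorProduct.mk R (Localization.AtPrime P) E 1) fun P hP ↦ ?_
  let R' := Localization.AtPrime P
  have : IsArtinianRing R' := inferInstance
  have hm : IsNilpotent (IsLocalRing.maximalIdeal R') :=
    (isArtinianRing_iff_isNilpotent_maximalIdeal R').1 inferInstance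
  let : Algebra R' (S ⊗[R] R') := Algebra.TensorProduct.rightAlgebra
  -- The hypotheses pass to the local ring `R'`: injectivity because `R'` is flat over `R`, flatness
  -- by base change.
  have hinj : Function.Injective (algebraMap R' (S ⊗[R] R')) := by
    have h1 := Module.Flat.rTensor_preserves_injective_linearMap (M := R')
      (Algebra.linearMap R S) hRS
    have h2 : (algebraMap R' (S ⊗[R] R') : R' → S ⊗[R] R') =
        (Algebra.linearMap R S).rTensor R' ∘ (TensorProduct.lid R R').symm := by
      ext x
      simp [Algebra.TensorProduct.right_algebraMap_apply]
    rw [h2]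
    exact h1.comp (LinearEquiv.injective _)
  have hflat : Module.Flat (S ⊗[R] R') ((S ⊗[R] R') ⊗[R'] (R' ⊗[R] E)) :=
    Module.Flat.of_linearEquiv
      ((AlgebraTensorModule.cancelBaseChange R R' (S ⊗[R] R') (S ⊗[R] R') E).trans
      (AlgebraTensorModule.cancelBaseChange R S (S ⊗[R] R') (S ⊗[R] R') E).symm)
  have := free_of_flat_baseChange_of_isLocalRing hm hinj (E := R' ⊗[R] E)
  have h3 : Module.Flat R' (R' ⊗[R] E) := inferInstance
  exact Module.Flat.trans R R' (R' ⊗[R] E)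

end FlatDescent

end LocalNori

namespace LocalNori

/-! ### Extending morphisms into affine schemes and closed subschemes -/

section AffineTargets

/-- A morphism inducing an isomorphism on global functions is orthogonal to affine schemes. -/
lemma exists_comp_eq_of_isIso_appTop {T' T W : Scheme.{u}} (p : T' ⟶ T) [IsIso p.appTop]
    [IsAffine W] (f : T' ⟶ W) : ∃ g : T ⟶ W, p ≫ g = f := by
  refine ⟨T.toSpecΓ ≫ Spec.map (f.appTop ≫ inv p.appTop) ≫ W.isoSpec.inv, ?_⟩
  rw [Scheme.toSpecΓ_naturality_assoc, ← Spec.map_comp_assoc, Category.assoc, IsIso.inv_hom_id,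
    Category.comp_id, ← Scheme.toSpecΓ_naturality_assoc, Scheme.toSpecΓ_isoSpec_inv,
    Category.comp_id]

lemma eq_of_comp_eq_of_injective_appTop {T' T W : Scheme.{u}} (p : T' ⟶ T)
    (hp : Function.Injective p.appTop) [IsAffine W] {f g : T ⟶ W} (h : p ≫ f = p ≫ g) :
    f = g := by
  apply ext_of_isAffine
  ext x
  apply hp
  have := congrArg (fun f : T' ⟶ W ↦ f.appTop x) h
  simp only [Scheme.Hom.comp_appTop] at this
  exact this

variable {k : Type u} [Field k]

lemma over_exists_comp_eq_of_isIso_appTop {S : Scheme.{u}} [IsAffine S] {T' T W : Over S}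
    (p : T' ⟶ T) [IsIso p.left.appTop] [IsAffine W.left] (f : T' ⟶ W) : ∃ g : T ⟶ W, p ≫ g = f := by
  obtain ⟨g, hg⟩ := exists_comp_eq_of_isIso_appTop p.left f.left
  refine ⟨Over.homMk g ?_, Over.OverMorphism.ext hg⟩
  apply eq_of_comp_eq_of_injective_appTop p.left
    (ConcreteCategory.bijective_of_isIso p.left.appTop).1
  rw [← Category.assoc, hg, Over.w, Over.w]

lemma over_eq_of_comp_eq {S : Scheme.{u}} {T' T W : Over S} (p : T' ⟶ T)
    (hp : Function.Injective p.left.appTop) [IsAffine W.left] {f g : T ⟶ W}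
    (h : p ≫ f = p ≫ g) : f = g :=
  Over.OverMorphism.ext (eq_of_comp_eq_of_injective_appTop p.left hp
    (congrArg CommaMorphism.left h))

lemma isIso_of_isIso_appTop {T W : Scheme.{u}} [IsAffine T] [IsAffine W] (f : T ⟶ W)
    [IsIso f.appTop] : IsIso f := by
  have h := Scheme.toSpecΓ_naturality f
  have : IsIso (f ≫ W.toSpecΓ) := by rw [h]; infer_instance
  exact IsIso.of_isIso_comp_right f W.toSpecΓ

/-- Schematically dominant morphisms are left orthogonal to closed immersions. -/
lemma over_exists_lift {S : Scheme.{u}} {T' T W Z : Over S} (p : T' ⟶ T)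
    [IsSchemeTheoreticallyDominant p.left] (i : W ⟶ Z) [IsClosedImmersion i.left]
    (f : T' ⟶ W) (g : T ⟶ Z) (h : f ≫ i = p ≫ g) : ∃ l : T ⟶ W, l ≫ i = g := by
  have hle : i.left.ker ≤ g.left.ker := by
    have h1 : (p.left ≫ g.left).ker = g.left.ker := by
      rw [Scheme.Hom.ker_comp, p.left.ker_eq_bot]; simp
    rw [← h1, ← Over.comp_left, ← h, Over.comp_left]
    exact Scheme.Hom.le_ker_comp _ _
  have hl := IsClosedImmersion.lift_fac i.left g.left hle
  exact ⟨Over.homMk (IsClosedImmersion.lift i.left g.left hle)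
    (by rw [← Over.w i, ← Category.assoc, hl, Over.w]), Over.OverMorphism.ext hl⟩

lemma mono_of_isClosedImmersion {S : Scheme.{u}} {W Z : Over S} (i : W ⟶ Z)
    [IsClosedImmersion i.left] : Mono i :=
  Over.mono_of_mono_left i

end AffineTargets

/-! ### Products of `k`-schemes: flatness and schematic dominance -/

section Products

variable {C : Type*} [Category C] [CartesianMonoidalCategory C]

lemma isPullback_fst_whiskerRight {V W : C} (f : V ⟶ W) (G : C) :
    IsPullback (fst V G) (f ▷ G) f (fst W G) :=
  IsPullback.of_isLimit' ⟨by simp⟩ (PullbackCone.IsLimit.mk _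
    (fun s ↦ lift s.fst (s.snd ≫ snd _ _))
    (fun s ↦ by simp)
    (fun s ↦ by
      apply CartesianMonoidalCategory.hom_ext
      · simp [s.condition]
      · simp)
    (fun s m hm hm' ↦ by
      apply CartesianMonoidalCategory.hom_ext
      · simp [hm]
      · simp [← hm']))

lemma isPullback_snd_whiskerLeft {V W : C} (f : V ⟶ W) (G : C) :
    IsPullback (snd G V) (G ◁ f) f (snd G W) :=
  IsPullback.of_isLimit' ⟨by simp⟩ (PullbackCone.IsLimit.mk _
    (fun s ↦ lift (s.snd ≫ fst _ _) s.fst)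
    (fun s ↦ by simp)
    (fun s ↦ by
      apply CartesianMonoidalCategory.hom_ext
      · simp
      · simp [s.condition])
    (fun s m hm hm' ↦ by
      apply CartesianMonoidalCategory.hom_ext
      · simp [← hm']
      · simp [hm]))

variable {k : Type u} [Field k]

lemma isPullback_left_tensor (V G : Over (Spec (.of k))) :
    IsPullback (fst V G).left (snd V G).left V.hom G.hom :=
  IsPullback.of_hasPullback _ _

instance flat_fst_left (V G : Over (Spec (.of k))) : Flat (fst V G).left :=
  MorphismProperty.of_isPullback (P := @Flat) (isPullback_left_tensor V G).flip inferInstance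

instance flat_snd_left (V G : Over (Spec (.of k))) : Flat (snd V G).left :=
  MorphismProperty.of_isPullback (P := @Flat) (isPullback_left_tensor V G) inferInstance

instance isAffine_tensor_left (V G : Over (Spec (.of k))) [IsAffine V.left] [IsAffine G.left] :
    IsAffine (V ⊗ G).left :=
  inferInstanceAs (IsAffine (pullback V.hom G.hom))

/-- `f × G` is the base change of `f` along a projection, which is flat because `k` is a field;
schematic dominance of a quasi-compact morphism survives flat base change. -/
instance isSchemeTheoreticallyDominant_whiskerRight {V W : Over (Spec (.of k))} (f : V ⟶ W)
    [IsSchemeTheoreticallyDominant f.left] [QuasiCompact f.left] (G : Over (Spec (.of k))) :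
    IsSchemeTheoreticallyDominant (f ▷ G).left :=
  .of_isPullback (f := f.left) (g := (fst W G).left)
    ((isPullback_fst_whiskerRight f G).map (Over.forget _))

instance isSchemeTheoreticallyDominant_whiskerLeft {V W : Over (Spec (.of k))} (f : V ⟶ W)
    [IsSchemeTheoreticallyDominant f.left] [QuasiCompact f.left] (G : Over (Spec (.of k))) :
    IsSchemeTheoreticallyDominant (G ◁ f).left :=
  .of_isPullback (f := f.left) (g := (snd G W).left)
    ((isPullback_snd_whiskerLeft f G).map (Over.forget _))

instance isSchemeTheoreticallyDominant_tensorHom {V W V' W' : Over (Spec (.of k))} (f : V ⟶ W)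
    (g : V' ⟶ W') [IsSchemeTheoreticallyDominant f.left] [QuasiCompact f.left]
    [IsSchemeTheoreticallyDominant g.left] [QuasiCompact g.left] :
    IsSchemeTheoreticallyDominant (f ⊗ₘ g).left := by
  rw [MonoidalCategory.tensorHom_def, Over.comp_left]
  infer_instance

end Products

/-! ### Scheme-theoretic images over `k` -/

section Image

variable {k : Type u} [Field k]

noncomputable def imageOver {V Y : Over (Spec (.of k))} (f : V ⟶ Y) : Over (Spec (.of k)) :=
  Over.mk (f.left.imageι ≫ Y.hom)

noncomputable def toImageOver {V Y : Over (Spec (.of k))} (f : V ⟶ Y) : V ⟶ imageOver f :=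
  Over.homMk f.left.toImage (by simp [imageOver])

noncomputable def imageOverι {V Y : Over (Spec (.of k))} (f : V ⟶ Y) : imageOver f ⟶ Y :=
  Over.homMk f.left.imageι (by simp [imageOver])

@[simp]
lemma toImageOver_ι {V Y : Over (Spec (.of k))} (f : V ⟶ Y) :
    toImageOver f ≫ imageOverι f = f :=
  Over.OverMorphism.ext f.left.toImage_imageι

instance {V Y : Over (Spec (.of k))} (f : V ⟶ Y) : IsClosedImmersion (imageOverι f).left :=
  inferInstanceAs (IsClosedImmersion f.left.imageι)

instance {V Y : Over (Spec (.of k))} (f : V ⟶ Y) [IsAffine Y.left] :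
    IsAffine (imageOver f).left :=
  isAffine_of_isAffineHom (X := f.left.image) (Y := Y.left) f.left.imageι

instance {V Y : Over (Spec (.of k))} (f : V ⟶ Y) [QuasiCompact f.left] [IsAffine Y.left] :
    IsSchemeTheoreticallyDominant (toImageOver f).left :=
  ⟨by
    have h1 := f.left.toImage_app_injective ⟨⊤, isAffineOpen_top _⟩
    have : IsAffine f.left.image := isAffine_of_isAffineHom (Y := Y.left) f.left.imageι
    refine Scheme.IdealSheafData.ext_of_isAffine (X := f.left.image) ?_
    refine (Scheme.Hom.ker_apply f.left.toImage _).trans ?_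
    rw [Scheme.IdealSheafData.ideal_bot]
    exact (RingHom.injective_iff_ker_eq_bot _).1 h1⟩

instance {V Y : Over (Spec (.of k))} (f : V ⟶ Y) [QuasiCompact f.left] :
    QuasiCompact (toImageOver f).left :=
  inferInstanceAs (QuasiCompact f.left.toImage)

end Image

end LocalNori

namespace LocalNori

/-! ### The image of a homomorphism of affine group-schemes -/

section ImageGroup

/-- A subobject of a group object which is closed under the operations is a group object. -/
abbrev grpObjOfMono {C : Type*} [Category C] [CartesianMonoidalCategory C] {H P : C} [GrpObj P]
    (i : H ⟶ P) [Mono i] (e : 𝟙_ C ⟶ H) (he : e ≫ i = MonObj.one) (m : H ⊗ H ⟶ H)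
    (hm : m ≫ i = (i ⊗ₘ i) ≫ MonObj.mul) (n : H ⟶ H) (hn : n ≫ i = i ≫ GrpObj.inv) : GrpObj H :=
  have hm' {T : C} (f g : T ⟶ H) : (lift f g ≫ m) ≫ i = (f ≫ i) * (g ≫ i) := by
    rw [Category.assoc, hm, CategoryTheory.Hom.mul_def, ← Category.assoc]
    congr 1
    apply CartesianMonoidalCategory.hom_ext <;> simp
  have he' {T : C} (f : T ⟶ 𝟙_ C) : (f ≫ e) ≫ i = 1 := by
    rw [Category.assoc, he, CategoryTheory.Hom.one_def, toUnit_unique f (toUnit T)]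
  have hn' {T : C} (f : T ⟶ H) : (f ≫ n) ≫ i = (f ≫ i)⁻¹ := by
    rw [Category.assoc, hn, ← Category.assoc]
    rfl
  { one := e
    mul := m
    inv := n
    one_mul := by
      have h : e ▷ H = lift (fst _ _ ≫ e) (snd _ _) := by
        apply CartesianMonoidalCategory.hom_ext <;> simp
      rw [← cancel_mono i, h, hm', he', one_mul, leftUnitor_hom]
    mul_one := by
      have h : H ◁ e = lift (fst _ _) (snd _ _ ≫ e) := by
        apply CartesianMonoidalCategory.hom_ext <;> simp
      rw [← cancel_mono i, h, hm', he', mul_one, rightUnitor_hom]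
    mul_assoc := by
      have h : m ▷ H = lift (lift (fst _ _ ≫ fst _ _) (fst _ _ ≫ snd _ _) ≫ m) (snd _ _) := by
        apply CartesianMonoidalCategory.hom_ext <;> simp [lift_comp_fst_snd]
      have h' : (α_ H H H).hom ≫ H ◁ m = lift (fst _ _ ≫ fst _ _)
          (lift (fst _ _ ≫ snd _ _) (snd _ _) ≫ m) := by
        apply CartesianMonoidalCategory.hom_ext
        · simp
        · simp only [Category.assoc, whiskerLeft_snd, lift_snd]
          rw [← Category.assoc]
          congr 1
          apply CartesianMonoidalCategory.hom_ext <;> simp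
      rw [← cancel_mono i, reassoc_of% h', h, hm', hm', hm', hm', mul_assoc]
    left_inv := by
      rw [← cancel_mono i, hm', he', Category.id_comp]
      have := hn' (𝟙 H)
      rw [Category.id_comp, Category.id_comp] at this
      rw [this, inv_mul_cancel]
    right_inv := by
      rw [← cancel_mono i, hm', he', Category.id_comp]
      have := hn' (𝟙 H)
      rw [Category.id_comp, Category.id_comp] at this
      rw [this, mul_inv_cancel] }

variable {k : Type u} [Field k] {G P : Grp (Over (Spec (.of k)))}

/-- Let `p` be the map from `G` to the image. Since `p` and `p × p` are schematically dominant and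
the image is closed in `P`, inversion and multiplication of `P` restrict to the image by
orthogonality. The group axioms are inherited from `P` along the monomorphism `j`. -/
theorem exists_image_group (φ : G ⟶ P) [IsAffine G.X.left] [IsAffine P.X.left] :
    ∃ (H : Grp (Over (Spec (.of k)))) (π : G ⟶ H) (i : H ⟶ P), π ≫ i = φ ∧
      IsSchemeTheoreticallyDominant π.hom.hom.left ∧ IsClosedImmersion i.hom.hom.left := by
  let p := toImageOver φ.hom.hom
  let j := imageOverι φ.hom.hom
  have hpj : p ≫ j = φ.hom.hom := toImageOver_ι _
  have : Mono j := mono_of_isClosedImmersion j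
  have : QuasiCompact (Over.Hom.left φ.hom.hom) := inferInstance
  obtain ⟨m, hm⟩ := over_exists_lift (p ⊗ₘ p) j (MonObj.mul ≫ p) ((j ⊗ₘ j) ≫ MonObj.mul) (by
    rw [Category.assoc, hpj, IsMonHom.mul_hom, tensorHom_comp_tensorHom_assoc, hpj])
  obtain ⟨n, hn⟩ := over_exists_lift p j (GrpObj.inv ≫ p) (j ≫ GrpObj.inv) (by
    rw [Category.assoc, hpj, ← Category.assoc, hpj]
    simp)
  let inst : GrpObj (imageOver φ.hom.hom) := grpObjOfMono j (MonObj.one ≫ p)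
    (by rw [Category.assoc, hpj, IsMonHom.one_hom]) m hm n hn
  let H : Grp (Over (Spec (.of k))) := ⟨imageOver φ.hom.hom⟩
  refine ⟨H, Grp.homMk'' (A := G) (B := H) p rfl ?_, Grp.homMk'' (A := H) (B := P) j ?_ hm,
    ?_, ?_, ?_⟩
  · change MonObj.mul ≫ p = (p ⊗ₘ p) ≫ m
    rw [← cancel_mono j, Category.assoc, Category.assoc, hm, hpj, IsMonHom.mul_hom,
      tensorHom_comp_tensorHom_assoc, hpj]
  · change (MonObj.one ≫ p) ≫ j = MonObj.one
    rw [Category.assoc, hpj, IsMonHom.one_hom]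
  · exact by ext1; ext1; exact congrArg CommaMorphism.left hpj
  · exact inferInstanceAs (IsSchemeTheoreticallyDominant p.left)
  · exact inferInstanceAs (IsClosedImmersion j.left)

end ImageGroup

end LocalNori

namespace LocalNori

open scoped TensorProduct

/-! ### Affine `k`-schemes and groups in terms of algebras -/

section SpecOver

variable {k : Type u} [Field k]

/-- The morphism of affine `k`-schemes given by a homomorphism of `k`-algebras. -/
noncomputable def specHom {R S : Type u} [CommRing R] [CommRing S] [Algebra k R] [Algebra k S]
    (f : R →ₐ[k] S) : baseX k S ⟶ baseX k R :=
  Over.homMk (Spec.map (CommRingCat.ofHom f.toRingHom)) (by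
    refine (Spec.map_comp _ _).symm.trans ?_
    rw [← CommRingCat.ofHom_comp, AlgHom.toRingHom_eq_coe, AlgHom.comp_algebraMap]
    rfl)

lemma specHom_left {R S : Type u} [CommRing R] [CommRing S] [Algebra k R] [Algebra k S]
    (f : R →ₐ[k] S) : (specHom f).left = Spec.map (CommRingCat.ofHom f.toRingHom) := rfl

lemma specHom_comp {R S T : Type u} [CommRing R] [CommRing S] [CommRing T] [Algebra k R]
    [Algebra k S] [Algebra k T] (f : R →ₐ[k] S) (g : S →ₐ[k] T) :
    specHom (g.comp f) = specHom g ≫ specHom f :=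
  Over.OverMorphism.ext (Spec.map_comp (CommRingCat.ofHom f.toRingHom)
    (CommRingCat.ofHom g.toRingHom))

lemma specHom_injective {R S : Type u} [CommRing R] [CommRing S] [Algebra k R] [Algebra k S] :
    Function.Injective (specHom : (R →ₐ[k] S) → _) := by
  intro f g h
  have := Spec.map_injective (congrArg CommaMorphism.left h)
  ext x
  exact congrArg (fun r ↦ r.hom x) this

lemma specHom_surjective {R S : Type u} [CommRing R] [CommRing S] [Algebra k R] [Algebra k S] :
    Function.Surjective (specHom : (R →ₐ[k] S) → _) := by
  intro f
  obtain ⟨g, hg⟩ := Spec.map_surjective f.left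
  have hw : CommRingCat.ofHom (algebraMap k R) ≫ g = CommRingCat.ofHom (algebraMap k S) := by
    apply Spec.map_injective
    rw [Spec.map_comp, hg]
    exact Over.w f
  exact ⟨⟨g.hom, fun r ↦ congrArg (fun r' ↦ r'.hom r) hw⟩, Over.OverMorphism.ext hg⟩

/-- The product of affine `k`-schemes as the spectrum of the tensor product. -/
noncomputable def specTensor (R S : Type u) [CommRing R] [CommRing S] [Algebra k R]
    [Algebra k S] : baseX k (R ⊗[k] S) ⟶ baseX k R ⊗ baseX k S :=
  lift (specHom Algebra.TensorProduct.includeLeft) (specHom Algebra.TensorProduct.includeRight)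

lemma specTensor_left (R S : Type u) [CommRing R] [CommRing S] [Algebra k R] [Algebra k S] :
    (specTensor (k := k) R S).left = (pullbackSpecIso k R S).inv := by
  apply pullback.hom_ext
  · refine Eq.trans ?_ (pullbackSpecIso_inv_fst k R S).symm
    exact congrArg CommaMorphism.left (lift_fst (specHom (k := k)
      (Algebra.TensorProduct.includeLeft : R →ₐ[k] R ⊗[k] S))
      (specHom Algebra.TensorProduct.includeRight))
  · refine Eq.trans ?_ (pullbackSpecIso_inv_snd k R S).symm
    exact congrArg CommaMorphism.left (lift_snd (specHom (k := k)
      (Algebra.TensorProduct.includeLeft : R →ₐ[k] R ⊗[k] S))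
      (specHom Algebra.TensorProduct.includeRight))

instance (R S : Type u) [CommRing R] [CommRing S] [Algebra k R] [Algebra k S] :
    IsIso (specTensor (k := k) R S) := by
  have h2 : IsIso ((Over.forget _).map (specTensor (k := k) R S)) := by
    change IsIso (specTensor (k := k) R S).left
    rw [specTensor_left]
    infer_instance
  exact isIso_of_reflects_iso _ (Over.forget _)

lemma lift_specHom {R S T : Type u} [CommRing R] [CommRing S] [CommRing T] [Algebra k R]
    [Algebra k S] [Algebra k T] (f : R →ₐ[k] T) (g : S →ₐ[k] T) :
    lift (specHom f) (specHom g) =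
      specHom (Algebra.TensorProduct.lift f g fun _ _ ↦ .all _ _) ≫ specTensor R S := by
  apply CartesianMonoidalCategory.hom_ext
  · rw [lift_fst, Category.assoc, specTensor, lift_fst, ← specHom_comp]
    congr 1; ext; simp
  · rw [lift_snd, Category.assoc, specTensor, lift_snd, ← specHom_comp]
    congr 1; ext; simp

noncomputable instance grpObjBaseX {O : Type u} [CommRing O] [HopfAlgebra k O] :
    GrpObj (baseX k O) :=
  inferInstanceAs (GrpObj ((Spec (.of O)).asOver (Spec (.of k))))

lemma specTensor_mul (O : Type u) [CommRing O] [HopfAlgebra k O] :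
    specTensor O O ≫ (MonObj.mul : baseX k O ⊗ baseX k O ⟶ baseX k O) =
      specHom (Bialgebra.comulAlgHom k O) := by
  apply Over.OverMorphism.ext
  rw [Over.comp_left, specTensor_left, Iso.inv_comp_eq]
  exact mul_spec_asOver_spec_left (R := .of k) (A := .of O)

lemma specHom_mul {O T : Type u} [CommRing O] [HopfAlgebra k O] [CommRing T] [Algebra k T]
    (f g : O →ₐ[k] T) : (specHom f * specHom g : baseX k T ⟶ baseX k O) =
      specHom ((Algebra.TensorProduct.lift f g fun _ _ ↦ .all _ _).comp
        (Bialgebra.comulAlgHom k O)) := by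
  rw [CategoryTheory.Hom.mul_def, lift_specHom, Category.assoc, specTensor_mul, ← specHom_comp]

lemma specHom_one {O T : Type u} [CommRing O] [HopfAlgebra k O] [CommRing T] [Algebra k T] :
    (1 : baseX k T ⟶ baseX k O) =
      specHom ((Algebra.ofId k T).comp (Bialgebra.counitAlgHom k O)) := by
  rw [CategoryTheory.Hom.one_def, specHom_comp]
  apply Over.OverMorphism.ext
  have h : (toUnit (baseX k T)).left = (specHom (Algebra.ofId k T)).left :=
    ((Category.comp_id _).symm.trans (Over.w (toUnit (baseX k T))))
  rw [Over.comp_left, Over.comp_left, h]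
  exact congrArg (_ ≫ ·) (one_spec_asOver_spec_left (R := .of k) (A := .of O))

end SpecOver

end LocalNori

namespace LocalNori

open scoped TensorProduct

lemma surjective_of_isClosedImmersion_specMap {R S : CommRingCat.{u}} (f : R ⟶ S)
    [IsClosedImmersion (Spec.map f)] : Function.Surjective f := by
  have h1 : f = (Scheme.ΓSpecIso R).inv ≫ (Spec.map f).appTop ≫ (Scheme.ΓSpecIso S).hom := by
    rw [← Scheme.ΓSpecIso_inv_naturality_assoc, Iso.inv_hom_id, Category.comp_id]
  have h2 := (IsClosedImmersion.isAffine_surjective_of_isAffine (Spec.map f)).2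
  have h3 := (ConcreteCategory.bijective_of_isIso (Scheme.ΓSpecIso R).inv).2
  have h4 := (ConcreteCategory.bijective_of_isIso (Scheme.ΓSpecIso S).hom).2
  have h5 : Function.Surjective ((Scheme.ΓSpecIso R).inv ≫ (Spec.map f).appTop ≫
      (Scheme.ΓSpecIso S).hom) := h4.comp (h2.comp h3)
  exact h1 ▸ h5

/-! ### Free actions of finite group-schemes on affine schemes -/

section FiniteQuotient

variable {k : Type u} [Field k] {A B O : Type u} [CommRing A] [CommRing B] [CommRing O]
  [Algebra k A] [Algebra k B] [Algebra A B] [IsScalarTower k A B] [HopfAlgebra k O]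

/-- This is `projective_and_injective_of_surjective` in geometric form. The action is a coaction
`ρ`, elements of `B` are morphisms to the affine line (so `hinv` says that the coinvariants lie in
`A`), and the closed immersion says that `B ⊗[A] B ⟶ B ⊗ O` is surjective. The result is that this
map is bijective and `B` is finite projective over `A`; surjectivity on spectra is lying over for
the injective integral map `A ⟶ B`. -/
theorem isPullback_of_isClosedImmersion [Module.Finite k O]
    (hAB : Function.Injective (algebraMap A B)) (act : baseX k B ⊗ baseX k O ⟶ baseX k B)
    (act_one : ∀ {T : Over (Spec (.of k))} (v : T ⟶ baseX k B),
      lift v (1 : T ⟶ baseX k O) ≫ act = v)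
    (act_mul : ∀ {T : Over (Spec (.of k))} (v : T ⟶ baseX k B) (g g' : T ⟶ baseX k O),
      lift v (g * g') ≫ act = lift (lift v g ≫ act) g' ≫ act)
    (hact : fst _ _ ≫ specHom (IsScalarTower.toAlgHom k A B) =
      act ≫ specHom (IsScalarTower.toAlgHom k A B))
    (hinv : ∀ f : baseX k B ⟶ baseX k (Polynomial k), act ≫ f = fst _ _ ≫ f →
      ∃ g, specHom (IsScalarTower.toAlgHom k A B) ≫ g = f)
    (hcl : IsClosedImmersion (pullback.lift (fst (baseX k B) (baseX k O)).left act.left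
      (congrArg CommaMorphism.left hact))) :
    Flat (specHom (k := k) (IsScalarTower.toAlgHom k A B)).left ∧
      Surjective (specHom (k := k) (IsScalarTower.toAlgHom k A B)).left ∧
      IsPullback (fst _ _) act (specHom (IsScalarTower.toAlgHom k A B))
        (specHom (IsScalarTower.toAlgHom k A B)) := by
  set h := specHom (k := k) (IsScalarTower.toAlgHom k A B) with hh
  obtain ⟨ρ₀, hρ₀⟩ := specHom_surjective (specTensor B O ≫ act)
  have hfst : specTensor (k := k) B O ≫ fst _ _ = specHom Algebra.TensorProduct.includeLeft :=
    lift_fst _ _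
  have key {T : Type u} [CommRing T] [Algebra k T] (b : B →ₐ[k] T) (o : O →ₐ[k] T) :
      lift (specHom b) (specHom o) ≫ act =
        specHom ((Algebra.TensorProduct.lift b o fun _ _ ↦ .all _ _).comp ρ₀) := by
    rw [lift_specHom, Category.assoc, ← hρ₀, ← specHom_comp]
  have hlin : ρ₀.comp (IsScalarTower.toAlgHom k A B) =
      Algebra.TensorProduct.includeLeft.comp (IsScalarTower.toAlgHom k A B) := by
    apply specHom_injective
    rw [specHom_comp, specHom_comp, hρ₀, ← hfst, Category.assoc, Category.assoc, ← hh, hact]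
  let ρ : B →ₐ[A] B ⊗[k] O := { ρ₀ with commutes' := fun a ↦ DFunLike.congr_fun hlin a }
  have hassoc : ∀ b, TensorProduct.assoc k B O O
      (((ρ.restrictScalars k).toLinearMap.rTensor O) (ρ b)) =
        Coalgebra.comul.lTensor B (ρ b) := by
    -- Coassociativity and the counit law are the action axioms at the universal points: three
    -- coordinates of `Spec (B ⊗ O ⊗ O)` here, the identity of `Spec B` below.
    have h1 := act_mul (T := baseX k (B ⊗[k] (O ⊗[k] O)))
      (specHom Algebra.TensorProduct.includeLeft)
      (specHom (Algebra.TensorProduct.includeRight.comp Algebra.TensorProduct.includeLeft))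
      (specHom (Algebra.TensorProduct.includeRight.comp Algebra.TensorProduct.includeRight))
    rw [specHom_mul, key, key, key] at h1
    have h2 := specHom_injective h1
    intro b
    have h3 := DFunLike.congr_fun h2 b
    simp only [AlgHom.comp_apply] at h3
    have h4 : ∀ z : B ⊗[k] O, TensorProduct.assoc k B O O
        (((ρ.restrictScalars k).toLinearMap.rTensor O) z) =
        (Algebra.TensorProduct.lift ((Algebra.TensorProduct.lift Algebra.TensorProduct.includeLeft
          (Algebra.TensorProduct.includeRight.comp Algebra.TensorProduct.includeLeft)
            fun _ _ ↦ .all _ _).comp ρ₀)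
          (Algebra.TensorProduct.includeRight.comp Algebra.TensorProduct.includeRight)
            fun _ _ ↦ .all _ _ : B ⊗[k] O →ₐ[k] B ⊗[k] (O ⊗[k] O)) z := by
      intro z
      induction z with
      | zero => simp
      | add x y hx hy => rw [map_add, map_add, map_add, hx, hy]
      | tmul b o =>
        rw [Algebra.TensorProduct.lift_tmul, LinearMap.rTensor_tmul, AlgHom.comp_apply]
        change TensorProduct.assoc k B O O (ρ₀ b ⊗ₜ o) = _
        induction ρ₀ b with
        | zero => simp
        | add x y hx hy => rw [TensorProduct.add_tmul, map_add, map_add, hx, hy, add_mul]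
        | tmul x y => simp
    have h5 : ∀ z : B ⊗[k] O, Coalgebra.comul.lTensor B z =
        (Algebra.TensorProduct.lift Algebra.TensorProduct.includeLeft
          ((Algebra.TensorProduct.lift
            (Algebra.TensorProduct.includeRight.comp Algebra.TensorProduct.includeLeft)
            (Algebra.TensorProduct.includeRight.comp Algebra.TensorProduct.includeRight)
            fun _ _ ↦ .all _ _).comp (Bialgebra.comulAlgHom k O))
            fun _ _ ↦ .all _ _ : B ⊗[k] O →ₐ[k] B ⊗[k] (O ⊗[k] O)) z := by
      intro z
      induction z with
      | zero => simp
      | add x y hx hy => rw [map_add, map_add, hx, hy]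
      | tmul b o =>
        rw [Algebra.TensorProduct.lift_tmul, LinearMap.lTensor_tmul, AlgHom.comp_apply]
        change b ⊗ₜ Coalgebra.comul o = _ * (Algebra.TensorProduct.lift _ _ _) (Coalgebra.comul o)
        induction Coalgebra.comul (R := k) o with
        | zero => simp
        | add x y hx hy => rw [TensorProduct.tmul_add, map_add, hx, hy, mul_add]
        | tmul x y => simp
    rw [h4, h5]
    exact h3.symm
  have hcounit : ∀ b, contract (Coalgebra.counit (R := k) (A := O)) (ρ b) = b := by
    have h1 := act_one (specHom (AlgHom.id k B))
    rw [specHom_one, key] at h1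
    have h2 := specHom_injective h1
    intro b
    have h3 := DFunLike.congr_fun h2 b
    refine Eq.trans ?_ h3
    change _ = (Algebra.TensorProduct.lift (AlgHom.id k B)
      ((Algebra.ofId k B).comp (Bialgebra.counitAlgHom k O)) fun _ _ ↦ .all _ _) (ρ b)
    induction ρ b with
    | zero => simp
    | tmul x y => simp [contract_tmul, Algebra.ofId_apply, Algebra.smul_def, mul_comm]
    | add x y hx hy => rw [map_add, map_add, hx, hy]
  have hinv' : ∀ b, ρ b = b ⊗ₜ 1 → b ∈ (algebraMap A B).range := by
    intro b hb
    obtain ⟨g, hg⟩ := hinv (specHom (Polynomial.aeval b)) (by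
      rw [← cancel_epi (specTensor B O), ← Category.assoc, ← Category.assoc, ← hρ₀, hfst,
        ← specHom_comp, ← specHom_comp]
      congr 1
      ext
      simp only [AlgHom.comp_apply, Polynomial.aeval_X]
      exact hb)
    obtain ⟨g, rfl⟩ := specHom_surjective g
    rw [hh, ← specHom_comp] at hg
    have := DFunLike.congr_fun (specHom_injective hg) Polynomial.X
    exact ⟨g Polynomial.X, by simpa using this⟩
  let L := Algebra.TensorProduct.lift (Algebra.TensorProduct.includeLeft : B →ₐ[A] B ⊗[k] O) ρ
    fun _ _ ↦ .all _ _
  have hfst' : (fst (baseX k B) (baseX k O)).left = pullback.lift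
      (fst (baseX k B) (baseX k O)).left act.left (congrArg CommaMorphism.left hact) ≫
        pullback.fst _ _ := (pullback.lift_fst _ _ _).symm
  have hsnd' : act.left = pullback.lift
      (fst (baseX k B) (baseX k O)).left act.left (congrArg CommaMorphism.left hact) ≫
        pullback.snd _ _ := (pullback.lift_snd _ _ _).symm
  set q : (baseX k B ⊗ baseX k O).left ⟶ pullback h.left h.left := pullback.lift
    (fst (baseX k B) (baseX k O)).left act.left (congrArg CommaMorphism.left hact) with hq
  let e : pullback h.left h.left ≅ Spec (.of (B ⊗[A] B)) := pullbackSpecIso A B B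
  have he₁ : e.inv ≫ pullback.fst _ _ = Spec.map (CommRingCat.ofHom
    Algebra.TensorProduct.includeLeftRingHom) := pullbackSpecIso_inv_fst A B B
  have he₂ : e.inv ≫ pullback.snd _ _ = Spec.map (CommRingCat.ofHom
    (Algebra.TensorProduct.includeRight : B →ₐ[A] B ⊗[A] B).toRingHom) :=
    pullbackSpecIso_inv_snd A B B
  have : IsIso (specTensor (k := k) B O).left := by
    rw [specTensor_left]; infer_instance
  have hL : Spec.map (CommRingCat.ofHom L.toRingHom) = (specTensor (k := k) B O).left ≫
      q ≫ e.hom := by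
    rw [← Category.assoc, ← Iso.comp_inv_eq]
    apply pullback.hom_ext
    · rw [Category.assoc, Category.assoc, ← hfst', he₁, ← Over.comp_left, hfst, ← Spec.map_comp,
        specHom_left]
      congr 1
      ext b
      simp [L]
    · rw [Category.assoc, Category.assoc, ← hsnd', he₂, ← Over.comp_left, ← hρ₀, ← Spec.map_comp,
        specHom_left]
      congr 1
      ext b
      change (1 : B ⊗[k] O) * ρ₀ b = ρ₀ b
      exact one_mul _
  have hsurj : Function.Surjective L := by
    have h1 : IsClosedImmersion (Spec.map (CommRingCat.ofHom L.toRingHom)) := by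
      rw [hL]
      infer_instance
    exact surjective_of_isClosedImmersion_specMap (CommRingCat.ofHom L.toRingHom)
  obtain ⟨⟨hfin, hproj⟩, hinj⟩ := projective_and_injective_of_surjective hAB ρ hassoc hcounit hinv'
    hsurj
  refine ⟨?_, ?_, ?_⟩
  · rw [hh, specHom_left, Flat.SpecMap_iff]
    exact (RingHom.flat_algebraMap_iff.2 inferInstance : (algebraMap A B).Flat)
  · have : Algebra.IsIntegral A B := inferInstance
    have h1 : Function.Surjective (PrimeSpectrum.comap (algebraMap A B)) :=
      (algebraMap_isIntegral_iff.2 this).comap_surjective hAB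
    exact ⟨h1⟩
  · have hLi : IsIso (Spec.map (CommRingCat.ofHom L.toRingHom)) := by
      have : IsIso (CommRingCat.ofHom L.toRingHom) :=
        (ConcreteCategory.isIso_iff_bijective _).2 ⟨hinj, hsurj⟩
      infer_instance
    have hqi : IsIso q := by
      rw [hL] at hLi
      have := IsIso.of_isIso_comp_left (specTensor (k := k) B O).left (q ≫ e.hom)
      exact IsIso.of_isIso_comp_right q e.hom
    have h1 : IsPullback (fst (baseX k B) (baseX k O)).left act.left h.left h.left :=
      IsPullback.of_iso_pullback ⟨congrArg CommaMorphism.left hact⟩ (asIso q) hfst'.symm hsnd'.symm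
    exact IsPullback.of_map (Over.forget _) hact h1

end FiniteQuotient

end LocalNori

namespace LocalNori

/-! ### The image of a bundle over `U` in a finite bundle over `X` -/

section Reduction

variable {k : Type u} [Field k]

instance isAffine_baseX_left (R : Type u) [CommRing R] [Algebra k R] : IsAffine (baseX k R).left :=
  inferInstanceAs (IsAffine (Spec (.of R)))

lemma exists_iso_baseX (Y : Over (Spec (.of k))) [IsAffine Y.left] :
    ∃ (B : Type u) (_ : CommRing B) (_ : Algebra k B), Nonempty (Y ≅ baseX k B) := by
  obtain ⟨B, ⟨e⟩⟩ := essImage_algSpec.2 ‹IsAffine Y.left›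
  exact ⟨B.unop, inferInstance, inferInstance, ⟨e.symm⟩⟩

lemma module_finite_of_isFinite {O : Type u} [CommRing O] [Algebra k O]
    (h : IsFinite (baseX k O).hom) : Module.Finite k O :=
  RingHom.finite_algebraMap.1 ((IsFinite.SpecMap_iff _).1 h)

/-- The image is closed in the finite group `P`, so it is finite; being affine it is the spectrum of
a Hopf algebra, the form in which integrals are available. -/
theorem exists_finite_image_group {G P : Grp (Over (Spec (.of k)))} (φ : G ⟶ P)
    [IsAffine G.X.left] (hP : IsFinite P.X.hom) :
    ∃ (O : Type u) (_ : CommRing O) (_ : HopfAlgebra k O) (π : G ⟶ ⟨baseX k O⟩)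
      (i : (⟨baseX k O⟩ : Grp (Over (Spec (.of k)))) ⟶ P), Module.Finite k O ∧ π ≫ i = φ ∧
      IsSchemeTheoreticallyDominant π.hom.hom.left ∧ IsClosedImmersion i.hom.hom.left := by
  have : IsAffine P.X.left := isAffine_of_isAffineHom (Y := Spec (.of k)) P.X.hom
  obtain ⟨H, π, i, hφ, hπ, hi⟩ := exists_image_group φ
  have : IsAffine H.X.left := isAffine_of_isAffineHom i.hom.hom.left
  obtain ⟨O, ⟨e⟩⟩ := essImage_hopfSpec.2 this
  let e' : (⟨baseX k O.unop⟩ : Grp (Over (Spec (.of k)))) ≅ H := e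
  have he : IsIso e'.hom.hom.hom.left :=
    inferInstanceAs (IsIso ((Grp.forget _ ⋙ Over.forget _).map e'.hom))
  have he' : IsIso e'.inv.hom.hom.left :=
    inferInstanceAs (IsIso ((Grp.forget _ ⋙ Over.forget _).map e'.inv))
  have hi' : IsClosedImmersion (e'.hom ≫ i).hom.hom.left := by
    change IsClosedImmersion (e'.hom.hom.hom.left ≫ i.hom.hom.left)
    infer_instance
  refine ⟨O.unop, inferInstance, inferInstance, π ≫ e'.inv, e'.hom ≫ i,
    module_finite_of_isFinite ?_, ?_, ?_, hi'⟩
  · have := Over.w (e'.hom ≫ i).hom.hom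
    rw [← this]
    infer_instance
  · simp [hφ]
  · change IsSchemeTheoreticallyDominant (π.hom.hom.left ≫ e'.inv.hom.hom.left)
    infer_instance

lemma isClosedImmersion_tensorHom_left {V W V' W' : Over (Spec (.of k))} (f : V ⟶ W)
    (g : V' ⟶ W') [IsClosedImmersion f.left] [IsClosedImmersion g.left] :
    IsClosedImmersion (f ⊗ₘ g).left := by
  have h1 : IsClosedImmersion (f ▷ V').left :=
    MorphismProperty.of_isPullback (P := @IsClosedImmersion)
      ((isPullback_fst_whiskerRight f V').map (Over.forget _)) ‹_›
  have h2 : IsClosedImmersion (W ◁ g).left :=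
    MorphismProperty.of_isPullback (P := @IsClosedImmersion)
      ((isPullback_snd_whiskerLeft g W).map (Over.forget _)) ‹_›
  rw [MonoidalCategory.tensorHom_def, Over.comp_left]
  infer_instance

lemma injective_appTop_of_isSchemeTheoreticallyDominant {X Y : Scheme.{u}} (f : X ⟶ Y)
    [IsSchemeTheoreticallyDominant f] [QuasiCompact f] : Function.Injective f.appTop :=
  f.app_injective _

variable {A : Type u} [CommRing A] [IsLocalRing A] [Algebra k A] [IsCompleteNormalGerm k A]

variable (k A) in
lemma isIso_inclU_appTop : IsIso (inclU k A).left.appTop :=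
  have := IsCompleteNormalGerm.isNoetherianRing (k := k) (A := A)
  have := IsCompleteNormalGerm.isDomain (k := k) (A := A)
  have := IsCompleteNormalGerm.isIntegrallyClosed (k := k) (A := A)
  isIso_punctured_appTop (IsCompleteNormalGerm.two_le_dim (k := k) (A := A))

variable (k A) in
lemma compactSpace_baseU : CompactSpace (baseU k A).left := by
  have := IsCompleteNormalGerm.isNoetherianRing (k := k) (A := A)
  have : IsNoetherian (Spec (CommRingCat.of A)) := inferInstance
  have : TopologicalSpace.NoetherianSpace (puncturedSpec A) :=
    (puncturedSpec A).ι.isOpenEmbedding.isInducing.noetherianSpace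
  exact inferInstanceAs (CompactSpace (puncturedSpec A))

lemma compactSpace_of_bundle (W : PrincipalBundle (baseU k A)) : CompactSpace W.V.left :=
  have := compactSpace_baseU k A
  QuasiCompact.compactSpace_of_compactSpace W.h.left

/-- Invariant functions on a principal bundle are functions on the base. -/
lemma PrincipalBundle.exists_desc {S : Over (Spec (.of k))} (W : PrincipalBundle S)
    {Z : Over (Spec (.of k))} (f : W.V ⟶ Z) (hf : W.act ≫ f = fst _ _ ≫ f) :
    ∃ g : S ⟶ Z, W.h ≫ g = f := by
  have hpb : IsPullback (fst W.V W.G.X).left W.act.left W.h.left W.h.left :=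
    W.isPullback.map (Over.forget _)
  have hd : ∀ {T : Scheme.{u}} (g₁ g₂ : T ⟶ W.V.left), g₁ ≫ W.h.left = g₂ ≫ W.h.left →
      g₁ ≫ f.left = g₂ ≫ f.left := by
    intro T g₁ g₂ h
    rw [← hpb.lift_fst g₁ g₂ h]
    conv_rhs => rw [← hpb.lift_snd g₁ g₂ h]
    rw [Category.assoc, Category.assoc, ← Over.comp_left, ← Over.comp_left, hf]
  -- An affine, flat and surjective morphism is an effective epimorphism, and the torsor condition
  -- identifies its kernel pair with the action.
  have hfac := EffectiveEpi.fac W.h.left f.left hd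
  refine ⟨Over.homMk (EffectiveEpi.desc W.h.left f.left hd) ?_, Over.OverMorphism.ext hfac⟩
  rw [← cancel_epi W.h.left, ← Category.assoc, hfac, Over.w, Over.w]

lemma PrincipalBundle.epi_h {S : Over (Spec (.of k))} (W : PrincipalBundle S) : Epi W.h :=
  Over.epi_of_epi_left W.h

/-- `W ⟶ U` is an epimorphism, and `U` and `X` have the same functions, so affine targets do not
distinguish them. -/
lemma PrincipalBundle.epi_toX (W : PrincipalBundle (baseU k A)) {Z : Over (Spec (.of k))}
    [IsAffine Z.left] {f g : baseX k A ⟶ Z}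
    (h : (W.h ≫ inclU k A) ≫ f = (W.h ≫ inclU k A) ≫ g) : f = g := by
  have := W.epi_h
  have := isIso_inclU_appTop k A
  rw [Category.assoc, Category.assoc, cancel_epi] at h
  exact over_eq_of_comp_eq (inclU k A) (ConcreteCategory.bijective_of_isIso _).1 h

/-- The images of `W.V` in `Q.V` and of `W.G` in `Q.G` form a bundle over all of `X`, although `W`
lives only over `U`. Freeness of the action is inherited from `Q`, and the ring of invariants is `A`
because invariants on `W` are functions on `U`. Finiteness is needed only of the group of `Q`, so
`W` may belong to a pro-object. -/
theorem exists_image_bundle (W : PrincipalBundle (baseU k A)) [IsAffine W.G.X.left]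
    (Q : PrincipalBundle (baseX k A)) (hQ : IsFinite Q.G.X.hom) (φ : W.G ⟶ Q.G) (f : W.V ⟶ Q.V)
    (hf : f ≫ Q.h = W.h ≫ inclU k A) (hφ : W.act ≫ f = (f ⊗ₘ φ.hom.hom) ≫ Q.act) :
    ∃ (Q' : PrincipalBundle (baseX k A)) (a : Q' ⟶ Q) (π : W.G ⟶ Q'.G) (p : W.V ⟶ Q'.V),
      IsFinite Q'.G.X.hom ∧ IsSchemeTheoreticallyDominant π.hom.hom.left ∧
      IsClosedImmersion (PrincipalBundle.Hom.φ a).hom.hom.left ∧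
      π ≫ PrincipalBundle.Hom.φ a = φ ∧ p ≫ PrincipalBundle.Hom.f a = f ∧
      IsSchemeTheoreticallyDominant p.left := by
  have := compactSpace_of_bundle W
  have : IsAffine Q.V.left := isAffine_of_isAffineHom (Y := Spec (.of A)) Q.h.left
  have : QuasiCompact f.left := inferInstance
  obtain ⟨O, _, _, π, i, hO, hi, hπ, hic⟩ := exists_finite_image_group φ hQ
  obtain ⟨B, _, _, ⟨e⟩⟩ := exists_iso_baseX (imageOver f)
  have : IsIso e.hom.left := inferInstanceAs (IsIso ((Over.forget _).map e.hom))
  have : IsIso e.inv.left := inferInstanceAs (IsIso ((Over.forget _).map e.inv))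
  obtain ⟨p, hpe⟩ : ∃ p : W.V ⟶ baseX k B, p = toImageOver f ≫ e.hom := ⟨_, rfl⟩
  obtain ⟨j, hje⟩ : ∃ j : baseX k B ⟶ Q.V, j = e.inv ≫ imageOverι f := ⟨_, rfl⟩
  have hpj : p ≫ j = f := by simp [hpe, hje]
  have hp : IsSchemeTheoreticallyDominant p.left :=
    hpe ▸ inferInstanceAs (IsSchemeTheoreticallyDominant ((toImageOver f).left ≫ e.hom.left))
  have hpq : QuasiCompact p.left :=
    hpe ▸ inferInstanceAs (QuasiCompact ((toImageOver f).left ≫ e.hom.left))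
  have hp' := injective_appTop_of_isSchemeTheoreticallyDominant p.left
  have hj : IsClosedImmersion j.left :=
    hje ▸ inferInstanceAs (IsClosedImmersion (e.inv.left ≫ (imageOverι f).left))
  have hjm : Mono j := mono_of_isClosedImmersion j
  obtain ⟨g, hg⟩ := specHom_surjective (j ≫ Q.h)
  let _ : Algebra A B := g.toAlgebra
  have : IsScalarTower k A B := .of_algebraMap_eq fun x ↦ (g.commutes x).symm
  have hh : specHom (IsScalarTower.toAlgHom k A B) = j ≫ Q.h := by
    rw [← hg]
    rfl
  have hph : p ≫ specHom (IsScalarTower.toAlgHom k A B) = W.h ≫ inclU k A := by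
    rw [hh, ← Category.assoc, hpj, hf]
  have hAB : Function.Injective (algebraMap A B) := by
    intro x y hxy
    have h1 : (specHom (Polynomial.aeval x) : baseX k A ⟶ baseX k (Polynomial k)) =
        specHom (Polynomial.aeval y) := by
      apply W.epi_toX
      rw [← hph, Category.assoc, Category.assoc, ← specHom_comp, ← specHom_comp]
      congr 2
      ext
      simpa using hxy
    simpa using DFunLike.congr_fun (specHom_injective h1) Polynomial.X
  have hiφ : φ.hom.hom = π.hom.hom ≫ i.hom.hom := by rw [← hi]; rfl
  have : IsAffine (⟨baseX k O⟩ : Grp (Over (Spec (.of k)))).X.left := isAffine_baseX_left O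
  have hπq : QuasiCompact π.hom.hom.left := inferInstance
  -- `p × π` is schematically dominant and `j` is a closed immersion, so the action of `Q.G` on
  -- `Q.V` restricts to the images.
  obtain ⟨act, hact⟩ := over_exists_lift (p ⊗ₘ π.hom.hom) j (W.act ≫ p)
    ((j ⊗ₘ i.hom.hom) ≫ Q.act) (by
      rw [Category.assoc, hpj, hφ, tensorHom_comp_tensorHom_assoc, hpj, ← hiφ])
  have hlact {T : Over (Spec (.of k))} (v : T ⟶ baseX k B) (x : T ⟶ baseX k O) :
      (lift v x ≫ act) ≫ j = lift (v ≫ j) (x ≫ i.hom.hom) ≫ Q.act := by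
    rw [Category.assoc, hact, ← Category.assoc]
    congr 1
    apply CartesianMonoidalCategory.hom_ext <;> simp
  have act_one : ∀ {T : Over (Spec (.of k))} (v : T ⟶ baseX k B),
      lift v (1 : T ⟶ baseX k O) ≫ act = v := by
    intro T v
    rw [← cancel_mono j, hlact, MonObj.one_comp, Q.act_one]
  have act_mul : ∀ {T : Over (Spec (.of k))} (v : T ⟶ baseX k B) (g g' : T ⟶ baseX k O),
      lift v (g * g') ≫ act = lift (lift v g ≫ act) g' ≫ act := by
    intro T v x y
    rw [← cancel_mono j, hlact, MonObj.mul_comp, Q.act_mul, hlact, hlact]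
  have hpact : (p ⊗ₘ π.hom.hom) ≫ act = W.act ≫ p := by
    rw [← cancel_mono j, Category.assoc, hact, Category.assoc, hpj, hφ,
      tensorHom_comp_tensorHom_assoc, hpj, ← hiφ]
  have hinv : fst _ _ ≫ specHom (IsScalarTower.toAlgHom k A B) =
      act ≫ specHom (IsScalarTower.toAlgHom k A B) := by
    rw [hh, reassoc_of% hact, ← Q.isPullback.w]
    simp
  obtain ⟨hflat, hsurj, hpb⟩ := isPullback_of_isClosedImmersion hAB act act_one act_mul hinv
    (by
      intro u hu
      -- An invariant function on the image pulls back to an invariant function on `W.V`. It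
      -- descends to `U`, extends to `X`, and the extension is the right one because `p` is
      -- injective on functions.
      obtain ⟨w, hw⟩ := W.exists_desc (p ≫ u) (by
        rw [← reassoc_of% hpact, hu]
        simp)
      have := isIso_inclU_appTop k A
      obtain ⟨w', hw'⟩ := over_exists_comp_eq_of_isIso_appTop (inclU k A) w
      refine ⟨w', over_eq_of_comp_eq p hp' ?_⟩
      rw [reassoc_of% hph, hw', hw])
    (by
      -- After the map `m` to `Q.V ×_X Q.V`, the morphism in question becomes `j × i` followed by
      -- the torsor isomorphism of `Q`, which is a closed immersion; `m` is then cancelled.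
      have hj₂ : j.left ≫ Q.h.left = (specHom (k := k) (IsScalarTower.toAlgHom k A B)).left := by
        rw [hh, Over.comp_left]
      have hQpb : IsPullback (fst Q.V Q.G.X).left Q.act.left Q.h.left Q.h.left :=
        Q.isPullback.map (Over.forget _)
      let m : pullback (specHom (k := k) (IsScalarTower.toAlgHom k A B)).left
          (specHom (k := k) (IsScalarTower.toAlgHom k A B)).left ⟶
          pullback Q.h.left Q.h.left :=
        pullback.map _ _ _ _ j.left j.left (𝟙 _) (by simp [hj₂]) (by simp [hj₂])
      have hji := isClosedImmersion_tensorHom_left j i.hom.hom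
      have hm : pullback.lift (fst (baseX k B) (baseX k O)).left act.left
          (congrArg CommaMorphism.left hinv) ≫ m =
          (j ⊗ₘ i.hom.hom).left ≫ hQpb.isoPullback.hom := by
        apply pullback.hom_ext
        · rw [Category.assoc, Category.assoc, hQpb.isoPullback_hom_fst, pullback.lift_fst,
            pullback.lift_fst_assoc, ← Over.comp_left, ← Over.comp_left, tensorHom_fst]
        · rw [Category.assoc, Category.assoc, hQpb.isoPullback_hom_snd, pullback.lift_snd,
            pullback.lift_snd_assoc, ← Over.comp_left, ← Over.comp_left, hact]
      have : IsClosedImmersion (pullback.lift (fst (baseX k B) (baseX k O)).left act.left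
          (congrArg CommaMorphism.left hinv) ≫ m) := by
        rw [hm]
        infer_instance
      exact IsClosedImmersion.of_comp _ m)
  let Q' : PrincipalBundle (baseX k A) :=
    { G := ⟨baseX k O⟩
      V := baseX k B
      h := specHom (IsScalarTower.toAlgHom k A B)
      act := act
      act_one := act_one
      act_mul := act_mul
      isAffineHom := inferInstanceAs (IsAffineHom (Spec.map _))
      flat := hflat
      surjective := hsurj
      isPullback := hpb }
  exact ⟨Q', ⟨j, i, hh.symm, hact⟩, π, p, (IsFinite.SpecMap_iff _).2
    (RingHom.finite_algebraMap.2 hO), hπ, hic, hi, hpj, hp⟩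

end Reduction

end LocalNori

namespace LocalNori

/-! ### Morphisms to affine schemes through `V.toSpecΓ` -/

section SpecΓ

lemma toSpecΓ_comp_specMap {V : Scheme.{u}} {R : CommRingCat.{u}} (g : V ⟶ Spec R) :
    V.toSpecΓ ≫ Spec.map ((Scheme.ΓSpecIso R).inv ≫ g.appTop) = g := by
  rw [Spec.map_comp, ← Scheme.toSpecΓ_naturality_assoc, ← SpecMap_ΓSpecIso_hom, ← Spec.map_comp,
    Iso.inv_hom_id, Spec.map_id, Category.comp_id]

lemma toSpecΓ_comp_specMap_appTop {V : Scheme.{u}} {R : CommRingCat.{u}} (s : R ⟶ Γ(V, ⊤)) :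
    (V.toSpecΓ ≫ Spec.map s).appTop = (Scheme.ΓSpecIso R).hom ≫ s := by
  rw [Scheme.Hom.comp_appTop, Scheme.toSpecΓ_appTop, Scheme.ΓSpecIso_naturality]

lemma specMap_comp_eq_of_toSpecΓ {V V' : Scheme.{u}} [IsAffine V] {R K : CommRingCat.{u}}
    (s : R ⟶ Γ(V', ⊤)) (p : V' ⟶ V) [IsIso p.appTop] (y : Spec K ⟶ V) (d : Spec R ⟶ V)
    (h : (V'.toSpecΓ ≫ Spec.map s) ≫ d = p) :
    Spec.map (s ≫ inv p.appTop ≫ y.appTop ≫ (Scheme.ΓSpecIso K).hom) ≫ d = y := by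
  apply ext_of_isAffine
  have h1 : d.appTop ≫ (Scheme.ΓSpecIso R).hom ≫ s = p.appTop := by
    rw [← toSpecΓ_comp_specMap_appTop, ← Scheme.Hom.comp_appTop, h]
  have h2 (t : R ⟶ K) : (Spec.map t).appTop = (Scheme.ΓSpecIso R).hom ≫
      t ≫ (Scheme.ΓSpecIso K).inv := by
    rw [← Scheme.ΓSpecIso_naturality_assoc, Iso.hom_inv_id, Category.comp_id]
  rw [Scheme.Hom.comp_appTop, h2, Category.assoc, Category.assoc, Category.assoc, Iso.hom_inv_id,
    Category.comp_id, reassoc_of% h1, IsIso.hom_inv_id_assoc]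

end SpecΓ

/-! ### Integral closures and the transport of points -/

section IntegralClosureLift

variable {k : Type u} [Field k] {A : Type u} [CommRing A] [Algebra k A]

/-- A principal bundle under a finite group is integral over its base. -/
lemma PrincipalBundle.isIntegralHom_h {S : Over (Spec (.of k))} (Q : PrincipalBundle S)
    (hQ : IsFinite Q.G.X.hom) : IsIntegralHom Q.h.left := by
  have h1 : IsFinite (fst Q.V Q.G.X).left :=
    MorphismProperty.of_isPullback (P := @IsFinite) (isPullback_left_tensor Q.V Q.G.X).flip hQ
  -- Pulled back along itself, `h` becomes the projection `V × G ⟶ V`, which is finite. Universal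
  -- closedness descends along the flat cover `h`, and an affine universally closed morphism is
  -- integral.
  have h2 : UniversallyClosed Q.h.left :=
    MorphismProperty.of_isPullback_of_descendsAlong (P := @UniversallyClosed)
      (Q := @Surjective ⊓ @Flat ⊓ @QuasiCompact) (Q.isPullback.map (Over.forget _))
      ⟨⟨inferInstanceAs (Surjective Q.h.left), inferInstanceAs (Flat Q.h.left)⟩,
        inferInstanceAs (QuasiCompact Q.h.left)⟩
      (inferInstanceAs (UniversallyClosed (fst Q.V Q.G.X).left))
  exact IsIntegralHom.iff_universallyClosed_and_isAffineHom.2 ⟨h2, inferInstance⟩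

lemma isIntegral_coordMap {Z : Over (Spec (.of k))} (g : Z ⟶ baseX k A)
    [IsIntegralHom g.left] : (coordMap g).IsIntegral := by
  have h1 : g.left.appTop.hom.IsIntegral :=
    IsIntegralHom.isIntegral_app (f := g.left) ⊤ (isAffineOpen_top (Spec (.of A)))
  have h2 : (Scheme.ΓSpecIso (.of A)).inv.hom.IsIntegral :=
    RingHom.isIntegral_of_surjective _ (ConcreteCategory.bijective_of_isIso _).2
  exact RingHom.IsIntegral.trans _ _ h2 h1

/-- The canonical morphism from `V` to its integral closure. -/
noncomputable def toIntClosure {V : Over (Spec (.of k))} (g : V ⟶ baseX k A) :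
    V ⟶ intClosure g :=
  Over.homMk (V.left.toSpecΓ ≫ Spec.map (CommRingCat.ofHom (intClosureRing g).subtype)) (by
    have h1 : CommRingCat.ofHom (toIntClosureRing g) ≫
        CommRingCat.ofHom (intClosureRing g).subtype =
        (Scheme.ΓSpecIso (.of A)).inv ≫ g.left.appTop := rfl
    have h2 : V.left.toSpecΓ ≫ Spec.map (CommRingCat.ofHom (intClosureRing g).subtype) ≫
        Spec.map (CommRingCat.ofHom (toIntClosureRing g)) = g.left := by
      rw [← Spec.map_comp, h1, toSpecΓ_comp_specMap]
    have h3 := congrArg (· ≫ (baseX k A).hom) h2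
    simp only [Category.assoc] at h3 ⊢
    exact h3.trans (Over.w g))

lemma toIntClosure_appTop {V : Over (Spec (.of k))} (g : V ⟶ baseX k A) :
    (toIntClosure g).left.appTop = (Scheme.ΓSpecIso (.of (intClosureRing g))).hom ≫
      CommRingCat.ofHom (intClosureRing g).subtype :=
  toSpecΓ_comp_specMap_appTop _

lemma injective_toIntClosure_appTop {V : Over (Spec (.of k))} (g : V ⟶ baseX k A) :
    Function.Injective (toIntClosure g).left.appTop := by
  rw [toIntClosure_appTop]
  exact Subtype.val_injective.comp (ConcreteCategory.bijective_of_isIso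
    (Scheme.ΓSpecIso (.of (intClosureRing g))).hom).1

lemma toIntClosure_map {V W : Over (Spec (.of k))} (g : V ⟶ baseX k A) (g' : W ⟶ baseX k A)
    (f : V ⟶ W) (w : f ≫ g' = g) :
    toIntClosure g ≫ intClosureMap g g' f w = f ≫ toIntClosure g' := by
  apply Over.OverMorphism.ext
  have h1 : CommRingCat.ofHom (intClosureRingMap g g' f w) ≫
      CommRingCat.ofHom (intClosureRing g).subtype =
      CommRingCat.ofHom (intClosureRing g').subtype ≫ f.left.appTop := rfl
  change (V.left.toSpecΓ ≫ Spec.map _) ≫ Spec.map _ = f.left ≫ W.left.toSpecΓ ≫ Spec.map _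
  rw [Category.assoc, ← Spec.map_comp, h1, Spec.map_comp, Scheme.toSpecΓ_naturality_assoc]

/-- A morphism from `V` to an integral `X`-scheme extends to the integral closure of `V`. -/
lemma exists_toIntClosure_comp_eq {V Z : Over (Spec (.of k))} (g : V ⟶ baseX k A)
    (g' : Z ⟶ baseX k A) [IsIntegralHom g'.left] (f : V ⟶ Z) (w : f ≫ g' = g) :
    ∃ d : intClosure g ⟶ Z, toIntClosure g ≫ d = f := by
  have : IsAffine Z.left := isAffine_of_isAffineHom (Y := Spec (.of A)) g'.left
  let r : Γ(Z.left, ⊤) →+* intClosureRing g := f.left.appTop.hom.codRestrict _ fun s ↦ by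
    rw [mem_intClosureRing, ← coordMap_comp g g' f w]
    exact (isIntegral_coordMap g' s).map _
  have hr : CommRingCat.ofHom r ≫ CommRingCat.ofHom (intClosureRing g).subtype =
    f.left.appTop := rfl
  let d : (intClosure g).left ⟶ Z.left := Spec.map (CommRingCat.ofHom r) ≫ Z.left.isoSpec.inv
  have hd : (toIntClosure g).left ≫ d = f.left := by
    change (V.left.toSpecΓ ≫ Spec.map _) ≫ Spec.map _ ≫ Z.left.isoSpec.inv = _
    rw [Category.assoc, ← Spec.map_comp_assoc, hr, ← Scheme.toSpecΓ_naturality_assoc,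
      Scheme.toSpecΓ_isoSpec_inv, Category.comp_id]
  refine ⟨Over.homMk d ?_, Over.OverMorphism.ext hd⟩
  apply eq_of_comp_eq_of_injective_appTop _ (injective_toIntClosure_appTop g)
  rw [← Category.assoc, hd, Over.w, Over.w]

variable [IsLocalRing A] [IsCompleteNormalGerm k A]

/-- `restrictPoint` was defined by inverting `p` on functions, and `d` induces `p` on functions, so
the two cancel. -/
lemma restrictPoint_comp {V V' : Over (Spec (.of k))} {h : V ⟶ baseX k A}
    {p : V' ⟶ V} {h' : V' ⟶ baseU k A} (hp : IsPullback p h' h (inclU k A)) [IsAffineHom h.left]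
    [Flat h.left] (y : 𝟙_ (Over (Spec (.of k))) ⟶ V) (d : intClosure (h' ≫ inclU k A) ⟶ V)
    (hd : toIntClosure (h' ≫ inclU k A) ≫ d = p) : restrictPoint hp y ≫ d = y := by
  have : IsAffine V.left := isAffine_of_isAffineHom (Y := Spec (.of A)) h.left
  have := isIso_appTop_of_flat hp
  exact Over.OverMorphism.ext (specMap_comp_eq_of_toSpecΓ (K := .of k)
    (CommRingCat.ofHom (intClosureRing (h' ≫ inclU k A)).subtype) p.left y.left d.left
    (congrArg CommaMorphism.left hd))

/-- The image bundle also needs a `k`-point. It is integral over `X`, so the map from `L` extends to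
the integral closure of `L`, and the image of `L.y` is the required point. -/
theorem exists_image_pointedBundle_of_isPullback (L : LocalBundle k A)
    [IsAffine L.bundle.G.X.left] (Q : PointedBundle (baseX k A) (pointX k A))
    (hQ : IsFinite Q.bundle.G.X.hom) {V' : Over (Spec (.of k))} {q : V' ⟶ Q.bundle.V}
    {h' : V' ⟶ baseU k A} (hq : IsPullback q h' Q.bundle.h (inclU k A)) (f : L.bundle.V ⟶ V')
    (φ : L.bundle.G ⟶ Q.bundle.G) (hf : f ≫ h' = L.bundle.h)
    (hφ : L.bundle.act ≫ f = (f ⊗ₘ φ.hom.hom) ≫ Q.bundle.baseChangeAct hq)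
    (hf' : f ≫ h' ≫ inclU k A = L.bundle.h ≫ inclU k A)
    (hy : L.y ≫ intClosureMap (L.bundle.h ≫ inclU k A) (h' ≫ inclU k A) f hf' =
      restrictPoint hq Q.y) :
    ∃ (Q' : PointedBundle (baseX k A) (pointX k A)) (a : Q' ⟶ Q)
      (π : L.bundle.G ⟶ Q'.bundle.G), IsFinite Q'.bundle.G.X.hom ∧
      IsSchemeTheoreticallyDominant π.hom.hom.left ∧
      IsClosedImmersion (PrincipalBundle.Hom.φ (PointedBundle.Hom.hom a)).hom.hom.left ∧
      π ≫ PrincipalBundle.Hom.φ (PointedBundle.Hom.hom a) = φ := by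
  have hfq : (f ≫ q) ≫ Q.bundle.h = L.bundle.h ≫ inclU k A := by
    rw [Category.assoc, hq.w, ← Category.assoc, hf]
  have hφq : L.bundle.act ≫ f ≫ q = ((f ≫ q) ⊗ₘ φ.hom.hom) ≫ Q.bundle.act := by
    rw [← Category.assoc, hφ, Category.assoc, PrincipalBundle.baseChangeAct_fst, ← Category.assoc]
    congr 1
    apply CartesianMonoidalCategory.hom_ext <;> simp
  obtain ⟨Q', a, π, p, hfin, hπ, hac, hπa, hpa, hp⟩ :=
    exists_image_bundle L.bundle Q.bundle hQ φ (f ≫ q) hfq hφq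
  have := Q.bundle.isIntegralHom_h hQ
  have := Q'.isIntegralHom_h hfin
  have : IsAffine Q.bundle.V.left := isAffine_of_isAffineHom (Y := Spec (.of A)) Q.bundle.h.left
  have hph : p ≫ Q'.h = L.bundle.h ≫ inclU k A := by
    rw [← PrincipalBundle.Hom.comp_h a, ← Category.assoc, hpa, hfq]
  obtain ⟨d, hd⟩ := exists_toIntClosure_comp_eq (L.bundle.h ≫ inclU k A) Q'.h p hph
  obtain ⟨e, he⟩ := exists_toIntClosure_comp_eq (h' ≫ inclU k A) Q.bundle.h q hq.w
  -- Two morphisms from the integral closure to an affine scheme agree once they agree on the bundle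
  -- itself, since its ring is a subring of the functions there.
  have hde : d ≫ PrincipalBundle.Hom.f a =
      intClosureMap (L.bundle.h ≫ inclU k A) (h' ≫ inclU k A) f hf' ≫ e := by
    apply over_eq_of_comp_eq _ (injective_toIntClosure_appTop (L.bundle.h ≫ inclU k A))
    have h1 := toIntClosure_map (L.bundle.h ≫ inclU k A) (h' ≫ inclU k A) f hf'
    rw [reassoc_of% hd, hpa, reassoc_of% h1, he]
  have hy' : (L.y ≫ d) ≫ PrincipalBundle.Hom.f a = Q.y := by
    rw [Category.assoc, hde, reassoc_of% hy, restrictPoint_comp hq Q.y e he]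
  let Qp : PointedBundle (baseX k A) (pointX k A) :=
    { bundle := Q'
      y := L.y ≫ d
      y_h := by rw [← PrincipalBundle.Hom.comp_h a, ← Category.assoc, hy', Q.y_h] }
  exact ⟨Qp, ⟨a, hy'⟩, π, hfin, hπ, hac, hπa⟩

/-- A morphism from a local bundle to the restriction of a finite pointed bundle `Q` factors
through a pointed bundle `Q' ⟶ Q` whose group is the image of the homomorphism of groups. -/
theorem exists_image_pointedBundle (L : LocalBundle k A) [IsAffine L.bundle.G.X.left]
    (Q : PointedBundle (baseX k A) (pointX k A)) (hQ : IsFinite Q.bundle.G.X.hom)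
    (v : L ⟶ rhoPointed.obj Q) :
    ∃ (Q' : PointedBundle (baseX k A) (pointX k A)) (a : Q' ⟶ Q)
      (π : L.bundle.G ⟶ Q'.bundle.G), IsFinite Q'.bundle.G.X.hom ∧
      IsSchemeTheoreticallyDominant π.hom.hom.left ∧
      IsClosedImmersion (PrincipalBundle.Hom.φ (PointedBundle.Hom.hom a)).hom.hom.left ∧
      π ≫ PrincipalBundle.Hom.φ (PointedBundle.Hom.hom a) =
        PrincipalBundle.Hom.φ (LocalBundle.Hom.hom v) :=
  exists_image_pointedBundle_of_isPullback L Q hQ (IsPullback.of_hasPullback _ _)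
    (PrincipalBundle.Hom.f (LocalBundle.Hom.hom v)) (PrincipalBundle.Hom.φ (LocalBundle.Hom.hom v))
    (PrincipalBundle.Hom.comp_h (LocalBundle.Hom.hom v))
    (PrincipalBundle.Hom.equivariant (LocalBundle.Hom.hom v))
    ((Category.assoc _ _ _).symm.trans
      (congrArg (· ≫ inclU k A) (PrincipalBundle.Hom.comp_h (LocalBundle.Hom.hom v))))
    (LocalBundle.Hom.y_f v)

end IntegralClosureLift

end LocalNori

namespace LocalNori

/-! ### Flatness of homomorphisms onto finite and profinite groups -/

section FlatLimits

/-- By the equational criterion: a relation has finitely many coefficients, so it lifts to some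
`R'`, is trivial there, and the trivialization maps back to `R`. -/
theorem flat_of_forall_exists {R S : Type u} [CommRing R] [CommRing S] [Algebra R S]
    (h : ∀ {l : ℕ} (c : Fin l → R), ∃ (R' : Type u) (_ : CommRing R') (_ : Algebra R' R)
      (_ : Algebra R' S), IsScalarTower R' R S ∧ Module.Flat R' S ∧
        ∀ i, c i ∈ (algebraMap R' R).range) : Module.Flat R S := by
  rw [Module.Flat.iff_forall_isTrivialRelation]
  intro l c x hcx
  obtain ⟨R', _, _, _, _, hflat, hg⟩ := h c
  choose c' hc' using hg
  have h1 : ∑ i, c' i • x i = 0 := by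
    rw [← hcx]
    refine Finset.sum_congr rfl fun i _ ↦ ?_
    rw [← hc', algebraMap_smul]
  have h2 : Module.IsTrivialRelation c' x :=
    Module.Flat.isTrivialRelation_of_sum_smul_eq_zero h1
  obtain ⟨n, a, y, hxy, ha⟩ := h2
  refine ⟨n, fun i j ↦ algebraMap R' R (a i j), y, fun i ↦ ?_, fun j ↦ ?_⟩
  · rw [hxy]
    exact Finset.sum_congr rfl fun j _ ↦ (algebraMap_smul R _ _).symm
  · simp_rw [← hc', ← map_mul, ← map_sum, ha, map_zero]

/-- A ring homomorphism is flat and surjective on spectra if its source is the filtered union of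
images of Artinian rings over which the target is flat and faithful. -/
theorem flat_and_surjective_of_forall_finset {R S : Type u} [CommRing R] [CommRing S]
    (f : R →+* S) (h : ∀ s : Finset R, ∃ (R' : Type u) (_ : CommRing R') (g : R' →+* R),
      IsArtinianRing R' ∧ (∀ x ∈ s, x ∈ g.range) ∧ (f.comp g).Flat ∧
      Function.Injective (f.comp g)) :
    f.Flat ∧ Function.Surjective (PrimeSpectrum.comap f) := by
  classical
  have hf : Function.Injective f := by
    rw [injective_iff_map_eq_zero]
    intro x hx
    obtain ⟨R', _, g, -, hg, -, hinj⟩ := h {x}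
    obtain ⟨y, rfl⟩ := hg x (by simp)
    rw [hinj (a₁ := y) (a₂ := 0) (by simpa using hx), map_zero]
  constructor
  · let _ := f.toAlgebra
    refine flat_of_forall_exists (R := R) (S := S) fun c ↦ ?_
    obtain ⟨R', _, g, -, hg, hflat, -⟩ := h (Finset.univ.image c)
    let _ := g.toAlgebra
    let _ := (f.comp g).toAlgebra
    exact ⟨R', inferInstance, inferInstance, inferInstance, .of_algebraMap_eq fun _ ↦ rfl, hflat,
      fun i ↦ hg (c i) (by simp)⟩
  · intro p
    -- Comparable primes of `R` have equal contractions to each Artinian `R'`, so they are equal: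
    -- every prime is minimal. Minimal primes lie in the image of the spectrum under an injective
    -- homomorphism.
    have hp : p.asIdeal ∈ minimalPrimes R := by
      rw [minimalPrimes_eq_minimals]
      refine ⟨p.isPrime, fun q hq hqp x hx ↦ ?_⟩
      obtain ⟨R', _, g, _, hg, -, -⟩ := h {x}
      obtain ⟨y, rfl⟩ := hg x (by simp)
      have : (q.comap g).IsPrime := Ideal.IsPrime.comap g (hK := hq)
      have : (q.comap g).IsMaximal := IsArtinianRing.isMaximal_of_isPrime _
      have h1 : q.comap g = p.asIdeal.comap g :=
        this.eq_of_le (Ideal.IsPrime.comap g).ne_top (Ideal.comap_mono hqp)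
      have h2 : y ∈ p.asIdeal.comap g := hx
      rw [← h1] at h2
      exact h2
    obtain ⟨q, hq, hqp⟩ := Ideal.exists_comap_eq_of_mem_minimalPrimes_of_injective hf _ hp
    exact ⟨⟨q, hq⟩, PrimeSpectrum.ext hqp⟩

/-- Flatness of `a` says that `f` becomes flat after base change along itself; as `f` is injective
on functions and `Y` is Artinian, this descends. -/
lemma flat_of_isPullback_of_isArtinianRing {X Y P : Scheme.{u}} [IsAffine X] [IsAffine Y]
    {f : X ⟶ Y} {a b : P ⟶ X} (h : IsPullback a b f f) [Flat a] [IsArtinianRing Γ(Y, ⊤)]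
    (hf : Function.Injective f.appTop) : f.appTop.hom.Flat := by
  let _ := f.appTop.hom.toAlgebra
  have h1 : IsPullback (a ≫ X.isoSpec.hom) (b ≫ X.isoSpec.hom) (Spec.map f.appTop)
      (Spec.map f.appTop) :=
    IsPullback.of_iso h (Iso.refl _) X.isoSpec X.isoSpec Y.isoSpec (by simp) (by simp)
      (Scheme.isoSpec_hom_naturality f).symm (Scheme.isoSpec_hom_naturality f).symm
  have h2 : Flat (pullback.fst (Spec.map f.appTop) (Spec.map f.appTop)) := by
    rw [← h1.isoPullback_inv_fst]
    infer_instance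
  have h3 : Flat ((pullbackSpecIso Γ(Y, ⊤) Γ(X, ⊤) Γ(X, ⊤)).inv ≫ pullback.fst _ _) := by
    have : Flat (pullback.fst (Spec.map (CommRingCat.ofHom (algebraMap Γ(Y, ⊤) Γ(X, ⊤))))
      (Spec.map (CommRingCat.ofHom (algebraMap Γ(Y, ⊤) Γ(X, ⊤))))) := h2
    infer_instance
  rw [pullbackSpecIso_inv_fst, Flat.SpecMap_iff] at h3
  have h4 : Module.Flat Γ(X, ⊤) (TensorProduct Γ(Y, ⊤) Γ(X, ⊤) Γ(X, ⊤)) :=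
    RingHom.flat_algebraMap_iff.1 h3
  exact flat_of_flat_baseChange_of_isArtinianRing (R := Γ(Y, ⊤)) (S := Γ(X, ⊤)) hf

variable {k : Type u} [Field k]

/-- The kernel pair of a homomorphism of groups is trivialized by the kernel. -/
lemma isPullback_fst_mul {C : Type*} [Category C] [CartesianMonoidalCategory C] {G H : Grp C}
    (p : G ⟶ H) {N : C} {i : N ⟶ G.X} (hN : IsPullback i (toUnit N) p.hom.hom MonObj.one) :
    IsPullback (fst G.X N) (fst G.X N * (snd G.X N ≫ i)) p.hom.hom p.hom.hom := by
  have hi : i ≫ p.hom.hom = 1 := hN.w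
  have hw : fst G.X N ≫ p.hom.hom = (fst G.X N * (snd G.X N ≫ i)) ≫ p.hom.hom := by
    rw [MonObj.mul_comp, Category.assoc, hi, MonObj.comp_one, mul_one]
  refine IsPullback.of_isLimit' ⟨hw⟩ (PullbackCone.IsLimit.mk _
    (fun s ↦ lift s.fst (hN.lift (s.fst⁻¹ * s.snd) (toUnit _) ?_)) ?_ ?_ ?_)
  · rw [MonObj.mul_comp, ← s.condition, GrpObj.inv_comp, inv_mul_cancel]
    rfl
  · intro s
    simp
  · intro s
    rw [MonObj.comp_mul, lift_fst, ← Category.assoc, lift_snd, hN.lift_fst, mul_inv_cancel_left]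
  · intro s m hm hm'
    rw [MonObj.comp_mul, hm] at hm'
    apply CartesianMonoidalCategory.hom_ext
    · rw [lift_fst, hm]
    · rw [lift_snd]
      apply hN.hom_ext
      · rw [hN.lift_fst, ← hm', inv_mul_cancel_left, Category.assoc]
      · exact toUnit_unique _ _

lemma isArtinianRing_appTop_of_isFinite {X : Scheme.{u}} (f : X ⟶ Spec (.of k)) [IsFinite f] :
    IsArtinianRing Γ(X, ⊤) := by
  have h1 : f.appTop.hom.Finite := IsFinite.finite_app (f := f) ⊤ (isAffineOpen_top (Spec (.of k)))
  have h2 : ((Scheme.ΓSpecIso (.of k)).inv ≫ f.appTop).hom.Finite := by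
    rw [CommRingCat.hom_comp]
    exact h1.comp (RingHom.Finite.of_surjective _
      (ConcreteCategory.bijective_of_isIso (Scheme.ΓSpecIso (.of k)).inv).2)
  let _ : Algebra k Γ(X, ⊤) := ((Scheme.ΓSpecIso (.of k)).inv ≫ f.appTop).hom.toAlgebra
  have : Module.Finite k Γ(X, ⊤) := h2
  exact IsArtinianRing.of_finite k _

/-- With `N` the kernel of `p`, the kernel pair `G ×_H G` is `G × N`, which is flat over `G` since
`k` is a field. Dominance makes `p` injective on functions, and those on `H` form an Artinian ring,
so flatness descends along `p`. -/
theorem flat_of_isSchemeTheoreticallyDominant {G H : Grp (Over (Spec (.of k)))} (p : G ⟶ H)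
    [IsAffine G.X.left] (hH : IsFinite H.X.hom)
    [hp : IsSchemeTheoreticallyDominant p.hom.hom.left] : p.hom.hom.left.appTop.hom.Flat := by
  have : IsAffine H.X.left := isAffine_of_isAffineHom (Y := Spec (.of k)) H.X.hom
  have hN := IsPullback.of_hasPullback p.hom.hom (MonObj.one : 𝟙_ _ ⟶ H.X)
  rw [toUnit_unique (pullback.snd _ _) (toUnit _)] at hN
  have h1 := isPullback_fst_mul p hN
  have hart : IsArtinianRing Γ(H.X.left, ⊤) := by
    have : IsFinite H.X.hom := hH
    exact isArtinianRing_appTop_of_isFinite H.X.hom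
  have hsq : IsPullback (fst G.X (pullback p.hom.hom MonObj.one)).left
      (fst G.X (pullback p.hom.hom MonObj.one) * (snd G.X _ ≫ pullback.fst p.hom.hom MonObj.one)).left
      p.hom.hom.left p.hom.hom.left := h1.map (Over.forget _)
  exact flat_of_isPullback_of_isArtinianRing hsq
    (injective_appTop_of_isSchemeTheoreticallyDominant p.hom.hom.left)

end FlatLimits

end LocalNori

namespace LocalNori

/-! ### Finite levels of pro-objects -/

section ProObjects

variable {k : Type u} [Field k] {S : Over (Spec (.of k))} {E : Type*} [Category E]

/-- The constant system on one object. It lets the initial object of `𝒞^ind(X, x)` be mapped to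
objects with finite group. -/
lemma isProObject_of_hasFiniteGroup (F : E ⥤ PrincipalBundle S) (T : E)
    (h : HasFiniteGroup F T) : IsProObject F T := by
  have : IsCofiltered (Discrete PUnit.{u + 1}) := inferInstance
  have key (H : E ⥤ Over (Spec (.of k))) : Nonempty (IsLimit (H.mapCone
      (Cone.mk T (𝟙 ((Functor.const (Discrete PUnit.{u + 1})).obj T))))) :=
    ⟨{ lift := fun s ↦ s.π.app ⟨⟨⟩⟩
       fac := fun s j ↦ by
        obtain ⟨⟨⟩⟩ := j
        simp
       uniq := fun s m hm ↦ by simpa using hm ⟨⟨⟩⟩ }⟩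
  exact ⟨Discrete PUnit.{u + 1}, inferInstance, this, (Functor.const _).obj T, 𝟙 _, fun _ ↦ h,
    key _, key _⟩

lemma isAffine_of_hasFiniteGroup (F : E ⥤ PrincipalBundle S) (T : E) (h : HasFiniteGroup F T) :
    IsAffine (F.obj T).G.X.left :=
  have : IsFinite (F.obj T).G.X.hom := h
  isAffine_of_isAffineHom (Y := Spec (.of k)) (F.obj T).G.X.hom

lemma IsProObject.isAffine {F : E ⥤ PrincipalBundle S} {T : E} (h : IsProObject F T) :
    IsAffine (F.obj T).G.X.left := by
  obtain ⟨J, _, _, D, c, hfin, ⟨hG⟩, -⟩ := h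
  have := IsCofiltered.isConnected J
  have h1 := isLimitOfPreserves (Over.forget _) hG
  have (i : J) : IsAffine (((D ⋙ F ⋙ PrincipalBundle.groupFunctor S) ⋙ Over.forget _).obj i) :=
    isAffine_of_hasFiniteGroup F _ (hfin i)
  exact Scheme.isAffine_of_isLimit _ h1

/-- Finitely many functions on the group of a pro-object come from a group at a finite level. -/
lemma IsProObject.exists_forall_mem_range {F : E ⥤ PrincipalBundle S} {T : E}
    (h : IsProObject F T) (s : Finset Γ((F.obj T).G.X.left, ⊤)) :
    ∃ (T' : E) (a : T ⟶ T'), HasFiniteGroup F T' ∧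
      ∀ x ∈ s, x ∈ (PrincipalBundle.Hom.φ (F.map a)).hom.hom.left.appTop.hom.range := by
  classical
  obtain ⟨J, _, _, D, c, hfin, ⟨hG⟩, -⟩ := h
  have := IsCofiltered.isConnected J
  have h1 := isLimitOfPreserves (Over.forget _) hG
  have (i : J) : IsAffine (((D ⋙ F ⋙ PrincipalBundle.groupFunctor S) ⋙ Over.forget _).obj i) :=
    isAffine_of_hasFiniteGroup F _ (hfin i)
  have h2 (x : Γ((F.obj T).G.X.left, ⊤)) : ∃ i,
      x ∈ (PrincipalBundle.Hom.φ (F.map (c.app i))).hom.hom.left.appTop.hom.range := by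
    obtain ⟨i, t, ht⟩ := exists_appTop_π_eq_of_isAffine_of_isLimit _ _ h1 x
    exact ⟨i, t, ht⟩
  choose i hi using h2
  obtain ⟨j, hj⟩ := IsCofiltered.inf_objs_exists (s.image i)
  refine ⟨D.obj j, c.app j, hfin j, fun x hx ↦ ?_⟩
  obtain ⟨f⟩ := hj (Finset.mem_image_of_mem i hx)
  obtain ⟨t, ht⟩ := hi x
  have h3 : c.app (i x) = c.app j ≫ D.map f := by
    rw [← c.naturality]
    exact (Category.id_comp _).symm
  rw [h3, F.map_comp] at ht
  exact ⟨(PrincipalBundle.Hom.φ (F.map (D.map f))).hom.hom.left.appTop t, ht⟩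

end ProObjects

/-! ### Faithful flatness -/

section Main

variable {k A : Type u} [Field k] [CommRing A] [IsLocalRing A] [Algebra k A]
  [IsCompleteNormalGerm k A]

/-- Universality of `T` makes every finite level `D` of `T` factor through the image `Q'` of `L` in
`D`, so finitely many functions on the group of `T` always come from a group onto which that of `L`
maps dominantly. No universality of `L` is involved. -/
theorem isFaithfullyFlat_groupHom (L : LocIndCat k A) (T : XIndCat k A) (hT : IsInitial T)
    (u : L ⟶ (rhoInd k A).obj T) : IsFaithfullyFlat (groupHom u) := by
  have : IsAffine L.obj.bundle.G.X.left := L.property.isAffine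
  have : IsAffine T.obj.bundle.G.X.left := T.property.isAffine
  have key := flat_and_surjective_of_forall_finset (groupHom u).hom.hom.left.appTop.hom (fun s ↦ by
    obtain ⟨D, c, hD, hs⟩ := T.property.exists_forall_mem_range s
    obtain ⟨Q', a, π, hfin, hπ, hac, hπa⟩ := exists_image_pointedBundle L.obj D hD
      (u.hom ≫ rhoPointed.map c)
    let D' : XIndCat k A := ⟨D, isProObject_of_hasFiniteGroup _ _ hD⟩
    let Q'' : XIndCat k A := ⟨Q', isProObject_of_hasFiniteGroup _ _ hfin⟩
    let τ : T ⟶ Q'' := hT.to Q''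
    -- Two morphisms from the initial object to `D` coincide.
    have hτ : τ.hom ≫ a = c :=
      congrArg InducedCategory.Hom.hom (hT.hom_ext (τ ≫ (⟨a⟩ : Q'' ⟶ D')) ⟨c⟩)
    let φτ : T.obj.bundle.G ⟶ Q'.bundle.G :=
      PrincipalBundle.Hom.φ (PointedBundle.Hom.hom τ.hom)
    let φa : Q'.bundle.G ⟶ D.bundle.G := PrincipalBundle.Hom.φ (PointedBundle.Hom.hom a)
    let φc : T.obj.bundle.G ⟶ D.bundle.G := PrincipalBundle.Hom.φ (PointedBundle.Hom.hom c)
    have hφ : φτ ≫ φa = φc :=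
      congrArg (fun f ↦ PrincipalBundle.Hom.φ (PointedBundle.Hom.hom f)) hτ
    -- Both homomorphisms have the same composite with the closed immersion `φa`, a monomorphism.
    have hπφ : groupHom u ≫ φτ = π := by
      have := mono_of_isClosedImmersion φa.hom.hom
      have h1 : (groupHom u ≫ φτ) ≫ φa = π ≫ φa := by
        rw [Category.assoc, hφ]
        exact hπa.symm
      have h2 : (groupHom u ≫ φτ).hom.hom = π.hom.hom :=
        (cancel_mono φa.hom.hom).1 (congrArg (fun f ↦ f.hom.hom) h1)
      ext1
      ext1
      exact congrArg CommaMorphism.left h2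
    have hcomp : π.hom.hom.left.appTop =
        φτ.hom.hom.left.appTop ≫ (groupHom u).hom.hom.left.appTop := by
      rw [← hπφ]
      exact Scheme.Hom.comp_appTop _ _
    have hart : IsArtinianRing Γ(Q'.bundle.G.X.left, ⊤) :=
      have := hfin
      isArtinianRing_appTop_of_isFinite Q'.bundle.G.X.hom
    have : IsAffine Q'.bundle.G.X.left :=
      have := hfin
      isAffine_of_isAffineHom (Y := Spec (.of k)) Q'.bundle.G.X.hom
    have hflat := flat_of_isSchemeTheoreticallyDominant π hfin
    have hinj := injective_appTop_of_isSchemeTheoreticallyDominant π.hom.hom.left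
    rw [hcomp] at hflat hinj
    refine ⟨Γ(Q'.bundle.G.X.left, ⊤), inferInstance, φτ.hom.hom.left.appTop.hom, hart,
      fun x hx ↦ ?_, hflat, hinj⟩
    obtain ⟨t, ht⟩ := hs x hx
    refine ⟨φa.hom.hom.left.appTop t, ?_⟩
    have hc : φc.hom.hom.left.appTop = φa.hom.hom.left.appTop ≫ φτ.hom.hom.left.appTop := by
      rw [← hφ]
      exact Scheme.Hom.comp_appTop _ _
    rw [← ht]
    exact (congrArg (fun r ↦ r.hom t) hc).symm)
  constructor
  · rw [HasRingHomProperty.iff_of_isAffine (P := @Flat)]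
    exact key.1
  · have h1 : Surjective (Spec.map (groupHom u).hom.hom.left.appTop) := ⟨key.2⟩
    have h2 := Scheme.isoSpec_hom_naturality (groupHom u).hom.hom.left
    have h3 : (groupHom u).hom.hom.left = L.obj.bundle.G.X.left.isoSpec.hom ≫
        Spec.map (groupHom u).hom.hom.left.appTop ≫ T.obj.bundle.G.X.left.isoSpec.inv := by
      rw [reassoc_of% h2, Iso.hom_inv_id, Category.comp_id]
    rw [h3]
    infer_instance

end Main

end LocalNori

namespace LocalNori

/-! ### Flat descent and flat base change of functions -/

section FlatDescent

lemma flat_codescendsAlong_faithfullyFlat :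
    RingHom.CodescendsAlong (fun {R S : Type u} _ _ (f : R →+* S) ↦ f.Flat)
      (fun {R S : Type u} _ _ (f : R →+* S) ↦ f.FaithfullyFlat) := by
  apply RingHom.CodescendsAlong.mk _ RingHom.Flat.respectsIso
  introv h H
  rw [RingHom.faithfullyFlat_algebraMap_iff] at h
  rw [RingHom.flat_algebraMap_iff] at H ⊢
  exact Module.Flat.of_flat_tensorProduct R T S

instance : MorphismProperty.DescendsAlong @Flat.{u} (@Surjective ⊓ @Flat ⊓ @QuasiCompact) :=
  HasRingHomProperty.descendsAlong_flat flat_codescendsAlong_faithfullyFlat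

/-- A morphism to an affine scheme inducing an isomorphism on global functions does so after a flat
affine base change. -/
lemma isIso_appTop_of_isPullback_of_flat {V Z E E' : Scheme.{u}} {p : V ⟶ Z} {e : E ⟶ Z}
    {p' : E' ⟶ E} {e' : E' ⟶ V} (hp : IsPullback p' e' e p) [IsAffine Z] [IsAffine E] [Flat e]
    [CompactSpace V] [QuasiSeparatedSpace V] [IsIso p.appTop] : IsIso p'.appTop := by
  have key := (isIso_pushoutSection_iff hp.flip (US := ⊤) (UT := ⊤) (UX := ⊤) (UY := ⊤) le_top
    le_top (by simp)).1 (isIso_pushoutSection_of_isQuasiSeparated_of_flat_right _ _ _ _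
      (isAffineOpen_top _) (isAffineOpen_top _) isCompact_univ
      (isQuasiSeparated_univ_iff.2 inferInstance))
  have h1 : p.appLE ⊤ ⊤ le_top = p.appTop := Scheme.Hom.appLE_eq_app _
  rw [h1] at key
  have := key.isIso_inr_of_isIso
  have h2 : p'.appLE ⊤ ⊤ le_top = p'.appTop := Scheme.Hom.appLE_eq_app _
  exact h2 ▸ this

end FlatDescent

/-! ### Recognizing a restricted bundle -/

section Restriction

variable {k : Type u} [Field k]

lemma toIntClosure_hom {A : Type u} [CommRing A] [Algebra k A] {V : Over (Spec (.of k))}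
    (g : V ⟶ baseX k A) : toIntClosure g ≫ intClosureHom g = g := by
  apply Over.OverMorphism.ext
  have h1 : CommRingCat.ofHom (toIntClosureRing g) ≫
      CommRingCat.ofHom (intClosureRing g).subtype =
      (Scheme.ΓSpecIso (.of A)).inv ≫ g.left.appTop := rfl
  change (V.left.toSpecΓ ≫ Spec.map _) ≫ Spec.map _ = _
  rw [Category.assoc, ← Spec.map_comp, h1, toSpecΓ_comp_specMap]

lemma isPullback_lift_lift_eq_id {C : Type*} [Category C] {X Y Z P P' : C} {f : X ⟶ Z} {g : Y ⟶ Z}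
    {a : P ⟶ X} {b : P ⟶ Y} {a' : P' ⟶ X} {b' : P' ⟶ Y} (h : IsPullback a b f g)
    (h' : IsPullback a' b' f g) : h'.lift a b h.w ≫ h.lift a' b' h'.w = 𝟙 P := by
  apply h.hom_ext <;> simp

lemma PrincipalBundle.hom_equivariant_of_isPullback {S S' : Over (Spec (.of k))} {j : S' ⟶ S}
    (W : PrincipalBundle S') (P : PrincipalBundle S) {p : W.V ⟶ P.V}
    (hp : IsPullback p W.h P.h j) (φ : W.G ≅ P.G)
    (hact : W.act ≫ p = (p ⊗ₘ φ.hom.hom.hom) ≫ P.act) {V' : Over (Spec (.of k))}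
    {q : V' ⟶ P.V} {h' : V' ⟶ S'} (hq : IsPullback q h' P.h j) :
    W.act ≫ hq.lift p W.h hp.w = (hq.lift p W.h hp.w ⊗ₘ φ.hom.hom.hom) ≫ P.baseChangeAct hq := by
  apply hq.hom_ext
  · rw [Category.assoc, hq.lift_fst, hact, Category.assoc, baseChangeAct_fst, ← Category.assoc]
    congr 1
    apply CartesianMonoidalCategory.hom_ext <;> simp
  · rw [Category.assoc, hq.lift_snd, Category.assoc, baseChangeAct_snd, tensorHom_fst_assoc,
      hq.lift_snd, W.isPullback.w]

lemma PrincipalBundle.inv_equivariant_of_isPullback {S S' : Over (Spec (.of k))} {j : S' ⟶ S}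
    (W : PrincipalBundle S') (P : PrincipalBundle S) {p : W.V ⟶ P.V}
    (hp : IsPullback p W.h P.h j) (φ : W.G ≅ P.G)
    (hact : W.act ≫ p = (p ⊗ₘ φ.hom.hom.hom) ≫ P.act) {V' : Over (Spec (.of k))}
    {q : V' ⟶ P.V} {h' : V' ⟶ S'} (hq : IsPullback q h' P.h j) :
    P.baseChangeAct hq ≫ hp.lift q h' hq.w = (hp.lift q h' hq.w ⊗ₘ φ.inv.hom.hom) ≫ W.act := by
  have hφ : φ.inv.hom.hom ≫ φ.hom.hom.hom = 𝟙 _ :=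
    congrArg (fun f : P.G ⟶ P.G ↦ f.hom.hom) φ.inv_hom_id
  apply hp.hom_ext
  · rw [Category.assoc, hp.lift_fst, Category.assoc, hact, baseChangeAct_fst, ← Category.assoc]
    congr 1
    apply CartesianMonoidalCategory.hom_ext <;> simp [hφ]
  · rw [Category.assoc, hp.lift_snd, baseChangeAct_snd, Category.assoc, ← W.isPullback.w,
      tensorHom_fst_assoc, hp.lift_snd]

/-- A principal bundle over `U` which is the restriction of a principal bundle `P` over `X` is
isomorphic to the restriction of `P`. -/
noncomputable def PrincipalBundle.isoRestrict {S S' : Over (Spec (.of k))} {j : S' ⟶ S}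
    (W : PrincipalBundle S') (P : PrincipalBundle S) {p : W.V ⟶ P.V}
    (hp : IsPullback p W.h P.h j) (φ : W.G ≅ P.G)
    (hact : W.act ≫ p = (p ⊗ₘ φ.hom.hom.hom) ≫ P.act) {V' : Over (Spec (.of k))}
    {q : V' ⟶ P.V} {h' : V' ⟶ S'} (hq : IsPullback q h' P.h j) : W ≅ P.baseChange hq where
  hom := ⟨hq.lift p W.h hp.w, φ.hom, hq.lift_snd _ _ _,
    hom_equivariant_of_isPullback W P hp φ hact hq⟩
  inv := ⟨hp.lift q h' hq.w, φ.inv, hp.lift_snd _ _ _,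
    inv_equivariant_of_isPullback W P hp φ hact hq⟩
  hom_inv_id := hom_ext (isPullback_lift_lift_eq_id hp hq) φ.hom_inv_id
  inv_hom_id := hom_ext (isPullback_lift_lift_eq_id hq hp) φ.inv_hom_id

end Restriction

/-! ### Extending a quotient of a restricted bundle to `X` -/

section Extension

variable {k : Type u} [Field k] {A : Type u} [CommRing A] [IsLocalRing A] [Algebra k A]
  [IsCompleteNormalGerm k A]

variable (k A) in
-- Since `Γ(U, 𝒪) = A`, the canonical map `U ⟶ Spec Γ(U, 𝒪)` is the open immersion `U ⟶ X` up to
-- isomorphism.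
lemma isQuasiAffine_baseU : (baseU k A).left.IsQuasiAffine := by
  have := compactSpace_baseU k A
  have h1 := isIso_inclU_appTop k A
  have h2 : IsOpenImmersion (inclU k A).left :=
    inferInstanceAs (IsOpenImmersion (puncturedSpec A).ι)
  have h3 : (inclU k A).left ≫ (baseX k A).left.toSpecΓ ≫ inv (Spec.map (inclU k A).left.appTop) =
      (baseU k A).left.toSpecΓ := by
    rw [Scheme.toSpecΓ_naturality_assoc, IsIso.hom_inv_id, Category.comp_id]
  have h4 : IsOpenImmersion (baseU k A).left.toSpecΓ := by
    rw [← h3]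
    infer_instance
  constructor

/-- A principal bundle over `U` is the restriction of the spectrum of its ring of functions. -/
lemma PrincipalBundle.exists_affine_extension (W : PrincipalBundle (baseU k A)) :
    ∃ (Z : Over (Spec (.of k))) (g : Z ⟶ baseX k A) (p : W.V ⟶ Z), IsAffineHom g.left ∧
      IsIso p.left.appTop ∧ IsPullback p W.h g (inclU k A) := by
  have := isQuasiAffine_baseU k A
  have h1 := isIso_inclU_appTop k A
  have := compactSpace_of_bundle W
  have hq : W.V.left.IsQuasiAffine := Scheme.IsQuasiAffine.of_isAffineHom W.h.left
  let t : Spec Γ(W.V.left, ⊤) ⟶ (baseX k A).left :=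
    Spec.map ((Scheme.ΓSpecIso (.of A)).inv ≫ (W.h ≫ inclU k A).left.appTop)
  have ht : W.V.left.toSpecΓ ≫ t = (W.h ≫ inclU k A).left := toSpecΓ_comp_specMap _
  let g : Over.mk (t ≫ (baseX k A).hom) ⟶ baseX k A := Over.homMk t
  let p : W.V ⟶ Over.mk (t ≫ (baseX k A).hom) := Over.homMk W.V.left.toSpecΓ (by
    have := congrArg (· ≫ (baseX k A).hom) ht
    simp only [Category.assoc] at this
    exact this.trans (Over.w (W.h ≫ inclU k A)))
  have hw : p ≫ g = W.h ≫ inclU k A := Over.OverMorphism.ext ht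
  refine ⟨_, g, p, inferInstanceAs (IsAffineHom t), ?_, ?_⟩
  · change IsIso W.V.left.toSpecΓ.appTop
    rw [Scheme.toSpecΓ_appTop]
    infer_instance
  · refine IsPullback.of_map (Over.forget _) hw ?_
    -- `W.V ⟶ U` is affine over a quasi-affine scheme, so its square of affinizations is cartesian;
    -- `e` identifies `Spec Γ(U, 𝒪)` with `X`.
    have h2 := Scheme.isPullback_toSpecΓ_toSpecΓ W.h.left
    let e : Spec Γ((baseU k A).left, ⊤) ⟶ (baseX k A).left :=
      Spec.map ((Scheme.ΓSpecIso (.of A)).inv ≫ (inclU k A).left.appTop)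
    have he : (baseU k A).left.toSpecΓ ≫ e = (inclU k A).left := toSpecΓ_comp_specMap _
    have het : Spec.map W.h.left.appTop ≫ e = t := by
      rw [← Spec.map_comp, Category.assoc, ← Scheme.Hom.comp_appTop, ← Over.comp_left]
    have h3 : IsPullback (𝟙 _) (Spec.map W.h.left.appTop) t e :=
      IsPullback.of_horiz_isIso ⟨by rw [het, Category.id_comp]⟩
    have h4 := h2.flip.paste_horiz h3
    rw [Category.comp_id, he] at h4
    exact h4

/-- Suppose that the restriction to `U` of a principal bundle `Q` over `X` maps to a principal
bundle `W` over `U`. If `W` is the restriction of an affine `X`-scheme `Z` with the same functions,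
then `Z ×_X Q ≅ Q × H`, where `H` is the group of `W`. -/
lemma PrincipalBundle.exists_isPullback_tensor (W : PrincipalBundle (baseU k A))
    (hH : IsAffineHom W.G.X.hom) (Q : PrincipalBundle (baseX k A)) {Q' : Over (Spec (.of k))}
    {q : Q' ⟶ Q.V} {h' : Q' ⟶ baseU k A} (hq : IsPullback q h' Q.h (inclU k A)) (f : Q' ⟶ W.V)
    (hf : f ≫ W.h = h') {Z : Over (Spec (.of k))} {g : Z ⟶ baseX k A} {p : W.V ⟶ Z}
    [IsAffineHom g.left] [IsIso p.left.appTop] (hp : IsPullback p W.h g (inclU k A)) :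
    ∃ a : Q.V ⊗ W.G.X ⟶ Z, IsPullback a (fst Q.V W.G.X) g Q.h := by
  have : IsAffine Z.left := isAffine_of_isAffineHom (Y := Spec (.of A)) g.left
  have : IsAffine Q.V.left := isAffine_of_isAffineHom (Y := Spec (.of A)) Q.h.left
  have : IsAffine W.G.X.left := isAffine_of_isAffineHom (Y := Spec (.of k)) W.G.X.hom
  have hfst : IsAffineHom (fst Q.V W.G.X ≫ Q.h).left := inferInstanceAs
    (IsAffineHom ((fst Q.V W.G.X).left ≫ Q.h.left))
  have hfst' : Flat (fst Q.V W.G.X ≫ Q.h).left := inferInstanceAs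
    (Flat ((fst Q.V W.G.X).left ≫ Q.h.left))
  -- `Q × H` is affine and flat over `X`, so its functions are determined over `U`. This extends the
  -- orbit map `(y, g) ↦ f(y) g` to `Q × H`.
  have hqH : IsIso (q ▷ W.G.X).left.appTop :=
    isIso_appTop_of_flat (h := fst Q.V W.G.X ≫ Q.h) (h' := fst _ _ ≫ h')
      ((isPullback_fst_whiskerRight q W.G.X).flip.paste_vert hq)
  obtain ⟨a, ha⟩ := over_exists_comp_eq_of_isIso_appTop (q ▷ W.G.X) ((f ▷ W.G.X) ≫ W.act ≫ p)
  have hag : a ≫ g = fst Q.V W.G.X ≫ Q.h := by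
    apply over_eq_of_comp_eq (q ▷ W.G.X) (ConcreteCategory.bijective_of_isIso _).1
    rw [reassoc_of% ha, hp.w, ← reassoc_of% W.isPullback.w, whiskerRight_fst_assoc,
      whiskerRight_fst_assoc, reassoc_of% hf, hq.w]
  refine ⟨a, ?_⟩
  have hE := IsPullback.of_hasPullback g Q.h
  let c : Q.V ⊗ W.G.X ⟶ pullback g Q.h := hE.lift a (fst _ _) hag
  -- Over `U` the map `f` gives a section of `W` over `Q'`, so `Q' ×_U W.V` is `Q' × H`.
  have h1 : IsPullback (f ▷ W.G.X ≫ W.act) (fst Q' W.G.X) W.h h' := by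
    have := (isPullback_fst_whiskerRight f W.G.X).flip.paste_horiz W.isPullback.flip
    rwa [hf] at this
  have h2 : IsPullback (f ▷ W.G.X ≫ W.act) (fst Q' W.G.X ≫ q) (p ≫ g) Q.h := by
    rw [hp.w]
    exact h1.paste_vert hq.flip
  have h3 : IsPullback (f ▷ W.G.X ≫ W.act) (q ▷ W.G.X ≫ c) p (pullback.fst g Q.h) := by
    refine IsPullback.of_bot ?_ ?_ hE
    · rw [Category.assoc, hE.lift_snd, whiskerRight_fst]
      exact h2
    · rw [Category.assoc, Category.assoc, hE.lift_fst, ha]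
  have hE' : IsPullback (pullback.fst g Q.h).left (pullback.snd g Q.h).left g.left Q.h.left :=
    hE.map (Over.forget _)
  have : Flat (pullback.fst g Q.h).left :=
    MorphismProperty.of_isPullback (P := @Flat) hE'.flip Q.flat
  have : IsAffineHom (pullback.fst g Q.h).left :=
    MorphismProperty.of_isPullback (P := @IsAffineHom) hE'.flip Q.isAffineHom
  have : IsAffine (pullback g Q.h).left := isAffine_of_isAffineHom (pullback.fst g Q.h).left
  have := compactSpace_of_bundle W
  have := isQuasiAffine_baseU k A
  have : W.V.left.IsQuasiAffine := Scheme.IsQuasiAffine.of_isAffineHom W.h.left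
  have h3' : IsPullback (q ▷ W.G.X ≫ c).left (f ▷ W.G.X ≫ W.act).left (pullback.fst g Q.h).left
      p.left := h3.flip.map (Over.forget _)
  -- `Z` is not yet known to be flat over `X`, but `Z ×_X Q` is flat over `Z`. So its functions are
  -- those over `W.V`, by flat base change from `Γ(Z, 𝒪) = Γ(W.V, 𝒪)`, and `c` is an isomorphism on
  -- functions between affine schemes.
  have h4 := isIso_appTop_of_isPullback_of_flat h3'
  have h5 : IsIso (c.left.appTop ≫ (q ▷ W.G.X).left.appTop) := by
    rw [← Scheme.Hom.comp_appTop, ← Over.comp_left]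
    exact h4
  have h6 : IsIso c.left.appTop := IsIso.of_isIso_comp_right _ (q ▷ W.G.X).left.appTop
  have h7 : IsIso c.left := isIso_of_isIso_appTop c.left
  have h8 : IsIso ((Over.forget _).map c) := h7
  have h9 : IsIso c := isIso_of_reflects_iso c (Over.forget _)
  exact IsPullback.of_iso_pullback ⟨hag⟩ (asIso c) (hE.lift_fst _ _ _) (hE.lift_snd _ _ _)

/-- The action of the structure group extends from `U` to `X`. -/
lemma PrincipalBundle.exists_act_extension (W : PrincipalBundle (baseU k A))
    (hH : IsAffineHom W.G.X.hom) {Z : Over (Spec (.of k))} {g : Z ⟶ baseX k A} {p : W.V ⟶ Z}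
    (hg : IsAffineHom g.left) (hg' : Flat g.left) (hg'' : Surjective g.left)
    (hp : IsPullback p W.h g (inclU k A)) :
    ∃ (P : PrincipalBundle (baseX k A)) (p' : W.V ⟶ P.V) (φ : W.G ≅ P.G),
      (IsFinite W.G.X.hom → IsFinite P.G.X.hom) ∧ IsPullback p' W.h P.h (inclU k A) ∧
      W.act ≫ p' = (p' ⊗ₘ φ.hom.hom.hom) ≫ P.act := by
  have : IsAffine Z.left := isAffine_of_isAffineHom (Y := Spec (.of A)) g.left
  have : IsAffine W.G.X.left := isAffine_of_isAffineHom (Y := Spec (.of k)) W.G.X.hom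
  have hpG (K : Over (Spec (.of k))) [IsAffine K.left] : IsIso (p ▷ K).left.appTop := by
    have : IsAffineHom (fst Z K ≫ g).left := inferInstanceAs
      (IsAffineHom ((fst Z K).left ≫ g.left))
    have : Flat (fst Z K ≫ g).left := inferInstanceAs (Flat ((fst Z K).left ≫ g.left))
    exact isIso_appTop_of_flat (h := fst Z K ≫ g) (h' := fst _ _ ≫ W.h)
      ((isPullback_fst_whiskerRight p K).flip.paste_vert hp)
  have hpi : IsIso p.left.appTop := isIso_appTop_of_flat hp
  have hp' := (ConcreteCategory.bijective_of_isIso p.left.appTop).1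
  have hpG' (K : Over (Spec (.of k))) [IsAffine K.left] :=
    have := hpG K
    (ConcreteCategory.bijective_of_isIso (p ▷ K).left.appTop).1
  have := hpG W.G.X
  obtain ⟨act, hact⟩ := over_exists_comp_eq_of_isIso_appTop (p ▷ W.G.X) (W.act ≫ p)
  have hT {T : Over (Spec (.of k))} (v : T ⟶ W.V) (x : T ⟶ W.G.X) :
      lift (v ≫ p) x ≫ act = lift v x ≫ W.act ≫ p := by
    rw [← hact, ← Category.assoc, lift_whiskerRight]
  have hag : act ≫ g = fst Z W.G.X ≫ g := by
    apply over_eq_of_comp_eq (p ▷ W.G.X) (hpG' _)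
    rw [reassoc_of% hact, hp.w, ← reassoc_of% W.isPullback.w, whiskerRight_fst_assoc, hp.w]
  -- The action axioms are checked at the universal points, where the sources are `Z` and `Z × H ×
  -- H`; morphisms from these to the affine `Z` are determined over `U`.
  have hone : lift (𝟙 Z) (1 : Z ⟶ W.G.X) ≫ act = 𝟙 Z := by
    apply over_eq_of_comp_eq p hp'
    rw [comp_lift_assoc, MonObj.comp_one, Category.comp_id]
    conv_lhs => rw [← Category.id_comp p]
    rw [hT, ← Category.assoc, W.act_one, Category.id_comp]
  have hmul : lift (fst Z (W.G.X ⊗ W.G.X)) ((snd Z (W.G.X ⊗ W.G.X) ≫ fst _ _) *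
      (snd Z (W.G.X ⊗ W.G.X) ≫ snd _ _)) ≫ act =
      lift (lift (fst Z (W.G.X ⊗ W.G.X)) (snd Z (W.G.X ⊗ W.G.X) ≫ fst _ _) ≫ act)
        (snd Z (W.G.X ⊗ W.G.X) ≫ snd _ _) ≫ act := by
    apply over_eq_of_comp_eq (p ▷ (W.G.X ⊗ W.G.X)) (hpG' _)
    have h1 : p ▷ (W.G.X ⊗ W.G.X) ≫ fst Z (W.G.X ⊗ W.G.X) = fst _ _ ≫ p :=
      whiskerRight_fst _ _
    have h2 : p ▷ (W.G.X ⊗ W.G.X) ≫ snd Z (W.G.X ⊗ W.G.X) = snd _ _ := whiskerRight_snd _ _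
    rw [comp_lift_assoc, comp_lift_assoc, comp_lift_assoc, MonObj.comp_mul, h1, reassoc_of% h2,
      reassoc_of% h2, hT, hT, ← Category.assoc (lift _ _) W.act p,
      ← Category.assoc (lift _ _) W.act p, hT, W.act_mul, Category.assoc]
  -- `Z × H` and `Z ×_X Z` are both affine and flat over `X`, and both restrict to `W.V × H` over
  -- `U`; hence they have the same functions.
  have hpull : IsPullback (fst Z W.G.X) act g g := by
    have hE := IsPullback.of_hasPullback g g
    let c : Z ⊗ W.G.X ⟶ pullback g g := hE.lift (fst _ _) act hag.symm
    have h1 : IsPullback (p ▷ W.G.X ≫ c) (fst W.V W.G.X) (pullback.fst g g) p := by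
      refine IsPullback.of_right ?_ ?_ hE.flip
      · rw [Category.assoc, hE.lift_snd, hact]
        have := W.isPullback.flip.paste_horiz hp
        rwa [← hp.w] at this
      · rw [Category.assoc, hE.lift_fst, whiskerRight_fst]
    have hE' : IsPullback (pullback.fst g g).left (pullback.snd g g).left g.left g.left :=
      hE.map (Over.forget _)
    have hfl : Flat (pullback.fst g g).left :=
      MorphismProperty.of_isPullback (P := @Flat) hE'.flip hg'
    have haf : IsAffineHom (pullback.fst g g).left :=
      MorphismProperty.of_isPullback (P := @IsAffineHom) hE'.flip hg
    have : IsAffine (pullback g g).left := isAffine_of_isAffineHom (pullback.fst g g).left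
    have : IsAffineHom (pullback.fst g g ≫ g).left := inferInstanceAs
      (IsAffineHom ((pullback.fst g g).left ≫ g.left))
    have : Flat (pullback.fst g g ≫ g).left := inferInstanceAs
      (Flat ((pullback.fst g g).left ≫ g.left))
    have h4 := isIso_appTop_of_flat (h1.paste_vert hp)
    have h5 : IsIso (c.left.appTop ≫ (p ▷ W.G.X).left.appTop) := by
      rw [← Scheme.Hom.comp_appTop, ← Over.comp_left]
      exact h4
    have h6 : IsIso c.left.appTop := IsIso.of_isIso_comp_right _ (p ▷ W.G.X).left.appTop
    have h7 : IsIso c.left := isIso_of_isIso_appTop c.left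
    have h8 : IsIso ((Over.forget _).map c) := h7
    have h9 : IsIso c := isIso_of_reflects_iso c (Over.forget _)
    exact IsPullback.of_iso_pullback ⟨hag.symm⟩ (asIso c) (hE.lift_fst _ _ _) (hE.lift_snd _ _ _)
  exact ⟨
    { G := W.G
      V := Z
      h := g
      act := act
      act_one := fun v ↦ by
        have := congrArg (v ≫ ·) hone
        simpa [comp_lift_assoc, MonObj.comp_one] using this
      act_mul := fun v x y ↦ by
        have := congrArg (lift v (lift x y) ≫ ·) hmul
        simpa [comp_lift_assoc, MonObj.comp_mul] using this
      isAffineHom := hg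
      flat := hg'
      surjective := hg''
      isPullback := hpull }, p, Iso.refl _, id, hp, by
      rw [← hact]
      rfl⟩

/-- The points of the integral closure of the restriction to `U` of an integral flat `X`-scheme. -/
lemma restrictPoint_comp_eq {V V' : Over (Spec (.of k))} {h : V ⟶ baseX k A} {p : V' ⟶ V}
    {h' : V' ⟶ baseU k A} (hp : IsPullback p h' h (inclU k A)) [IsAffineHom h.left] [Flat h.left]
    (y : 𝟙_ (Over (Spec (.of k))) ⟶ intClosure (h' ≫ inclU k A))
    (d : intClosure (h' ≫ inclU k A) ⟶ V) (hd : toIntClosure (h' ≫ inclU k A) ≫ d = p) :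
    restrictPoint hp (y ≫ d) = y := by
  have : IsAffine V.left := isAffine_of_isAffineHom (Y := Spec (.of A)) h.left
  have h1 := isIso_appTop_of_flat hp
  -- Restriction from `V` to `V'` is an isomorphism on functions and factors through the subring of
  -- integral elements, so `d` is an isomorphism: `V` is the integral closure of `V'`.
  have h2 : IsIso (d.left.appTop ≫ (toIntClosure (h' ≫ inclU k A)).left.appTop) := by
    rw [← Scheme.Hom.comp_appTop, ← Over.comp_left, hd]
    exact h1
  have h3 := injective_toIntClosure_appTop (h' ≫ inclU k A)
  have h4 : Function.Bijective
      ((toIntClosure (h' ≫ inclU k A)).left.appTop ∘ d.left.appTop) :=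
    ConcreteCategory.bijective_of_isIso
      (d.left.appTop ≫ (toIntClosure (h' ≫ inclU k A)).left.appTop)
  have h5 : IsIso d.left.appTop := (ConcreteCategory.isIso_iff_bijective _).2
    ⟨h4.1.of_comp, fun x ↦ (h4.2 ((toIntClosure _).left.appTop x)).imp fun y hy ↦ h3 hy⟩
  have : IsAffine (intClosure (h' ≫ inclU k A)).left :=
    inferInstanceAs (IsAffine (Spec (.of (intClosureRing (h' ≫ inclU k A)))))
  have h6 : IsIso d.left := isIso_of_isIso_appTop d.left
  have : Mono d := Over.mono_of_mono_left d
  rw [← cancel_mono d, restrictPoint_comp hp _ d hd]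

/-- A morphism of local bundles over an isomorphism of principal bundles is an isomorphism. -/
noncomputable def LocalBundle.isoMk {L M : LocalBundle k A} (e : L.bundle ≅ M.bundle)
    (h : L.y ≫ LocalBundle.extend e.hom = M.y) : L ≅ M where
  hom := ⟨e.hom, h⟩
  inv := ⟨e.inv, by
    rw [← h, Category.assoc, ← LocalBundle.extend_comp, e.hom_inv_id, LocalBundle.extend_id,
      Category.comp_id]⟩
  hom_inv_id := LocalBundle.Hom.ext e.hom_inv_id
  inv_hom_id := LocalBundle.Hom.ext e.inv_hom_id

/-- A local bundle under a finite group which is the image of the restriction of a principal bundle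
over `X` is the restriction of a pointed bundle over `X`. -/
theorem exists_iso_rhoPointed (L : LocalBundle k A) (hL : IsFinite L.bundle.G.X.hom)
    (Q : PrincipalBundle (baseX k A)) {Q' : Over (Spec (.of k))} {q : Q' ⟶ Q.V}
    {h' : Q' ⟶ baseU k A} (hq : IsPullback q h' Q.h (inclU k A)) (f : Q' ⟶ L.bundle.V)
    (hf : f ≫ L.bundle.h = h') :
    ∃ M : PointedBundle (baseX k A) (pointX k A), IsFinite M.bundle.G.X.hom ∧
      Nonempty (rhoPointed.obj M ≅ L) := by
  have hH : IsAffineHom L.bundle.G.X.hom := inferInstance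
  obtain ⟨Z, g, p, hg, hpi, hp⟩ := L.bundle.exists_affine_extension
  obtain ⟨a, ha⟩ := L.bundle.exists_isPullback_tensor hH Q hq f hf hp
  have ha' : IsPullback (fst Q.V L.bundle.G.X).left a.left Q.h.left g.left :=
    ha.flip.map (Over.forget _)
  -- The base change of `g` along the flat cover `Q ⟶ X` is the projection `Q × H ⟶ Q`, which is
  -- flat.
  have hflat : Flat g.left :=
    MorphismProperty.of_isPullback_of_descendsAlong (P := @Flat)
      (Q := @Surjective ⊓ @Flat ⊓ @QuasiCompact) ha' ⟨⟨Q.surjective, Q.flat⟩, inferInstance⟩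
      inferInstance
  have hsurj : Surjective g.left := by
    have h1 : Surjective (fst Q.V L.bundle.G.X).left := by
      have h2 : lift (𝟙 Q.V) (1 : Q.V ⟶ L.bundle.G.X) ≫ fst _ _ = 𝟙 _ := lift_fst _ _
      have h3 : Surjective ((lift (𝟙 Q.V) (1 : Q.V ⟶ L.bundle.G.X)).left ≫
          (fst Q.V L.bundle.G.X).left) := by
        rw [← Over.comp_left, h2]
        exact inferInstanceAs (Surjective (𝟙 Q.V.left))
      exact Surjective.of_comp (lift (𝟙 Q.V) (1 : Q.V ⟶ L.bundle.G.X)).left _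
    have h4 : Surjective (a.left ≫ g.left) := by
      rw [← ha'.w]
      infer_instance
    exact Surjective.of_comp a.left g.left
  obtain ⟨P, p, φ, hfin, hp, hact⟩ := L.bundle.exists_act_extension hH hg hflat hsurj hp
  have := P.isIntegralHom_h (hfin hL)
  obtain ⟨d, hd⟩ := exists_toIntClosure_comp_eq (L.bundle.h ≫ inclU k A) P.h p hp.w
  have hdh : d ≫ P.h = intClosureHom (L.bundle.h ≫ inclU k A) := by
    apply over_eq_of_comp_eq _ (injective_toIntClosure_appTop (L.bundle.h ≫ inclU k A))
    rw [reassoc_of% hd, hp.w, toIntClosure_hom]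
  let M : PointedBundle (baseX k A) (pointX k A) :=
    { bundle := P
      y := L.y ≫ d
      y_h := by rw [Category.assoc, hdh, L.y_h] }
  have hP := IsPullback.of_hasPullback P.h (inclU k A)
  -- The point chosen on `P` is the image of `L.y` under the isomorphism `d`; restricting it to the
  -- integral closure returns `L.y`.
  have key : L.y ≫ intClosureMap (L.bundle.h ≫ inclU k A) (pullback.snd P.h (inclU k A) ≫ inclU k A)
      (hP.lift p L.bundle.h hp.w) (by rw [← Category.assoc, hP.lift_snd]) =
      restrictPoint hP (L.y ≫ d) := by
    have h1 := restrictPoint_map hp hP (L.y ≫ d) (𝟙 _) (hP.lift p L.bundle.h hp.w)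
      (by rw [hP.lift_fst, Category.comp_id]) (by rw [← Category.assoc, hP.lift_snd])
    rwa [restrictPoint_comp_eq hp L.y d hd, Category.comp_id] at h1
  exact ⟨M, hfin hL, ⟨(LocalBundle.isoMk (M := rhoPointed.obj M)
    (L.bundle.isoRestrict P hp φ hact hP) key).symm⟩⟩

end Extension

end LocalNori

theorem proposition2p3 (k A : Type u) [Field k] [CommRing A] [IsLocalRing A] [Algebra k A]
    [IsCompleteNormalGerm k A] :
    (∀ (L : LocIndCat k A) (hL : IsInitial L) (T : XIndCat k A) (hT : IsInitial T),
      IsFaithfullyFlat (rhoStar hL hT)) ∧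
    (∀ (L : LocIndCat k A) (T : XIndCat k A) (_ : IsInitial T) (u : L ⟶ (rhoInd k A).obj T),
      IsFaithfullyFlat (groupHom u)) ∧
    (∀ (T : XCat k A) (L : LocCat k A) (_ : (rho k A).obj T ⟶ L),
      ∃ Z : XCat k A, Nonempty ((rho k A).obj Z ≅ L)) := by
  refine ⟨fun L hL T hT ↦ isFaithfullyFlat_groupHom L T hT _,
    fun L T hT u ↦ isFaithfullyFlat_groupHom L T hT u, fun T L u ↦ ?_⟩
  obtain ⟨M, hM, ⟨e⟩⟩ := exists_iso_rhoPointed L.obj L.property T.obj.bundle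
    (IsPullback.of_hasPullback _ _) (PrincipalBundle.Hom.f (LocalBundle.Hom.hom u.hom))
    (PrincipalBundle.Hom.comp_h (LocalBundle.Hom.hom u.hom))
  exact ⟨⟨M, hM⟩, ⟨ObjectProperty.isoMk _ e⟩⟩
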